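/- Let $\Omega\subset\mathbf{C}$ be a convex polygon with $n\ge 3$ vertices $z_1,\dots,z_n$ listed counterclockwise ($z_{n+1}=z_1$), all interior angles being less than $\pi$. Put $\alpha_i=\arg(z_{i+1}-z_i)$, $\sigma_i=\tfrac12|z_{i+1}-z_i|$, $m_i=\tfrac12(z_i+z_{i+1})$. Let $PW^{\sigma}_{\mathrm{sym}}$ be the real vector space of all entire functions $\lambda\mapsto\int_{-\sigma}^{\sigma}e^{-\mathrm{i}\lambda\tau}\varphi(\tau)\,d\tau$ with $\varphi\in L^2([-\sigma,\sigma];\mathbf{R})$, let $X_{\mathrm{sym}}=PW^{\sigma_1}_{\mathrm{sym}}\times\cdots\times PW^{\sigma_n}_{\mathrm{sym}}$, and for an $n$-tuple $\Phi=(\Phi_1,\dots,\Phi_n)$ of functions on $\mathbf{C}$ put $$(T\Phi)_i(\lambda)=\Phi_i(\lambda)+\sum_{j\ne i}e^{\mathrm{i}e^{-\mathrm{i}\alpha_i}(m_i-m_j)\lambda}\,\Phi_j\big(e^{-\mathrm{i}(\alpha_i-\alpha_j)}\lambda\big),\qquad 1\le i\le n.$$ Let $\gamma_1,\dots,\gamma_n$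 be curves in $\mathbf{C}$ which are semi-infinite (parametrised by arc length $s\in[0,\infty)$), locally of finite length, and each of which eventually coincides with the negative real axis (for each $i$ there is $c_i\in\mathbf{R}$ with $\gamma_i(s)=c_i-s$ for all large $s$); $ds$ denotes arc length. Let $\Phi^{\mathbf t}\in X_{\mathrm{sym}}$ and, for $\Phi,\Psi\in X_{\mathrm{sym}}$, set $$a(\Phi,\Psi)=\Re\sum_{i=1}^n\int_{\gamma_i}(T\Phi)_i\overline{(T\Psi)_i}\,ds,\qquad \ell(\Psi)=-\Im\sum_{i=1}^n\int_{\gamma_i}(T\Phi^{\mathbf t})_i\overline{(T\Psi)_i}\,ds,$$ $$I[\Phi]=\sum_{i=1}^n\int_{\gamma_i}\big|T(\Phi-\mathrm{i}\Phi^{\mathbf t})_i\big|^2\,ds.$$ Then all these integrals converge absolutely, and there is exactly one $\Phi\in X_{\mathrm{sym}}$ such that $$a(\Phi,\Psi)=\ell(\Psi)\qquad\text{for all }\Psi\in X_{\mathrm{sym}}.$$ Equivalently, $I$ has exactly one minimizer over $X_{\mathrm{sym}}$: an element $\Phi\in X_{\mathrm{sym}}$ satisfies $a(\Phi,\Psi)=\ell(\Psi)$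 for all $\Psi\in X_{\mathrm{sym}}$ if and only if it minimizes $I$ over $X_{\mathrm{sym}}$. -/

import Mathlib

open MeasureTheory Set

noncomputable section

namespace SpectralDN

/-- A (strictly) convex polygon in the plane with `n ≥ 3` vertices `z₁, …, zₙ`, listed in
counterclockwise order: every vertex that is not an endpoint of the side from `zᵢ` to `zᵢ₊₁`
lies strictly to the left of the directed line from `zᵢ` to `zᵢ₊₁`. -/
def IsConvexPolygon {n : ℕ} (P : Polygon ℂ n) : Prop :=
  3 ≤ n ∧ ∀ i j : Fin n, j ≠ i → j ≠ finRotate n i →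
    0 < (starRingEnd ℂ (P (finRotate n i) - P i) * (P j - P i)).im

/-- The angle `αᵢ = arg (zᵢ₊₁ - zᵢ)` that the `i`-th side makes with the positive real axis. -/
def angle {n : ℕ} (P : Polygon ℂ n) (i : Fin n) : ℝ :=
  Complex.arg (P (finRotate n i) - P i)

/-- Half the length of the `i`-th side: `2 σᵢ = |zᵢ₊₁ - zᵢ|`. -/
def halfLength {n : ℕ} (P : Polygon ℂ n) (i : Fin n) : ℝ :=
  ‖P (finRotate n i) - P i‖ / 2

/-- The mid-point `mᵢ = (zᵢ + zᵢ₊₁) / 2` of the `i`-th side. -/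
def midPoint {n : ℕ} (P : Polygon ℂ n) (i : Fin n) : ℂ :=
  (P i + P (finRotate n i)) / 2

/-- The Fourier transform `φ̂(z) = ∫_{-σ}^{σ} e^{-i z τ} φ(τ) dτ`, `z ∈ ℂ`, of a real valued
function on `[-σ, σ]`. -/
def fourier (σ : ℝ) (φ : ℝ → ℝ) (z : ℂ) : ℂ :=
  ∫ τ in (-σ)..σ, Complex.exp (-Complex.I * z * τ) * φ τ

/-- The real Paley-Wiener space `PW^σ_sym`: the (entire) Fourier transforms of real valued square
integrable functions on `[-σ, σ]`. -/
def PWsym (σ : ℝ) : Set (ℂ → ℂ) :=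
  {f | ∃ φ : ℝ → ℝ, MemLp φ 2 (volume.restrict (Icc (-σ) σ)) ∧ f = fourier σ φ}

/-- `X_sym = PW^{σ₁}_sym × ⋯ × PW^{σₙ}_sym`. -/
def Xsym {n : ℕ} (P : Polygon ℂ n) : Set (Fin n → ℂ → ℂ) :=
  {Φ | ∀ i, Φ i ∈ PWsym (halfLength P i)}

/-- The operator `T = I + K`, where
`(K Φ)ᵢ(z) = ∑_{j ≠ i} exp (i e^{-i αᵢ} (mᵢ - mⱼ) z) Φⱼ (e^{-i (αᵢ - αⱼ)} z)`. -/
def T {n : ℕ} (P : Polygon ℂ n) (Φ : Fin n → ℂ → ℂ) (i : Fin n) (z : ℂ) : ℂ :=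
  Φ i z + ∑ j ∈ Finset.univ.erase i,
    Complex.exp (Complex.I * Complex.exp (-Complex.I * angle P i)
        * (midPoint P i - midPoint P j) * z)
      * Φ j (Complex.exp (-Complex.I * (angle P i - angle P j : ℝ)) * z)

/-- A locally rectifiable semi-infinite curve `γ : [0, ∞) → ℂ`, parametrised by arc length, that
eventually coincides with the negative real axis, traversed towards `-∞`. (Values of `γ` at
negative parameters play no role.) -/
def IsContour (γ : ℝ → ℂ) : Prop :=
  HasUnitSpeedOn γ (Ici 0) ∧ ∃ c S : ℝ, ∀ s ≥ S, γ s = ((c - s : ℝ) : ℂ)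

/-- The bilinear form `a(Φ, Ψ) = Re ∑ᵢ ∫_{γᵢ} (TΦ)ᵢ conj((TΨ)ᵢ) ds`. -/
def a {n : ℕ} (P : Polygon ℂ n) (γ : Fin n → ℝ → ℂ) (Φ Ψ : Fin n → ℂ → ℂ) : ℝ :=
  (∑ i, ∫ s in Ici (0 : ℝ), T P Φ i (γ i s) * starRingEnd ℂ (T P Ψ i (γ i s))).re

/-- The linear form `ℓ(Ψ) = - Im ∑ᵢ ∫_{γᵢ} (TΦᵗ)ᵢ conj((TΨ)ᵢ) ds`. -/
def ell {n : ℕ} (P : Polygon ℂ n) (γ : Fin n → ℝ → ℂ) (Φt Ψ : Fin n → ℂ → ℂ) : ℝ :=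
  -(∑ i, ∫ s in Ici (0 : ℝ), T P Φt i (γ i s) * starRingEnd ℂ (T P Ψ i (γ i s))).im

/-- The functional `I[Φ] = ∑ᵢ ∫_{γᵢ} |T(Φ - i Φᵗ)ᵢ|² ds`. -/
def functional {n : ℕ} (P : Polygon ℂ n) (γ : Fin n → ℝ → ℂ) (Φt Φ : Fin n → ℂ → ℂ) : ℝ :=
  ∑ i, ∫ s in Ici (0 : ℝ), ‖T P (Φ - Complex.I • Φt) i (γ i s)‖ ^ 2

/-- `Φ ∈ X_sym` solves the weak problem `a(Φ, Ψ) = ℓ(Ψ)` for all `Ψ ∈ X_sym`. -/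
def IsWeakSolution {n : ℕ} (P : Polygon ℂ n) (γ : Fin n → ℝ → ℂ) (Φt Φ : Fin n → ℂ → ℂ) : Prop :=
  Φ ∈ Xsym P ∧ ∀ Ψ ∈ Xsym P, a P γ Φ Ψ = ell P γ Φt Ψ

/-- `Φ ∈ X_sym` minimises the functional `I` over `X_sym`. -/
def IsMinimizer {n : ℕ} (P : Polygon ℂ n) (γ : Fin n → ℝ → ℂ) (Φt Φ : Fin n → ℂ → ℂ) : Prop :=
  Φ ∈ Xsym P ∧ IsMinOn (functional P γ Φt) (Xsym P) Φ

end SpectralDN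

end

/-! ### Plancherel's theorem on `L¹ ∩ L²` and on the half line. -/

namespace SpectralDN
open FourierTransform Filter Topology
open scoped SchwartzMap ContDiff

/-! Put the real functions behind `Φ` side by side as one density `φ` on `∂Ω`. The rotations and
shifts in `T` then fit together: `(TΦ)ᵢ(z) = ∫ exp(z ξᵢ(p)) φ(p) ds(p)` over `∂Ω`, with `ξᵢ(p) = -i
e^{-iαᵢ}(p - mᵢ)`. By convexity `Re ξᵢ(p)`, the distance from `p` to the line of side `i`, is
nonnegative. On the negative axis `z = -r` the `i`-th component is thus a Fourier transform of the
density on side `i` plus Laplace transforms of the densities on the other sides, all bounded from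
`L²` to `L²(0, ∞)`. The compact part of a contour adds a bounded term, so `T` induces a bounded
real-linear operator `A` from `L²(∂Ω; ℝ)` to `L²` of the contours (`contourOp`). With `b = i TΦᵗ`
the forms are `a(Φ,Ψ) = ⟨Aφ, Aψ⟩` and `ℓ(Ψ) = ⟨b, Aψ⟩`, and the functional is `I[Φ] = ‖Aφ - b‖²`.
Everything then follows by projection onto the range of `A`, once `c‖φ‖ ≤ ‖Aφ‖` is known for some `c
> 0` (`exists_mul_norm_le_contourOp`).

The lower bound is proved by compactness. If it fails, there are unit vectors `φₖ` with `Aφₖ → 0`,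
weakly convergent along a subsequence to some `φ₀` with `Aφ₀ = 0`. Two facts contradict this: `A` is
injective, so `φ₀ = 0`; and a weakly null sequence with `Aφₖ → 0` converges in norm.

Injectivity (`ae_eq_zero_of_expTransform_eq_zero`): if one component vanishes on a half line,
analyticity makes all moments `∫ pᵏ φ ds` vanish. Then the logarithmic potential of `φ` vanishes
outside the closed polygon. It is continuous and inside it is the real part of a holomorphic
function, so it vanishes everywhere by the maximum principle. Circle averages of the potential
recover the mass of every disc, and Lebesgue differentiation gives `φ = 0`.

Norm convergence (`tendsto_zero_of_tendsto_bdryOp`): the `L²(0, ∞)` pairing of two transforms is a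
double integral with kernel `1/(conj ξ + ξ')`. Where this kernel is bounded, weakly null sequences
have vanishing pairings. This decouples the vertices: the density is cut at the midpoints of the
sides, and each corner piece is sent to zero by the two components belonging to its sides. At a
single corner of angle `θ` an explicit estimate holds (`corner_estimate`): rotating the contour
turns the cross term into `cos(θ/2)` times a squared norm on the bisecting ray, which leaves the
positive constant `1 - cos(θ/2)` because `θ < π`. -/

/-- On `L¹ ∩ L²` the Fourier integral represents the `L²` Fourier transform. -/
theorem fourierIntegral_ae_eq_fourier_toLp {f : ℝ → ℂ} (hf : Integrable f) (hf2 : MemLp f 2) :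
    𝓕 f =ᵐ[volume] (𝓕 (hf2.toLp f) : Lp ℂ 2 (volume : Measure ℝ)) := by
  have hcont : Continuous (𝓕 f) :=
    VectorFourier.fourierIntegral_continuous Real.continuous_fourierChar (by fun_prop) hf
  -- The `L²` transform is accessible through tempered distributions, so both functions are tested
  -- against smooth compactly supported functions. On either side the transform moves onto the test
  -- function.
  apply ae_eq_of_integral_contDiff_smul_eq hcont.locallyIntegrable
    ((Lp.memLp _).locallyIntegrable (by norm_num))
  intro g g_smooth g_cpt
  have hg₁ : HasCompactSupport (Complex.ofRealCLM ∘ g) := g_cpt.comp_left rfl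
  have hg₂ : ContDiff ℝ ∞ (Complex.ofRealCLM ∘ g) := by fun_prop
  set G : 𝓢(ℝ, ℂ) := hg₁.toSchwartzMap hg₂ with hG
  have hGg : ∀ x, G x = (g x : ℂ) := fun x => rfl
  have h1 : ∫ x, g x • (𝓕 (hf2.toLp f) : Lp ℂ 2 (volume : Measure ℝ)) x
      = ((𝓕 (hf2.toLp f) : Lp ℂ 2 (volume : Measure ℝ)) : 𝓢'(ℝ, ℂ)) G := by
    rw [Lp.toTemperedDistribution_apply]
    simp [hGg]
  have h2 : ∫ x, G x • 𝓕 f x = ∫ x, (𝓕 (G : ℝ → ℂ)) x • f x := by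
    have := VectorFourier.integral_fourierIntegral_smul_eq_flip (e := Real.fourierChar)
      (L := innerₗ ℝ) (μ := volume) (ν := volume) (f := f) (g := (G : ℝ → ℂ))
      Real.continuous_fourierChar continuous_inner hf (G.integrable)
    simp only [smul_eq_mul, flip_innerₗ] at this
    simp only [smul_eq_mul, mul_comm (G _), mul_comm _ (f _)]
    exact this
  rw [h1, ← Lp.fourier_toTemperedDistribution_eq, TemperedDistribution.fourier_apply,
    Lp.toTemperedDistribution_apply]
  have h3 : ∫ x, g x • 𝓕 f x = ∫ x, G x • 𝓕 f x := by simp [hGg]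
  rw [h3, h2, ← SchwartzMap.fourier_coe]
  apply integral_congr_ae
  filter_upwards [hf2.coeFn_toLp] with x hx
  rw [hx]

theorem memLp_two_fourierIntegral {f : ℝ → ℂ} (hf : Integrable f) (hf2 : MemLp f 2) :
    MemLp (𝓕 f) 2 :=
  (memLp_congr_ae (fourierIntegral_ae_eq_fourier_toLp hf hf2)).2 (Lp.memLp _)

theorem integral_norm_sq_toLp {α : Type*} [MeasurableSpace α] {μ : Measure α} (F : Lp ℂ 2 μ) :
    ∫ x, ‖F x‖ ^ 2 ∂μ = ‖F‖ ^ 2 := by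
  have h := L2.inner_def (𝕜 := ℂ) F F
  have h2 : (inner ℂ F F : ℂ) = ((‖F‖ ^ 2 : ℝ) : ℂ) := by
    rw [inner_self_eq_norm_sq_to_K]; norm_cast
  have h3 : ∫ a, (inner ℂ (F a) (F a) : ℂ) ∂μ = ((∫ x, ‖F x‖ ^ 2 ∂μ : ℝ) : ℂ) := by
    rw [← integral_complex_ofReal]
    congr 1; ext x
    rw [inner_self_eq_norm_sq_to_K]; norm_cast
  rw [h2, h3] at h
  exact_mod_cast h.symm

/-- Plancherel's theorem for the Fourier integral on `L¹ ∩ L²`. -/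
theorem integral_norm_sq_fourierIntegral {f : ℝ → ℂ} (hf : Integrable f) (hf2 : MemLp f 2) :
    ∫ x, ‖𝓕 f x‖ ^ 2 = ∫ x, ‖f x‖ ^ 2 := by
  have h1 : ∫ x, ‖𝓕 f x‖ ^ 2
      = ∫ x, ‖(𝓕 (hf2.toLp f) : Lp ℂ 2 (volume : Measure ℝ)) x‖ ^ 2 := by
    apply integral_congr_ae
    filter_upwards [fourierIntegral_ae_eq_fourier_toLp hf hf2] with x hx
    rw [hx]
  have h2 : ∫ x, ‖f x‖ ^ 2 = ∫ x, ‖(hf2.toLp f) x‖ ^ 2 := by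
    apply integral_congr_ae
    filter_upwards [hf2.coeFn_toLp] with x hx
    rw [hx]
  rw [h1, h2, integral_norm_sq_toLp, integral_norm_sq_toLp, Lp.norm_fourier_eq]

/-- The transform `r ↦ ∫ exp (-r ξ(y)) f(y) dm(y)` of a real function `f`. -/
noncomputable def expTransform {Y : Type*} [MeasurableSpace Y] (m : Measure Y) (ξ : Y → ℂ)
    (f : Y → ℝ) (r : ℝ) : ℂ :=
  ∫ y, Complex.exp (-((r : ℂ) * ξ y)) * f y ∂m

theorem expTransform_eq_fourierIntegral (f : ℝ → ℝ) (r : ℝ) :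
    expTransform volume (fun τ : ℝ => Complex.I * τ) f r
      = 𝓕 (fun τ : ℝ => (f τ : ℂ)) (r * (2 * Real.pi)⁻¹) := by
  rw [Real.fourier_eq', expTransform]
  congr 1
  ext τ
  rw [smul_eq_mul]
  congr 2
  simp only [RCLike.inner_apply, conj_trivial]
  push_cast
  have : (Real.pi : ℂ) ≠ 0 := by exact_mod_cast Real.pi_ne_zero
  field_simp

theorem memLp_two_expTransform_line {f : ℝ → ℝ} (hf : Integrable f) (hf2 : MemLp f 2) :
    MemLp (expTransform volume (fun τ : ℝ => Complex.I * τ) f) 2 := by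
  have h := memLp_two_fourierIntegral hf.ofReal hf2.ofReal
  have h2 : expTransform volume (fun τ : ℝ => Complex.I * τ) f
      = fun r => 𝓕 (fun τ : ℝ => (f τ : ℂ)) (r * (2 * Real.pi)⁻¹) := by
    ext r; exact expTransform_eq_fourierIntegral f r
  have hc : Continuous (𝓕 (fun τ : ℝ => (f τ : ℂ))) :=
    VectorFourier.fourierIntegral_continuous Real.continuous_fourierChar (by fun_prop) hf.ofReal
  rw [h2, memLp_two_iff_integrable_sq_norm (by fun_prop)]
  have h3 := (memLp_two_iff_integrable_sq_norm h.1).1 h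
  exact h3.comp_mul_right' (by positivity)

/-- Plancherel's theorem on the half line, for real functions. -/
theorem integral_norm_sq_expTransform_line {f : ℝ → ℝ} (hf : Integrable f) (hf2 : MemLp f 2) :
    ∫ r in Ioi (0 : ℝ), ‖expTransform volume (fun τ : ℝ => Complex.I * τ) f r‖ ^ 2
      = Real.pi * ∫ τ, f τ ^ 2 := by
  have h : ∫ x, ‖𝓕 (fun τ : ℝ => (f τ : ℂ)) x‖ ^ 2 = ∫ x, ‖(f x : ℂ)‖ ^ 2 :=
    integral_norm_sq_fourierIntegral hf.ofReal hf2.ofReal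
  have h1 : ∫ r, ‖expTransform volume (fun τ : ℝ => Complex.I * τ) f r‖ ^ 2
      = 2 * Real.pi * ∫ τ, f τ ^ 2 := by
    simp_rw [expTransform_eq_fourierIntegral]
    rw [Measure.integral_comp_mul_right (fun r => ‖𝓕 (fun τ : ℝ => (f τ : ℂ)) r‖ ^ 2), h,
      inv_inv, abs_of_pos (by positivity)]
    simp
  -- Since `f` is real, the transform at `-r` is the conjugate of the one at `r`. The modulus is
  -- even, and the half line carries half of `2π ∫ f²`.
  have h2 : ∀ r, ‖expTransform volume (fun τ : ℝ => Complex.I * τ) f r‖ ^ 2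
      = (fun s => ‖expTransform volume (fun τ : ℝ => Complex.I * τ) f s‖ ^ 2) |r| := by
    intro r
    rcases abs_choice r with h | h
    · simp [h]
    · simp only [h]
      have : expTransform volume (fun τ : ℝ => Complex.I * τ) f (-r)
          = starRingEnd ℂ (expTransform volume (fun τ : ℝ => Complex.I * τ) f r) := by
        unfold expTransform
        rw [← integral_conj]
        congr 1; ext τ
        simp [← Complex.exp_conj]
      rw [this, RCLike.norm_conj]
  rw [integral_congr_ae (.of_forall h2)] at h1
  rw [integral_comp_abs (f := fun s =>
    ‖expTransform volume (fun τ : ℝ => Complex.I * τ) f s‖ ^ 2)] at h1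
  linarith

end SpectralDN

/-! ### The Laplace transform on `L²(0, ∞)` and the pairing of two transforms. -/

namespace SpectralDN
open Filter Topology
open scoped ENNReal ComplexConjugate

/-- The Cauchy-Schwarz inequality for lower Lebesgue integrals. -/
theorem lintegral_mul_sq_le {α : Type*} [MeasurableSpace α] {μ : Measure α} {f g : α → ℝ≥0∞}
    (hf : AEMeasurable f μ) (hg : AEMeasurable g μ) :
    (∫⁻ x, f x * g x ∂μ) ^ 2 ≤ (∫⁻ x, f x ^ 2 ∂μ) * ∫⁻ x, g x ^ 2 ∂μ := by
  have h := ENNReal.lintegral_mul_le_Lp_mul_Lq μ Real.HolderConjugate.two_two hf hg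
  have h2 := pow_le_pow_left' h 2
  refine h2.trans (le_of_eq ?_)
  rw [mul_pow, ← ENNReal.rpow_natCast, ← ENNReal.rpow_natCast, ← ENNReal.rpow_mul,
    ← ENNReal.rpow_mul]
  norm_num

/-- This is `Γ(1/2) = √π` after scaling. It is the weight integral of the Schur test below, used
once in each variable. -/
theorem lintegral_exp_neg_mul_rpow {b : ℝ} (hb : 0 < b) :
    ∫⁻ t in Ioi (0 : ℝ), ENNReal.ofReal (t ^ (-(1 / 2 : ℝ)) * Real.exp (-(b * t)))
      = ENNReal.ofReal (√Real.pi * b ^ (-(1 / 2 : ℝ))) := by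
  have h := Real.integral_rpow_mul_exp_neg_mul_Ioi (a := 1 / 2) (by norm_num) hb
  have h1 : ((1 : ℝ) / 2 - 1) = -(1 / 2) := by norm_num
  rw [h1, Real.Gamma_one_half_eq, one_div b, Real.inv_rpow hb.le, ← Real.rpow_neg hb.le] at h
  rw [← ofReal_integral_eq_lintegral_ofReal, h, mul_comm]
  · apply Integrable.of_integral_ne_zero
    rw [h]
    positivity
  · filter_upwards [ae_restrict_mem measurableSet_Ioi] with t ht
    have : 0 < t := ht
    positivity

/-- The Laplace transform is bounded on `L²(0, ∞)`. -/
theorem lintegral_laplace_sq_le {c : ℝ} (hc : 0 < c) {g : ℝ → ℝ≥0∞} (hg : Measurable g) :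
    ∫⁻ r in Ioi (0 : ℝ), (∫⁻ t in Ioi (0 : ℝ), ENNReal.ofReal (Real.exp (-(r * c * t))) * g t) ^ 2
      ≤ ENNReal.ofReal (Real.pi / c) * ∫⁻ t in Ioi (0 : ℝ), g t ^ 2 := by
  -- Schur test: split the integrand as `t^{-1/4} e^{-rct/2}` times `t^{1/4} e^{-rct/2} g` and apply
  -- Cauchy-Schwarz. After Tonelli the remaining integral in `r` is of the same type, and `√π
  -- c^{-1/2} t^{1/2} · √π (ct)^{-1/2} = π/c`.
  have key : ∀ r ∈ Ioi (0 : ℝ),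
      (∫⁻ t in Ioi (0 : ℝ), ENNReal.ofReal (Real.exp (-(r * c * t))) * g t) ^ 2 ≤
        ENNReal.ofReal (√Real.pi * (r * c) ^ (-(1 / 2 : ℝ))) *
          ∫⁻ t in Ioi (0 : ℝ), ENNReal.ofReal (t ^ (1 / 2 : ℝ) * Real.exp (-(r * c * t)))
            * g t ^ 2 := by
    intro r hr
    have hr : 0 < r := hr
    rw [← lintegral_exp_neg_mul_rpow (by positivity)]
    have h := lintegral_mul_sq_le (μ := volume.restrict (Ioi (0 : ℝ)))
      (f := fun t => ENNReal.ofReal (t ^ (-(1 / 4 : ℝ)) * Real.exp (-(r * c * t / 2))))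
      (g := fun t => ENNReal.ofReal (t ^ (1 / 4 : ℝ) * Real.exp (-(r * c * t / 2))) * g t)
      (by fun_prop) (by fun_prop)
    have e1 : ∀ t : ℝ, Real.exp (-(r * c * t / 2)) ^ 2 = Real.exp (-(r * c * t)) := by
      intro t; rw [← Real.exp_nat_mul]; congr 1; push_cast; ring
    refine le_trans (le_of_eq ?_) (h.trans (le_of_eq ?_))
    · congr 1
      apply setLIntegral_congr_fun measurableSet_Ioi
      intro t ht
      have ht : 0 < t := ht
      dsimp only
      rw [← mul_assoc, ← ENNReal.ofReal_mul (by positivity)]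
      congr 2
      rw [← e1 t, mul_mul_mul_comm, ← Real.rpow_add ht]
      norm_num
      ring
    · congr 1
      · apply setLIntegral_congr_fun measurableSet_Ioi
        intro t ht
        have ht : 0 < t := ht
        dsimp only
        rw [← ENNReal.ofReal_pow (by positivity), mul_pow, e1, ← Real.rpow_natCast, ← Real.rpow_mul ht.le]
        norm_num
      · apply setLIntegral_congr_fun measurableSet_Ioi
        intro t ht
        have ht : 0 < t := ht
        dsimp only
        rw [mul_pow, ← ENNReal.ofReal_pow (by positivity), mul_pow, e1, ← Real.rpow_natCast (_ ^ _),
          ← Real.rpow_mul ht.le]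
        norm_num
  refine (setLIntegral_mono' measurableSet_Ioi key).trans ?_
  have h2 : ∀ r, ENNReal.ofReal (√Real.pi * (r * c) ^ (-(1 / 2 : ℝ))) *
          ∫⁻ t in Ioi (0 : ℝ), ENNReal.ofReal (t ^ (1 / 2 : ℝ) * Real.exp (-(r * c * t))) * g t ^ 2
      = ∫⁻ t in Ioi (0 : ℝ), ENNReal.ofReal (√Real.pi * (r * c) ^ (-(1 / 2 : ℝ))) *
         (ENNReal.ofReal (t ^ (1 / 2 : ℝ) * Real.exp (-(r * c * t))) * g t ^ 2) := by
    intro r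
    rw [lintegral_const_mul _ (by fun_prop)]
  simp_rw [h2]
  rw [lintegral_lintegral_swap (by fun_prop), ← lintegral_const_mul _ (by fun_prop)]
  apply setLIntegral_mono' measurableSet_Ioi
  intro t ht
  have ht : 0 < t := ht
  have h3 : ∀ r ∈ Ioi (0 : ℝ), ENNReal.ofReal (√Real.pi * (r * c) ^ (-(1 / 2 : ℝ))) *
         (ENNReal.ofReal (t ^ (1 / 2 : ℝ) * Real.exp (-(r * c * t))) * g t ^ 2)
      = (ENNReal.ofReal (√Real.pi * c ^ (-(1 / 2 : ℝ)) * t ^ (1 / 2 : ℝ)) * g t ^ 2) *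
        ENNReal.ofReal (r ^ (-(1 / 2 : ℝ)) * Real.exp (-((c * t) * r))) := by
    intro r hr
    have hr : 0 < r := hr
    rw [← mul_assoc, ← ENNReal.ofReal_mul (by positivity),
      mul_right_comm (ENNReal.ofReal (_ * t ^ (1 / 2 : ℝ))), ← ENNReal.ofReal_mul (by positivity)]
    congr 2
    rw [Real.mul_rpow hr.le hc.le, show -(c * t * r) = -(r * c * t) by ring]
    ring
  rw [setLIntegral_congr_fun measurableSet_Ioi h3, lintegral_const_mul _ (by fun_prop),
    lintegral_exp_neg_mul_rpow (by positivity), mul_right_comm,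
    ← ENNReal.ofReal_mul (by positivity)]
  apply le_of_eq
  congr 2
  rw [Real.mul_rpow hc.le ht.le, Real.rpow_neg hc.le, Real.rpow_neg ht.le]
  have e3 : (t ^ (1 / 2 : ℝ)) ≠ 0 := by positivity
  have e4 : (c ^ (1 / 2 : ℝ)) ^ 2 = c := by
    rw [← Real.rpow_natCast, ← Real.rpow_mul hc.le]; norm_num
  have e5 : √Real.pi ^ 2 = Real.pi := Real.sq_sqrt Real.pi_pos.le
  have e6 : (c ^ (1 / 2 : ℝ)) ≠ 0 := by positivity
  field_simp
  rw [e4, e5]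
  ring

theorem lintegral_laplace_sq_le' {c : ℝ} (hc : 0 < c) {g : ℝ → ℝ≥0∞}
    (hg : AEMeasurable g (volume.restrict (Ioi 0))) :
    ∫⁻ r in Ioi (0 : ℝ), (∫⁻ t in Ioi (0 : ℝ), ENNReal.ofReal (Real.exp (-(r * c * t))) * g t) ^ 2
      ≤ ENNReal.ofReal (Real.pi / c) * ∫⁻ t in Ioi (0 : ℝ), g t ^ 2 := by
  have h := lintegral_laplace_sq_le hc hg.measurable_mk
  have e1 : ∀ r : ℝ, ∫⁻ t in Ioi (0 : ℝ), ENNReal.ofReal (Real.exp (-(r * c * t))) * hg.mk g t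
      = ∫⁻ t in Ioi (0 : ℝ), ENNReal.ofReal (Real.exp (-(r * c * t))) * g t := fun r =>
    lintegral_congr_ae (hg.ae_eq_mk.mono fun t ht => by simp [ht])
  have e2 : ∫⁻ t in Ioi (0 : ℝ), hg.mk g t ^ 2 = ∫⁻ t in Ioi (0 : ℝ), g t ^ 2 :=
    lintegral_congr_ae (hg.ae_eq_mk.mono fun t ht => by simp [ht])
  simpa only [e1, e2] using h

section transform
variable {Y : Type*} [MeasurableSpace Y] {m : Measure Y} {ξ : Y → ℂ} {f g : Y → ℝ}

theorem norm_exp_neg_mul_le_one {r : ℝ} (hr : 0 ≤ r) {z : ℂ} (hz : 0 ≤ z.re) :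
    ‖Complex.exp (-((r : ℂ) * z))‖ ≤ 1 := by
  rw [Complex.norm_exp, Real.exp_le_one_iff]
  simp only [Complex.neg_re, Complex.re_ofReal_mul, neg_nonpos]
  positivity

theorem integrable_exp_neg_mul (hξ : Measurable ξ) (h0 : ∀ᵐ y ∂m, 0 ≤ (ξ y).re)
    (hf : Integrable f m) {r : ℝ} (hr : 0 ≤ r) :
    Integrable (fun y => Complex.exp (-((r : ℂ) * ξ y)) * f y) m := by
  refine Integrable.mono' hf.norm ?_ ?_
  · exact (by fun_prop : Measurable fun y => Complex.exp (-((r : ℂ) * ξ y))).aestronglyMeasurable.mul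
      hf.ofReal.1
  · filter_upwards [h0] with y hy
    rw [norm_mul, Complex.norm_real]
    exact mul_le_of_le_one_left (norm_nonneg _) (norm_exp_neg_mul_le_one hr hy)

theorem norm_expTransform_le (h0 : ∀ᵐ y ∂m, 0 ≤ (ξ y).re)
    (hf : Integrable f m) {r : ℝ} (hr : 0 ≤ r) :
    ‖expTransform m ξ f r‖ ≤ ∫ y, ‖f y‖ ∂m := by
  refine norm_integral_le_of_norm_le hf.norm ?_
  filter_upwards [h0] with y hy
  rw [norm_mul, Complex.norm_real]
  exact mul_le_of_le_one_left (norm_nonneg _) (norm_exp_neg_mul_le_one hr hy)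

theorem continuousOn_expTransform (hξ : Measurable ξ) (h0 : ∀ᵐ y ∂m, 0 ≤ (ξ y).re)
    (hf : Integrable f m) : ContinuousOn (expTransform m ξ f) (Ici 0) := by
  intro r hr
  refine continuousWithinAt_of_dominated (bound := fun y => ‖f y‖) ?_ ?_ hf.norm ?_
  · filter_upwards [self_mem_nhdsWithin] with s hs using (integrable_exp_neg_mul hξ h0 hf hs).1
  · filter_upwards [self_mem_nhdsWithin] with s hs
    filter_upwards [h0] with y hy
    rw [norm_mul, Complex.norm_real]
    exact mul_le_of_le_one_left (norm_nonneg _) (norm_exp_neg_mul_le_one hs hy)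
  · filter_upwards with y
    exact (by fun_prop : Continuous fun s : ℝ =>
      Complex.exp (-((s : ℂ) * ξ y)) * f y).continuousWithinAt

theorem aestronglyMeasurable_expTransform (hξ : Measurable ξ) (h0 : ∀ᵐ y ∂m, 0 ≤ (ξ y).re)
    (hf : Integrable f m) :
    AEStronglyMeasurable (expTransform m ξ f) (volume.restrict (Ioi 0)) :=
  ((continuousOn_expTransform hξ h0 hf).mono Ioi_subset_Ici_self).aestronglyMeasurable
    measurableSet_Ioi

theorem expTransform_add (hξ : Measurable ξ) (h0 : ∀ᵐ y ∂m, 0 ≤ (ξ y).re)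
    (hf : Integrable f m) (hg : Integrable g m) {r : ℝ} (hr : 0 ≤ r) :
    expTransform m ξ (f + g) r = expTransform m ξ f r + expTransform m ξ g r := by
  unfold expTransform
  rw [← integral_add (integrable_exp_neg_mul hξ h0 hf hr) (integrable_exp_neg_mul hξ h0 hg hr)]
  congr 1; ext y; simp [mul_add]

/-- Integration of the transform over the half line. -/
theorem integral_expTransform [SFinite m] (hξ : Measurable ξ) (h0 : ∀ᵐ y ∂m, 0 ≤ (ξ y).re)
    (hne : ∀ᵐ y ∂m, ξ y ≠ 0) (hf : Integrable f m)
    (hint : IntegrableOn (expTransform m ξ f) (Ioi 0))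
    (hker : Integrable (fun y => (f y : ℂ) / ξ y) m) :
    ∫ r in Ioi (0 : ℝ), expTransform m ξ f r = ∫ y, (f y : ℂ) / ξ y ∂m := by
  -- Fubini fails to apply directly because `Re ξ` may vanish. A factor `e^{-εr}` makes the double
  -- integral absolutely convergent. As `ε → 0` the two sides are dominated by the transform itself
  -- and by `f/ξ`, since `|ε + ξ| ≥ |ξ|` when `Re ξ ≥ 0`.
  set ε : ℕ → ℝ := fun k => 1 / ((k : ℝ) + 1) with hε
  have hεpos : ∀ k, 0 < ε k := fun k => Nat.one_div_pos_of_nat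
  have hεlim : Tendsto ε atTop (𝓝 0) := tendsto_one_div_add_atTop_nhds_zero_nat
  have heq : ∀ k, ∫ r in Ioi (0 : ℝ), (Real.exp (-(ε k * r)) : ℂ) * expTransform m ξ f r
      = ∫ y, (f y : ℂ) / (ε k + ξ y) ∂m := by
    intro k
    have h1 : ∀ r, (Real.exp (-(ε k * r)) : ℂ) * expTransform m ξ f r
        = ∫ y, Complex.exp (-(ε k + ξ y) * r) * f y ∂m := by
      intro r
      rw [expTransform, ← integral_const_mul]
      congr 1; ext y
      rw [← mul_assoc, Complex.ofReal_exp, ← Complex.exp_add]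
      congr 2
      push_cast; ring
    simp_rw [h1]
    rw [integral_integral_swap]
    · apply integral_congr_ae
      filter_upwards [h0] with y hy
      rw [integral_mul_const, integral_exp_mul_complex_Ioi]
      · have : (ε k : ℂ) + ξ y ≠ 0 := by
          intro h
          have := congrArg Complex.re h
          simp at this
          linarith [hεpos k]
        simp only [Complex.ofReal_zero, mul_zero, Complex.exp_zero]
        rw [neg_div_neg_eq]
        ring
      · simp; linarith [hεpos k]
    · have hexp : IntegrableOn (fun r => Real.exp (-ε k * r)) (Ioi 0) := by
        exact exp_neg_integrableOn_Ioi 0 (hεpos k)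
      have hb := Integrable.mul_prod hexp hf.norm
      refine Integrable.mono' hb ?_ ?_
      · refine AEStronglyMeasurable.mul ?_ hf.ofReal.1.comp_snd
        exact (by fun_prop : Measurable fun z : ℝ × Y =>
          Complex.exp (-(ε k + ξ z.2) * z.1)).aestronglyMeasurable
      · have hr : ∀ᵐ z ∂((volume.restrict (Ioi (0:ℝ))).prod m), 0 < z.1 :=
          Measure.quasiMeasurePreserving_fst.ae (ae_restrict_mem measurableSet_Ioi)
        have hy : ∀ᵐ z ∂((volume.restrict (Ioi (0:ℝ))).prod m), 0 ≤ (ξ z.2).re :=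
          Measure.quasiMeasurePreserving_snd.ae h0
        filter_upwards [hr, hy] with z hz1 hz2
        simp only [Function.uncurry, norm_mul, Complex.norm_real]
        gcongr
        rw [Complex.norm_exp]
        apply Real.exp_le_exp.2
        simp
        nlinarith
  have hl : Tendsto (fun k => ∫ r in Ioi (0 : ℝ),
      (Real.exp (-(ε k * r)) : ℂ) * expTransform m ξ f r) atTop
      (𝓝 (∫ r in Ioi (0 : ℝ), expTransform m ξ f r)) := by
    refine tendsto_integral_of_dominated_convergence (fun r => ‖expTransform m ξ f r‖) ?_
      hint.norm ?_ ?_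
    · intro k
      exact (by fun_prop : Measurable fun r : ℝ =>
        (Real.exp (-(ε k * r)) : ℂ)).aestronglyMeasurable.mul hint.1
    · intro k
      filter_upwards [ae_restrict_mem measurableSet_Ioi] with r hr
      have hr : 0 < r := hr
      rw [norm_mul, Complex.norm_real]
      apply mul_le_of_le_one_left (norm_nonneg _)
      rw [Real.norm_eq_abs, Real.abs_exp, Real.exp_le_one_iff]
      have := mul_pos (hεpos k) hr
      linarith
    · filter_upwards with r
      have : Tendsto (fun k => (Real.exp (-(ε k * r)) : ℂ) * expTransform m ξ f r) atTop
          (𝓝 ((Real.exp (-(0 * r)) : ℂ) * expTransform m ξ f r)) := by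
        apply Tendsto.mul_const
        apply (Complex.continuous_ofReal.tendsto _).comp
        apply (Real.continuous_exp.tendsto _).comp
        exact (hεlim.mul_const r).neg
      simpa using this
  have hr : Tendsto (fun k => ∫ y, (f y : ℂ) / (ε k + ξ y) ∂m) atTop
      (𝓝 (∫ y, (f y : ℂ) / ξ y ∂m)) := by
    refine tendsto_integral_of_dominated_convergence (fun y => ‖(f y : ℂ) / ξ y‖) ?_
      hker.norm ?_ ?_
    · intro k
      exact hf.ofReal.1.aemeasurable.div (by fun_prop) |>.aestronglyMeasurable
    · intro k
      filter_upwards [h0, hne] with y hy hy2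
      rw [norm_div, norm_div]
      have hp := norm_pos_iff.2 hy2
      gcongr
      · rw [← sq_le_sq₀ (norm_nonneg _) (norm_nonneg _), ← Complex.normSq_eq_norm_sq,
          ← Complex.normSq_eq_norm_sq, Complex.normSq_apply, Complex.normSq_apply]
        simp
        nlinarith [hεpos k]
    · filter_upwards [hne] with y hy2
      have h : Tendsto (fun k => (f y : ℂ) / (ε k + ξ y)) atTop (𝓝 ((f y : ℂ) / ((0:ℝ) + ξ y))) := by
        apply Tendsto.div tendsto_const_nhds
        · exact ((Complex.continuous_ofReal.tendsto _).comp hεlim).add_const _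
        · simpa using hy2
      simpa using h
  exact tendsto_nhds_unique hl (by simpa only [heq] using hr)

end transform

/-- The `L²(0, ∞)` pairing of two transforms as a double integral. -/
theorem integral_conj_expTransform_mul {Y Z : Type*} [MeasurableSpace Y] [MeasurableSpace Z]
    {m : Measure Y} {m' : Measure Z} [SFinite m] [SFinite m'] {ξ : Y → ℂ} {ζ : Z → ℂ}
    {f : Y → ℝ} {g : Z → ℝ} (hξ : Measurable ξ) (hζ : Measurable ζ)
    (hξ0 : ∀ᵐ y ∂m, 0 ≤ (ξ y).re) (hζ0 : ∀ᵐ y ∂m', 0 ≤ (ζ y).re)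
    (hne : ∀ᵐ z ∂m.prod m', conj (ξ z.1) + ζ z.2 ≠ 0)
    (hf : Integrable f m) (hg : Integrable g m')
    (hF : MemLp (expTransform m ξ f) 2 (volume.restrict (Ioi 0)))
    (hG : MemLp (expTransform m' ζ g) 2 (volume.restrict (Ioi 0)))
    (hker : Integrable (fun z => ((f z.1 * g z.2 : ℝ) : ℂ) / (conj (ξ z.1) + ζ z.2))
      (m.prod m')) :
    ∫ r in Ioi (0 : ℝ), conj (expTransform m ξ f r) * expTransform m' ζ g r
      = ∫ z, ((f z.1 * g z.2 : ℝ) : ℂ) / (conj (ξ z.1) + ζ z.2) ∂m.prod m' := by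
  -- The product is again a transform, of the tensor product of the densities, with the sum of the
  -- exponents.
  have h1 : ∀ r, conj (expTransform m ξ f r) * expTransform m' ζ g r
      = expTransform (m.prod m') (fun z => conj (ξ z.1) + ζ z.2) (fun z => f z.1 * g z.2) r := by
    intro r
    unfold expTransform
    rw [← integral_conj, ← integral_prod_mul]
    congr 1; ext z
    simp only [map_mul, ← Complex.exp_conj, map_neg, Complex.conj_ofReal]
    rw [mul_mul_mul_comm, ← Complex.exp_add]
    push_cast
    congr 2
    ring
  simp_rw [h1]
  apply integral_expTransform
  · have := Complex.continuous_conj.measurable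
    fun_prop
  · filter_upwards [Measure.quasiMeasurePreserving_fst.ae hξ0,
      Measure.quasiMeasurePreserving_snd.ae hζ0] with z h1 h2
    simp; positivity
  · exact hne
  · exact hf.mul_prod hg
  · rw [IntegrableOn]
    rw [← funext h1]
    have := MemLp.integrable_mul (hF.star) hG
    exact this
  · exact hker

end SpectralDN

/-! ### Hilbert's inequality and exponents of linear growth. -/

namespace SpectralDN
open Filter Topology
open scoped ENNReal ComplexConjugate

theorem lintegral_enorm_sq_lt_top {α : Type*} [MeasurableSpace α] {μ : Measure α} {E : Type*}
    [NormedAddCommGroup E] {f : α → E} (hf : MemLp f 2 μ) : ∫⁻ x, ‖f x‖ₑ ^ 2 ∂μ < ∞ := by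
  have h := lintegral_rpow_enorm_lt_top_of_eLpNorm_lt_top (by norm_num) (by norm_num) hf.2
  simpa using h

theorem memLp_two_of_lintegral {α : Type*} [MeasurableSpace α] {μ : Measure α} {E : Type*}
    [NormedAddCommGroup E] {f : α → E} (hf : AEStronglyMeasurable f μ)
    (h : ∫⁻ x, ‖f x‖ₑ ^ 2 ∂μ < ∞) : MemLp f 2 μ := by
  refine ⟨hf, ?_⟩
  rw [eLpNorm_lt_top_iff_lintegral_rpow_enorm_lt_top (by norm_num) (by norm_num)]
  simpa using h

theorem lintegral_enorm_sq_eq {α : Type*} [MeasurableSpace α] {μ : Measure α} {E : Type*}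
    [NormedAddCommGroup E] {f : α → E} (hf : MemLp f 2 μ) :
    ∫⁻ x, ‖f x‖ₑ ^ 2 ∂μ = ENNReal.ofReal (∫ x, ‖f x‖ ^ 2 ∂μ) := by
  rw [ofReal_integral_eq_lintegral_ofReal hf.norm.integrable_sq (.of_forall fun x => by positivity)]
  congr 1; ext x
  rw [ENNReal.ofReal_pow (norm_nonneg _), ofReal_norm]

/-- Measure-level bound of a transform whose exponent grows linearly. -/
theorem lintegral_enorm_expTransform_sq_le {c : ℝ} (hc : 0 < c) {ξ : ℝ → ℂ}
    (hξ0 : ∀ t, 0 < t → c * t ≤ (ξ t).re) {f : ℝ → ℝ}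
    (hf : AEStronglyMeasurable f (volume.restrict (Ioi 0))) :
    ∫⁻ r in Ioi (0 : ℝ), ‖expTransform (volume.restrict (Ioi 0)) ξ f r‖ₑ ^ 2
      ≤ ENNReal.ofReal (Real.pi / c) * ∫⁻ t in Ioi (0 : ℝ), ‖f t‖ₑ ^ 2 := by
  refine le_trans (setLIntegral_mono' measurableSet_Ioi ?_) (lintegral_laplace_sq_le' hc hf.enorm)
  intro r hr
  have hr : 0 < r := hr
  gcongr
  refine (enorm_integral_le_lintegral_enorm _).trans (setLIntegral_mono' measurableSet_Ioi ?_)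
  intro t ht
  rw [enorm_mul]
  have h1 : ‖(f t : ℂ)‖ₑ = ‖f t‖ₑ := by
    rw [← ofReal_norm, ← ofReal_norm, Complex.norm_real]
  rw [h1]
  gcongr
  rw [← ofReal_norm, Complex.norm_exp]
  apply ENNReal.ofReal_le_ofReal
  apply Real.exp_le_exp.2
  have := hξ0 t ht
  simp
  nlinarith

theorem memLp_two_expTransform_of_le {c : ℝ} (hc : 0 < c) {ξ : ℝ → ℂ} (hξ : Measurable ξ)
    (hξ0 : ∀ t, 0 < t → c * t ≤ (ξ t).re) {f : ℝ → ℝ}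
    (hf1 : IntegrableOn f (Ioi 0)) (hf : MemLp f 2 (volume.restrict (Ioi 0))) :
    MemLp (expTransform (volume.restrict (Ioi 0)) ξ f) 2 (volume.restrict (Ioi 0)) := by
  refine memLp_two_of_lintegral (aestronglyMeasurable_expTransform hξ ?_ hf1) ?_
  · filter_upwards [ae_restrict_mem measurableSet_Ioi] with t ht
    have ht : 0 < t := ht
    have := hξ0 t ht
    nlinarith
  · exact (lintegral_enorm_expTransform_sq_le hc hξ0 hf.1).trans_lt
      (ENNReal.mul_lt_top ENNReal.ofReal_lt_top (lintegral_enorm_sq_lt_top hf))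

theorem lintegral_exp_neg_mul {b : ℝ} (hb : 0 < b) :
    ∫⁻ r in Ioi (0 : ℝ), ENNReal.ofReal (Real.exp (-(r * b))) = ENNReal.ofReal (1 / b) := by
  have hi : IntegrableOn (fun r => Real.exp (-(r * b))) (Ioi 0) := by
    have := exp_neg_integrableOn_Ioi 0 hb
    refine this.congr_fun (fun r _ => ?_) measurableSet_Ioi
    dsimp only; congr 1; ring
  rw [← ofReal_integral_eq_lintegral_ofReal hi (.of_forall fun r => (Real.exp_pos _).le)]
  congr 1
  have := integral_exp_mul_Ioi (a := -b) (by linarith) 0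
  simp only [mul_zero, Real.exp_zero] at this
  rw [neg_div_neg_eq] at this
  rw [← this]
  congr 1; ext r; congr 1; ring

/-- **Hilbert's inequality**, qualitative form. -/
theorem lintegral_hilbert_lt_top {f g : ℝ → ℝ} (hf : MemLp f 2 (volume.restrict (Ioi 0)))
    (hg : MemLp g 2 (volume.restrict (Ioi 0))) :
    ∫⁻ z, ‖f z.1‖ₑ * ‖g z.2‖ₑ * ENNReal.ofReal (1 / (z.1 + z.2))
      ∂((volume.restrict (Ioi (0 : ℝ))).prod (volume.restrict (Ioi (0 : ℝ)))) < ∞ := by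
  set μ := volume.restrict (Ioi (0 : ℝ)) with hμ
  have hpos1 : ∀ᵐ z ∂(μ.prod μ), 0 < z.1 :=
    Measure.quasiMeasurePreserving_fst.ae (ae_restrict_mem measurableSet_Ioi)
  have hpos2 : ∀ᵐ z ∂(μ.prod μ), 0 < z.2 :=
    Measure.quasiMeasurePreserving_snd.ae (ae_restrict_mem measurableSet_Ioi)
  have hfm : AEMeasurable (fun z : ℝ × ℝ => ‖f z.1‖ₑ) (μ.prod μ) := hf.1.enorm.comp_quasiMeasurePreserving Measure.quasiMeasurePreserving_fst
  have hgm : AEMeasurable (fun z : ℝ × ℝ => ‖g z.2‖ₑ) (μ.prod μ) := hg.1.enorm.comp_quasiMeasurePreserving Measure.quasiMeasurePreserving_snd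
  -- Writing `1/(s+t) = ∫ e^{-r(s+t)} dr` factorises the kernel. The double integral becomes an `L²`
  -- pairing of two Laplace transforms.
  have e1 : ∫⁻ z, ‖f z.1‖ₑ * ‖g z.2‖ₑ * ENNReal.ofReal (1 / (z.1 + z.2)) ∂(μ.prod μ)
      = ∫⁻ z, ∫⁻ r, ‖f z.1‖ₑ * ‖g z.2‖ₑ * ENNReal.ofReal (Real.exp (-(r * (z.1 + z.2)))) ∂μ
          ∂(μ.prod μ) := by
    apply lintegral_congr_ae
    filter_upwards [hpos1, hpos2] with z h1 h2
    rw [lintegral_const_mul _ (by fun_prop), lintegral_exp_neg_mul (by positivity)]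
  have e2 : ∀ r, ∫⁻ z, ‖f z.1‖ₑ * ‖g z.2‖ₑ * ENNReal.ofReal (Real.exp (-(r * (z.1 + z.2))))
        ∂(μ.prod μ)
      = (∫⁻ t, ENNReal.ofReal (Real.exp (-(r * 1 * t))) * ‖f t‖ₑ ∂μ)
        * ∫⁻ t, ENNReal.ofReal (Real.exp (-(r * 1 * t))) * ‖g t‖ₑ ∂μ := by
    intro r
    rw [← lintegral_prod_mul]
    · congr 1; ext z
      rw [mul_add, neg_add, Real.exp_add, ENNReal.ofReal_mul (Real.exp_pos _).le]
      simp only [mul_one]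
      ring
    · exact (by fun_prop : Measurable fun t : ℝ => ENNReal.ofReal (Real.exp (-(r * 1 * t)))).aemeasurable.mul hf.1.enorm
    · exact (by fun_prop : Measurable fun t : ℝ => ENNReal.ofReal (Real.exp (-(r * 1 * t)))).aemeasurable.mul hg.1.enorm
  rw [e1, lintegral_lintegral_swap]
  · simp_rw [e2]
    have hm : ∀ f : ℝ → ℝ, AEStronglyMeasurable f μ → AEMeasurable (fun r =>
        ∫⁻ t, ENNReal.ofReal (Real.exp (-(r * 1 * t))) * ‖f t‖ₑ ∂μ) μ := by
      intro f hf
      have : AEMeasurable (fun z : ℝ × ℝ =>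
          ENNReal.ofReal (Real.exp (-(z.1 * 1 * z.2))) * ‖f z.2‖ₑ) (μ.prod μ) :=
        (by fun_prop : Measurable fun z : ℝ × ℝ =>
          ENNReal.ofReal (Real.exp (-(z.1 * 1 * z.2)))).aemeasurable.mul
          (hf.enorm.comp_quasiMeasurePreserving Measure.quasiMeasurePreserving_snd)
      exact this.lintegral_prod_right'
    have h := lintegral_mul_sq_le (hm f hf.1) (hm g hg.1)
    have h1 := (lintegral_laplace_sq_le' one_pos hf.1.enorm).trans_lt
      (ENNReal.mul_lt_top ENNReal.ofReal_lt_top (lintegral_enorm_sq_lt_top hf))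
    have h2 := (lintegral_laplace_sq_le' one_pos hg.1.enorm).trans_lt
      (ENNReal.mul_lt_top ENNReal.ofReal_lt_top (lintegral_enorm_sq_lt_top hg))
    have h3 := h.trans_lt (ENNReal.mul_lt_top h1 h2)
    by_contra hcon
    rw [not_lt, top_le_iff] at hcon
    rw [hcon] at h3
    simp at h3
  · refine AEMeasurable.mul ?_ (by fun_prop : Measurable fun p : (ℝ × ℝ) × ℝ =>
      ENNReal.ofReal (Real.exp (-(p.2 * (p.1.1 + p.1.2))))).aemeasurable
    exact (hfm.mul hgm).comp_quasiMeasurePreserving Measure.quasiMeasurePreserving_fst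

/-- Two sides meeting at a vertex give a kernel that is singular at the vertex, but no worse than
`1/(s+t)`. Hilbert's inequality then supplies the integrability required by the pairing formula. -/
theorem integrable_hilbert_kernel {c : ℝ} (hc : 0 < c) {f g : ℝ → ℝ}
    (hf : MemLp f 2 (volume.restrict (Ioi 0))) (hg : MemLp g 2 (volume.restrict (Ioi 0)))
    {κ : ℝ × ℝ → ℂ} (hκ : Measurable κ)
    (hκc : ∀ s t, 0 < s → 0 < t → c * (s + t) ≤ ‖κ (s, t)‖) :
    Integrable (fun z => ((f z.1 * g z.2 : ℝ) : ℂ) / κ z)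
      ((volume.restrict (Ioi (0 : ℝ))).prod (volume.restrict (Ioi (0 : ℝ)))) := by
  set μ := volume.restrict (Ioi (0 : ℝ)) with hμ
  have hpos1 : ∀ᵐ z ∂(μ.prod μ), 0 < z.1 :=
    Measure.quasiMeasurePreserving_fst.ae (ae_restrict_mem measurableSet_Ioi)
  have hpos2 : ∀ᵐ z ∂(μ.prod μ), 0 < z.2 :=
    Measure.quasiMeasurePreserving_snd.ae (ae_restrict_mem measurableSet_Ioi)
  have hfm : AEMeasurable (fun z : ℝ × ℝ => f z.1) (μ.prod μ) :=
    hf.1.aemeasurable.comp_quasiMeasurePreserving Measure.quasiMeasurePreserving_fst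
  have hgm : AEMeasurable (fun z : ℝ × ℝ => g z.2) (μ.prod μ) :=
    hg.1.aemeasurable.comp_quasiMeasurePreserving Measure.quasiMeasurePreserving_snd
  refine ⟨((Complex.measurable_ofReal.comp_aemeasurable (hfm.mul hgm)).div
    hκ.aemeasurable).aestronglyMeasurable, ?_⟩
  rw [hasFiniteIntegral_iff_enorm]
  have h := lintegral_hilbert_lt_top hf hg
  have h2 := ENNReal.mul_lt_top (ENNReal.ofReal_lt_top (r := 1 / c)) h
  refine lt_of_le_of_lt ?_ h2
  rw [← lintegral_const_mul' _ _ ENNReal.ofReal_ne_top]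
  apply lintegral_mono_ae
  filter_upwards [hpos1, hpos2] with z h1 h2
  have h3 := hκc z.1 z.2 h1 h2
  have h4 : 0 < c * (z.1 + z.2) := by positivity
  rw [← ofReal_norm, ← ofReal_norm, ← ofReal_norm, ← ENNReal.ofReal_mul (by positivity),
    ← ENNReal.ofReal_mul (by positivity), ← ENNReal.ofReal_mul (by positivity)]
  apply ENNReal.ofReal_le_ofReal
  rw [norm_div, Complex.norm_real, norm_mul]
  calc ‖f z.1‖ * ‖g z.2‖ / ‖κ (z.1, z.2)‖ ≤ ‖f z.1‖ * ‖g z.2‖ / (c * (z.1 + z.2)) := by gcongr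
    _ = _ := by field_simp

end SpectralDN

/-! ### The model corner: transforms on two rays. -/

namespace SpectralDN
open Filter Topology
open scoped ENNReal ComplexConjugate

theorem expTransform_restrict {Y : Type*} [MeasurableSpace Y] {m : Measure Y} {E : Set Y}
    (hE : MeasurableSet E) (ξ : Y → ℂ) (f : Y → ℝ) (r : ℝ) :
    expTransform (m.restrict E) ξ f r = expTransform m ξ (E.indicator f) r := by
  unfold expTransform
  rw [← integral_indicator hE]
  congr 1; ext y
  by_cases hy : y ∈ E <;> simp [hy]

theorem memLp_two_expTransform_half {f : ℝ → ℝ} (hf1 : IntegrableOn f (Ioi 0))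
    (hf : MemLp f 2 (volume.restrict (Ioi 0))) :
    MemLp (expTransform (volume.restrict (Ioi 0)) (fun t : ℝ => Complex.I * t) f) 2
      (volume.restrict (Ioi 0)) := by
  rw [show expTransform (volume.restrict (Ioi 0)) (fun t : ℝ => Complex.I * t) f = _ from
    funext fun r => expTransform_restrict measurableSet_Ioi _ f r]
  exact (memLp_two_expTransform_line (hf1.integrable_indicator measurableSet_Ioi)
    ((memLp_indicator_iff_restrict measurableSet_Ioi).2 hf)).restrict _

theorem integral_norm_sq_expTransform_half {f : ℝ → ℝ} (hf1 : IntegrableOn f (Ioi 0))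
    (hf : MemLp f 2 (volume.restrict (Ioi 0))) :
    ∫ r in Ioi (0 : ℝ),
      ‖expTransform (volume.restrict (Ioi 0)) (fun t : ℝ => Complex.I * t) f r‖ ^ 2
      = Real.pi * ∫ t in Ioi (0 : ℝ), f t ^ 2 := by
  simp_rw [expTransform_restrict measurableSet_Ioi]
  rw [integral_norm_sq_expTransform_line (hf1.integrable_indicator measurableSet_Ioi)
    ((memLp_indicator_iff_restrict measurableSet_Ioi).2 hf), ← integral_indicator measurableSet_Ioi]
  congr 2; ext t
  by_cases ht : t ∈ Ioi (0 : ℝ) <;> simp [ht]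

/-- The exponent `e^{-iθ} i t`, whose transform is the Fourier transform on the ray of
angle `-θ`. -/
noncomputable def rayExponent (θ : ℝ) (t : ℝ) : ℂ := Complex.I * (Complex.exp (-(θ * Complex.I)) * t)

theorem measurable_rayExponent (θ : ℝ) : Measurable (rayExponent θ) := by
  unfold rayExponent; fun_prop

theorem rayExponent_re (θ t : ℝ) : (rayExponent θ t).re = Real.sin θ * t := by
  unfold rayExponent
  rw [show (-(θ * Complex.I) : ℂ) = ((-θ : ℝ) : ℂ) * Complex.I by push_cast; ring,
    Complex.exp_mul_I]
  simp [Complex.sin_ofReal_re]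

theorem rayExponent_zero : rayExponent 0 = fun t : ℝ => Complex.I * t := by
  ext t; simp [rayExponent]

theorem memLp_two_expTransform_ray {θ : ℝ} (h0 : 0 < θ) (hπ : θ < Real.pi) {f : ℝ → ℝ}
    (hf1 : IntegrableOn f (Ioi 0)) (hf : MemLp f 2 (volume.restrict (Ioi 0))) :
    MemLp (expTransform (volume.restrict (Ioi 0)) (rayExponent θ) f) 2
      (volume.restrict (Ioi 0)) :=
  memLp_two_expTransform_of_le (Real.sin_pos_of_pos_of_lt_pi h0 hπ) (measurable_rayExponent θ)
    (fun t _ => (rayExponent_re θ t).ge) hf1 hf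

/-- Rotation of the contour: the pairing of the transforms on the rays of angles `0` and `-θ`
is, up to the factor `e^{iθ/2}`, the squared norm on the bisecting ray. -/
theorem integral_conj_mul_ray {θ : ℝ} (h0 : 0 < θ) (hπ : θ < Real.pi) {f : ℝ → ℝ}
    (hf1 : IntegrableOn f (Ioi 0)) (hf : MemLp f 2 (volume.restrict (Ioi 0))) :
    ∫ r in Ioi (0 : ℝ), conj (expTransform (volume.restrict (Ioi 0)) (rayExponent 0) f r)
        * expTransform (volume.restrict (Ioi 0)) (rayExponent θ) f r
      = Complex.exp ((θ / 2 : ℝ) * Complex.I) * (∫ r in Ioi (0 : ℝ),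
        ‖expTransform (volume.restrict (Ioi 0)) (rayExponent (θ / 2)) f r‖ ^ 2 : ℝ) := by
  set μ := volume.restrict (Ioi (0 : ℝ)) with hμ
  have hs : 0 < Real.sin (θ / 2) := Real.sin_pos_of_pos_of_lt_pi (by linarith) (by linarith)
  have hmeas : ∀ θ₁ θ₂ : ℝ, Measurable fun z : ℝ × ℝ =>
      conj (rayExponent θ₁ z.1) + rayExponent θ₂ z.2 := by
    intro θ₁ θ₂
    have := Complex.continuous_conj.measurable
    have := measurable_rayExponent θ₁
    have := measurable_rayExponent θ₂
    fun_prop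
  -- The kernel for the rays `(0, θ)` differs from that for the bisector `(θ/2, θ/2)` by the
  -- unimodular constant `e^{-iθ/2}`. The contour rotation therefore reduces to an identity between
  -- kernels, and the second kernel has real part `sin(θ/2)(s+t) > 0`.
  have hker : ∀ s t : ℝ, conj (rayExponent 0 s) + rayExponent θ t
      = Complex.exp (-((θ / 2 : ℝ) * Complex.I)) *
        (conj (rayExponent (θ / 2) s) + rayExponent (θ / 2) t) := by
    intro s t
    simp only [rayExponent, map_mul, Complex.conj_I, Complex.conj_ofReal, ← Complex.exp_conj,
      map_neg, Complex.ofReal_zero, zero_mul, neg_zero, Complex.exp_zero, one_mul]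
    rw [mul_add]
    congr 1
    · calc -Complex.I * s = Complex.exp (-((θ / 2 : ℝ) * Complex.I)
            + -(((θ / 2 : ℝ) : ℂ) * -Complex.I)) * (-Complex.I * s) := by simp
        _ = _ := by rw [Complex.exp_add]; ring
    · rw [show -((θ : ℂ) * Complex.I) = -((θ / 2 : ℝ) * Complex.I) + -((θ / 2 : ℝ) * Complex.I) by
        push_cast; ring, Complex.exp_add]
      ring
  have hbound : ∀ s t : ℝ, 0 < s → 0 < t → Real.sin (θ / 2) * (s + t) ≤
      ‖conj (rayExponent (θ / 2) s) + rayExponent (θ / 2) t‖ := by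
    intro s t _ _
    refine le_trans (le_of_eq ?_) (Complex.re_le_norm _)
    simp only [Complex.add_re, Complex.conj_re, rayExponent_re]
    ring
  have hexp1 : ‖Complex.exp (-((θ / 2 : ℝ) * Complex.I))‖ = 1 := by
    rw [← neg_mul, ← Complex.ofReal_neg, Complex.norm_exp_ofReal_mul_I]
  have hbound' : ∀ s t : ℝ, 0 < s → 0 < t → Real.sin (θ / 2) * (s + t) ≤
      ‖conj (rayExponent 0 s) + rayExponent θ t‖ := by
    intro s t h1 h2
    rw [hker, norm_mul, hexp1, one_mul]
    exact hbound s t h1 h2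
  have hpos1 : ∀ᵐ z ∂(μ.prod μ), 0 < z.1 :=
    Measure.quasiMeasurePreserving_fst.ae (ae_restrict_mem measurableSet_Ioi)
  have hpos2 : ∀ᵐ z ∂(μ.prod μ), 0 < z.2 :=
    Measure.quasiMeasurePreserving_snd.ae (ae_restrict_mem measurableSet_Ioi)
  have hre : ∀ θ' : ℝ, 0 ≤ θ' → θ' < Real.pi → ∀ᵐ t ∂μ, 0 ≤ (rayExponent θ' t).re := by
    intro θ' h1 h2
    filter_upwards [ae_restrict_mem measurableSet_Ioi] with t ht
    have ht : 0 < t := ht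
    rw [rayExponent_re]
    have := Real.sin_nonneg_of_nonneg_of_le_pi h1 h2.le
    positivity
  have hne : ∀ s t : ℝ, 0 < s → 0 < t → conj (rayExponent (θ / 2) s) + rayExponent (θ / 2) t ≠ 0 := by
    intro s t h1 h2 h
    have := hbound s t h1 h2
    rw [h, norm_zero] at this
    have : 0 < Real.sin (θ / 2) * (s + t) := by positivity
    linarith
  have hhalf := memLp_two_expTransform_ray (θ := θ / 2) (by linarith) (by linarith) hf1 hf
  have hzero : MemLp (expTransform μ (rayExponent 0) f) 2 μ := by
    rw [rayExponent_zero]; exact memLp_two_expTransform_half hf1 hf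
  have hA := integral_conj_expTransform_mul (measurable_rayExponent 0) (measurable_rayExponent θ)
    (hre 0 le_rfl Real.pi_pos) (hre θ h0.le hπ)
    (by
      filter_upwards [hpos1, hpos2] with z h1 h2
      rw [hker]
      exact mul_ne_zero (Complex.exp_ne_zero _) (hne _ _ h1 h2)) hf1 hf1 hzero
    (memLp_two_expTransform_ray h0 hπ hf1 hf)
    (integrable_hilbert_kernel hs hf hf (hmeas 0 θ) hbound')
  have hB := integral_conj_expTransform_mul (measurable_rayExponent (θ / 2))
    (measurable_rayExponent (θ / 2))
    (hre (θ / 2) (by linarith) (by linarith)) (hre (θ / 2) (by linarith) (by linarith))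
    (by
      filter_upwards [hpos1, hpos2] with z h1 h2
      exact hne _ _ h1 h2) hf1 hf1 hhalf hhalf
    (integrable_hilbert_kernel hs hf hf (hmeas _ _) hbound)
  have hC : ((∫ r in Ioi (0 : ℝ), ‖expTransform μ (rayExponent (θ / 2)) f r‖ ^ 2 : ℝ) : ℂ)
      = ∫ r in Ioi (0 : ℝ), conj (expTransform μ (rayExponent (θ / 2)) f r)
        * expTransform μ (rayExponent (θ / 2)) f r := by
    rw [← integral_complex_ofReal]
    congr 1; ext r
    rw [Complex.conj_mul']
    norm_cast
  rw [hA, hC, hB, ← integral_const_mul]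
  congr 1; ext z
  rw [hker, Complex.exp_neg, ← div_div, div_inv_eq_mul]
  ring

/-- With `F`, `G` the transforms on the two rays and `N` the squared norm on the bisector, the right
side is `‖F‖² + ‖G‖² + 2s cos(θ/2) N`. The same rotation identity gives `|⟨F, G⟩| = N`, hence `2N ≤
‖F‖² + ‖G‖²`, and `‖F‖² = π‖f‖²` by Plancherel. The cosine is nonnegative since `θ < π`. -/
theorem one_sub_cos_mul_le_integral {θ : ℝ} (h0 : 0 < θ) (hπ : θ < Real.pi) {f : ℝ → ℝ}
    (hf1 : IntegrableOn f (Ioi 0)) (hf : MemLp f 2 (volume.restrict (Ioi 0))) {s : ℝ}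
    (hs : s = 1 ∨ s = -1) :
    (1 - Real.cos (θ / 2)) * (Real.pi * ∫ t in Ioi (0 : ℝ), f t ^ 2) ≤
      ∫ r in Ioi (0 : ℝ), ‖expTransform (volume.restrict (Ioi 0)) (rayExponent 0) f r
        + s * expTransform (volume.restrict (Ioi 0)) (rayExponent θ) f r‖ ^ 2 := by
  have hrot := integral_conj_mul_ray h0 hπ hf1 hf
  have hzero : MemLp (expTransform (volume.restrict (Ioi 0)) (rayExponent 0) f) 2
      (volume.restrict (Ioi 0)) := by
    rw [rayExponent_zero]; exact memLp_two_expTransform_half hf1 hf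
  have hθ := memLp_two_expTransform_ray h0 hπ hf1 hf
  have hpl := integral_norm_sq_expTransform_half hf1 hf
  rw [← rayExponent_zero] at hpl
  set F := expTransform (volume.restrict (Ioi 0)) (rayExponent 0) f
  set G := expTransform (volume.restrict (Ioi 0)) (rayExponent θ) f
  set N := ∫ r in Ioi (0 : ℝ),
    ‖expTransform (volume.restrict (Ioi 0)) (rayExponent (θ / 2)) f r‖ ^ 2
  have hN : 0 ≤ N := integral_nonneg fun r => by positivity
  have iF : IntegrableOn (fun r => ‖F r‖ ^ 2) (Ioi 0) := hzero.norm.integrable_sq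
  have iG : IntegrableOn (fun r => ‖G r‖ ^ 2) (Ioi 0) := hθ.norm.integrable_sq
  have iFG : IntegrableOn (fun r => conj (F r) * G r) (Ioi 0) :=
    MemLp.integrable_mul hzero.star hθ
  have hexpand : ∫ r in Ioi (0 : ℝ), ‖F r + s * G r‖ ^ 2
      = (∫ r in Ioi (0 : ℝ), ‖F r‖ ^ 2) + (∫ r in Ioi (0 : ℝ), ‖G r‖ ^ 2)
        + 2 * s * (∫ r in Ioi (0 : ℝ), conj (F r) * G r).re := by
    have i1 : IntegrableOn (fun r => ‖F r‖ ^ 2 + ‖G r‖ ^ 2) (Ioi 0) := iF.add iG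
    have i2 : IntegrableOn (fun r => 2 * s * (conj (F r) * G r).re) (Ioi 0) :=
      iFG.re.const_mul _
    rw [show (∫ r in Ioi (0 : ℝ), conj (F r) * G r).re = ∫ r in Ioi (0 : ℝ), (conj (F r) * G r).re
      from (integral_re iFG).symm, ← integral_const_mul, ← integral_add iF iG,
      ← integral_add i1 i2]
    congr 1; ext r
    have hs2 : s ^ 2 = 1 := by rcases hs with rfl | rfl <;> norm_num
    simp only [← Complex.normSq_eq_norm_sq, Complex.normSq_apply]
    simp
    linear_combination ((G r).re ^ 2 + (G r).im ^ 2) * hs2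
  have hre : (∫ r in Ioi (0 : ℝ), conj (F r) * G r).re = Real.cos (θ / 2) * N := by
    rw [hrot, Complex.re_mul_ofReal, Complex.exp_ofReal_mul_I_re]
  have hle : 2 * N ≤ (∫ r in Ioi (0 : ℝ), ‖F r‖ ^ 2) + ∫ r in Ioi (0 : ℝ), ‖G r‖ ^ 2 := by
    have h1 : ‖∫ r in Ioi (0 : ℝ), conj (F r) * G r‖ = N := by
      rw [hrot, norm_mul, Complex.norm_exp_ofReal_mul_I, one_mul, Complex.norm_real,
        Real.norm_of_nonneg hN]
    have h2 : ‖∫ r in Ioi (0 : ℝ), conj (F r) * G r‖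
        ≤ ∫ r in Ioi (0 : ℝ), (‖F r‖ ^ 2 + ‖G r‖ ^ 2) / 2 := by
      refine norm_integral_le_of_norm_le ((iF.add iG).div_const 2) (.of_forall fun r => ?_)
      rw [norm_mul, RCLike.norm_conj]
      nlinarith [sq_nonneg (‖F r‖ - ‖G r‖)]
    rw [integral_div, integral_add iF iG] at h2
    linarith
  have hG : 0 ≤ ∫ r in Ioi (0 : ℝ), ‖G r‖ ^ 2 := integral_nonneg fun r => by positivity
  have hc0 : 0 ≤ Real.cos (θ / 2) := Real.cos_nonneg_of_mem_Icc ⟨by linarith, by linarith⟩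
  have hc1 := Real.cos_le_one (θ / 2)
  rw [hexpand, hre, ← hpl]
  rcases hs with rfl | rfl
  · nlinarith [mul_nonneg hc0 hN, mul_nonneg hc0 (integral_nonneg (μ := volume.restrict (Ioi (0:ℝ)))
      (f := fun r => ‖F r‖ ^ 2) fun r => by positivity)]
  · nlinarith [mul_nonneg hc0 hG]

/-- The estimate at a corner of angle `θ`. -/
theorem corner_estimate {θ : ℝ} (h0 : 0 < θ) (hπ : θ < Real.pi) {f g : ℝ → ℝ}
    (hf1 : IntegrableOn f (Ioi 0)) (hf : MemLp f 2 (volume.restrict (Ioi 0)))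
    (hg1 : IntegrableOn g (Ioi 0)) (hg : MemLp g 2 (volume.restrict (Ioi 0))) :
    (1 - Real.cos (θ / 2)) * Real.pi *
        ((∫ t in Ioi (0 : ℝ), f t ^ 2) + ∫ t in Ioi (0 : ℝ), g t ^ 2) ≤
      2 * ((∫ r in Ioi (0 : ℝ), ‖expTransform (volume.restrict (Ioi 0)) (rayExponent 0) f r
        + expTransform (volume.restrict (Ioi 0)) (rayExponent θ) g r‖ ^ 2)
      + ∫ r in Ioi (0 : ℝ), ‖expTransform (volume.restrict (Ioi 0)) (rayExponent 0) g r
        + expTransform (volume.restrict (Ioi 0)) (rayExponent θ) f r‖ ^ 2) := by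
  -- For `f ± g` the two-component system decouples into the scalar cases `s = 1` and `s = -1`. The
  -- parallelogram law recombines them.
  have hS := one_sub_cos_mul_le_integral h0 hπ (hf1.add hg1) (hf.add hg) (Or.inl rfl)
  have hD := one_sub_cos_mul_le_integral h0 hπ (hf1.add hg1.neg) (hf.add hg.neg) (Or.inr rfl)
  have hm : ∀ (θ' : ℝ), 0 ≤ θ' → θ' < Real.pi → ∀ᵐ t ∂(volume.restrict (Ioi (0:ℝ))),
      0 ≤ (rayExponent θ' t).re := by
    intro θ' h1 h2
    filter_upwards [ae_restrict_mem measurableSet_Ioi] with t ht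
    have ht : 0 < t := ht
    rw [rayExponent_re]
    have := Real.sin_nonneg_of_nonneg_of_le_pi h1 h2.le
    positivity
  have hmem : ∀ {u : ℝ → ℝ}, IntegrableOn u (Ioi 0) → MemLp u 2 (volume.restrict (Ioi 0)) →
      MemLp (expTransform (volume.restrict (Ioi 0)) (rayExponent 0) u) 2
      (volume.restrict (Ioi 0)) := by
    intro u h1 h2
    rw [rayExponent_zero]; exact memLp_two_expTransform_half h1 h2
  have hneg : ∀ θ' r, expTransform (volume.restrict (Ioi 0)) (rayExponent θ') (-g) r
      = - expTransform (volume.restrict (Ioi 0)) (rayExponent θ') g r := by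
    intro θ' r
    simp [expTransform, integral_neg]
  have e1 : ∫ r in Ioi (0 : ℝ), ‖expTransform (volume.restrict (Ioi 0)) (rayExponent 0) (f + g) r
        + (1 : ℝ) * expTransform (volume.restrict (Ioi 0)) (rayExponent θ) (f + g) r‖ ^ 2
      = ∫ r in Ioi (0 : ℝ), ‖(expTransform (volume.restrict (Ioi 0)) (rayExponent 0) f r
        + expTransform (volume.restrict (Ioi 0)) (rayExponent θ) g r)
        + (expTransform (volume.restrict (Ioi 0)) (rayExponent 0) g r
        + expTransform (volume.restrict (Ioi 0)) (rayExponent θ) f r)‖ ^ 2 := by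
    apply setIntegral_congr_fun measurableSet_Ioi
    intro r hr
    dsimp only
    rw [expTransform_add (measurable_rayExponent 0) (hm 0 le_rfl Real.pi_pos) hf1 hg1
      (le_of_lt hr), expTransform_add (measurable_rayExponent θ) (hm θ h0.le hπ) hf1 hg1
      (le_of_lt hr)]
    congr 2; push_cast; ring
  have e2 : ∫ r in Ioi (0 : ℝ), ‖expTransform (volume.restrict (Ioi 0)) (rayExponent 0) (f + -g) r
        + (-1 : ℝ) * expTransform (volume.restrict (Ioi 0)) (rayExponent θ) (f + -g) r‖ ^ 2
      = ∫ r in Ioi (0 : ℝ), ‖(expTransform (volume.restrict (Ioi 0)) (rayExponent 0) f r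
        + expTransform (volume.restrict (Ioi 0)) (rayExponent θ) g r)
        - (expTransform (volume.restrict (Ioi 0)) (rayExponent 0) g r
        + expTransform (volume.restrict (Ioi 0)) (rayExponent θ) f r)‖ ^ 2 := by
    apply setIntegral_congr_fun measurableSet_Ioi
    intro r hr
    dsimp only
    rw [expTransform_add (measurable_rayExponent 0) (hm 0 le_rfl Real.pi_pos) hf1 hg1.neg
      (le_of_lt hr), expTransform_add (measurable_rayExponent θ) (hm θ h0.le hπ) hf1 hg1.neg
      (le_of_lt hr), hneg, hneg]
    congr 2; push_cast; ring
  rw [e1] at hS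
  rw [e2] at hD
  have iA := ((hmem hf1 hf).add (memLp_two_expTransform_ray h0 hπ hg1 hg))
  have iB := ((hmem hg1 hg).add (memLp_two_expTransform_ray h0 hπ hf1 hf))
  have hpar : ∀ a b : ℂ, ‖a + b‖ ^ 2 + ‖a - b‖ ^ 2 = 2 * (‖a‖ ^ 2 + ‖b‖ ^ 2) := by
    intro a b
    have := parallelogram_law_with_norm ℝ a b
    nlinarith
  have i1 := iA.norm.integrable_sq
  have i2 := iB.norm.integrable_sq
  simp only [Pi.add_apply] at i1 i2
  have e3 := integral_add (iA.add iB).norm.integrable_sq (iA.sub iB).norm.integrable_sq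
  simp only [Pi.add_apply, Pi.sub_apply, hpar] at e3
  rw [integral_const_mul, integral_add i1 i2] at e3
  have e4 : (∫ t in Ioi (0 : ℝ), (f + g) t ^ 2) + ∫ t in Ioi (0 : ℝ), (f + -g) t ^ 2
      = 2 * ((∫ t in Ioi (0 : ℝ), f t ^ 2) + ∫ t in Ioi (0 : ℝ), g t ^ 2) := by
    rw [← integral_add (hf.add hg).integrable_sq (hf.add hg.neg).integrable_sq,
      ← integral_add hf.integrable_sq hg.integrable_sq, ← integral_const_mul]
    congr 1; ext t
    simp; ring
  have hmul := congrArg (fun x => (1 - Real.cos (θ / 2)) * Real.pi * x) e4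
  have hcc := Real.cos_le_one (θ / 2)
  -- The argument proves the bound even without the factor `2` on the right. Nonnegativity of the
  -- left side gives the weaker form.
  have hnn : 0 ≤ (1 - Real.cos (θ / 2)) * Real.pi *
        ((∫ t in Ioi (0 : ℝ), f t ^ 2) + ∫ t in Ioi (0 : ℝ), g t ^ 2) := by
    have h1 : 0 ≤ 1 - Real.cos (θ / 2) := by linarith
    have h2 : 0 ≤ ∫ t in Ioi (0 : ℝ), f t ^ 2 := integral_nonneg fun t => by positivity
    have h3 : 0 ≤ ∫ t in Ioi (0 : ℝ), g t ^ 2 := integral_nonneg fun t => by positivity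
    have := Real.pi_pos
    positivity
  rw [mul_add] at hmul
  nlinarith [hS, hD, e3, hmul]

end SpectralDN

/-! ### Moments of a density and its logarithmic potential. -/

namespace SpectralDN
open Filter Topology
open scoped ENNReal ComplexConjugate

section moments
variable {Y : Type*} [MeasurableSpace Y] {m : Measure Y} {p : Y → ℂ} {f : Y → ℝ}

theorem integrable_pow_mul_exp (hp : Measurable p) {B : ℝ} (hB : ∀ᵐ y ∂m, ‖p y‖ ≤ B)
    (hf : Integrable f m) (k : ℕ) (w : ℂ) :
    Integrable (fun y => p y ^ k * Complex.exp (w * p y) * f y) m := by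
  refine hf.ofReal.bdd_mul (c := B ^ k * Real.exp (‖w‖ * B)) (by fun_prop) (hB.mono fun y hBy => ?_)
  rw [norm_mul, norm_pow, Complex.norm_exp]
  have hB0 := (norm_nonneg _).trans hBy
  have h1 : (w * p y).re ≤ ‖w‖ * B := by
    refine (Complex.re_le_norm _).trans ?_
    rw [norm_mul]
    gcongr
  gcongr

theorem hasDerivAt_integral_pow_mul_exp (hp : Measurable p) {B : ℝ} (hB : ∀ᵐ y ∂m, ‖p y‖ ≤ B)
    (hf : Integrable f m) (k : ℕ) (w : ℂ) :
    HasDerivAt (fun w => ∫ y, p y ^ k * Complex.exp (w * p y) * f y ∂m)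
      (∫ y, p y ^ (k + 1) * Complex.exp (w * p y) * f y ∂m) w := by
  refine (hasDerivAt_integral_of_dominated_loc_of_deriv_le
    (F' := fun w y => p y ^ (k + 1) * Complex.exp (w * p y) * f y)
    (bound := fun y => B ^ (k + 1) * Real.exp ((‖w‖ + 1) * B) * ‖f y‖)
    (Metric.ball_mem_nhds w one_pos) (.of_forall fun w' => (integrable_pow_mul_exp hp hB hf k w').1)
    (integrable_pow_mul_exp hp hB hf k w) (integrable_pow_mul_exp hp hB hf (k + 1) w).1
    (hB.mono fun y hBy w' hw' => ?_) (hf.norm.const_mul _) (hB.mono fun y hBy w' _ => ?_)).2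
  · have hw : ‖w'‖ ≤ ‖w‖ + 1 := by
      have h1 : ‖w' - w‖ < 1 := by simpa [dist_eq_norm] using hw'
      have h2 := norm_add_le (w' - w) w
      rw [sub_add_cancel] at h2
      linarith
    rw [norm_mul, norm_mul, norm_pow, Complex.norm_exp, Complex.norm_real]
    have hB0 := (norm_nonneg _).trans hBy
    have h1 : (w' * p y).re ≤ (‖w‖ + 1) * B := by
      refine (Complex.re_le_norm _).trans ?_
      rw [norm_mul]
      gcongr
    gcongr
  · have h := (((hasDerivAt_id' w').mul_const (p y)).cexp.const_mul (p y ^ k)).mul_const (f y : ℂ)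
    refine h.congr_deriv ?_
    ring

/-- If the transform of `f` along an affine exponent vanishes on a half line, all the moments of
`f` vanish. -/
theorem integral_pow_mul_eq_zero (hp : Measurable p) {B : ℝ} (hB : ∀ᵐ y ∂m, ‖p y‖ ≤ B)
    (hf : Integrable f m) {α β : ℂ} (hα : α ≠ 0) {R : ℝ}
    (h : ∀ r, R < r → expTransform m (fun y => α * p y + β) f r = 0) (k : ℕ) :
    ∫ y, p y ^ k * f y ∂m = 0 := by
  have hd : ∀ k, Differentiable ℂ (fun w => ∫ y, p y ^ k * Complex.exp (w * p y) * f y ∂m) :=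
    fun k w => (hasDerivAt_integral_pow_mul_exp hp hB hf k w).differentiableAt
  -- The function `w ↦ ∫ exp(w p) f` is entire and vanishes on a half line, hence everywhere. So do
  -- its derivatives, whose values at `0` are the moments.
  have hall : ∀ k w, ∫ y, p y ^ k * Complex.exp (w * p y) * f y ∂m = 0 := by
    intro k
    induction k with
    | zero =>
      have han : AnalyticOnNhd ℂ (fun w => ∫ y, p y ^ 0 * Complex.exp (w * p y) * f y ∂m) univ :=
        fun w _ => (hd 0).analyticAt w
      have hz : ∀ r : ℝ, R < r → ∫ y, p y ^ 0 * Complex.exp (-(r * α) * p y) * f y ∂m = 0 := by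
        intro r hr
        have h1 := h r hr
        have h2 : expTransform m (fun y => α * p y + β) f r = Complex.exp (-(r * β)) *
            ∫ y, p y ^ 0 * Complex.exp (-(r * α) * p y) * f y ∂m := by
          rw [expTransform, ← integral_const_mul]
          congr 1; ext y
          rw [pow_zero, one_mul, ← mul_assoc, ← Complex.exp_add]
          congr 2
          ring
        rw [h2] at h1
        exact (mul_eq_zero.1 h1).resolve_left (Complex.exp_ne_zero _)
      -- The zeros `-rα` with `r ↓ R + 1` accumulate at `-(R+1)α`, which is what the identity
      -- theorem needs.
      have hfreq : ∃ᶠ w in 𝓝[≠] (-(((R + 1 : ℝ) : ℂ) * α)),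
          ∫ y, p y ^ 0 * Complex.exp (w * p y) * f y ∂m = 0 := by
        have ht : Tendsto (fun r : ℝ => -((r : ℂ) * α)) (𝓝[>] (R + 1))
            (𝓝[≠] (-(((R + 1 : ℝ) : ℂ) * α))) := by
          apply tendsto_nhdsWithin_of_tendsto_nhds_of_eventually_within
          · have : Continuous fun r : ℝ => -((r : ℂ) * α) := by fun_prop
            exact this.continuousWithinAt
          · filter_upwards [self_mem_nhdsWithin] with r hr heq
            have : (r : ℂ) = ((R + 1 : ℝ) : ℂ) := mul_right_cancel₀ hα (neg_injective heq)
            exact (ne_of_gt hr) (Complex.ofReal_injective this)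
        refine ht.frequently (Eventually.frequently ?_)
        filter_upwards [self_mem_nhdsWithin] with r hr
        have hr : R + 1 < r := hr
        exact hz r (by linarith)
      have := han.eqOn_zero_of_preconnected_of_frequently_eq_zero isPreconnected_univ (mem_univ _)
        hfreq
      exact fun w => this (mem_univ w)
    | succ k ih =>
      intro w
      rw [← (hasDerivAt_integral_pow_mul_exp hp hB hf k w).deriv, funext ih]
      simp
  simpa using hall k 0

theorem integral_eval_mul_eq_zero (hp : Measurable p) {B : ℝ} (hB : ∀ᵐ y ∂m, ‖p y‖ ≤ B)
    (hf : Integrable f m) (h : ∀ k : ℕ, ∫ y, p y ^ k * f y ∂m = 0) (q : Polynomial ℂ) :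
    ∫ y, q.eval (p y) * f y ∂m = 0 := by
  simp_rw [Polynomial.eval_eq_sum_range, Finset.sum_mul, mul_assoc]
  rw [integral_finsetSum]
  · refine Finset.sum_eq_zero fun k _ => ?_
    rw [integral_const_mul, h, mul_zero]
  · intro k _
    have := integrable_pow_mul_exp hp hB hf k 0
    simp only [zero_mul, Complex.exp_zero, mul_one] at this
    exact this.const_mul _

/-- If all moments of `f` vanish, so does its logarithmic potential at each point that is separated
by a circle from the support. -/
theorem integral_log_norm_sub_eq_zero (hp : Measurable p) {B : ℝ} (hB : ∀ᵐ y ∂m, ‖p y‖ ≤ B)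
    (hf : Integrable f m) (h : ∀ k : ℕ, ∫ y, p y ^ k * f y ∂m = 0) {z c : ℂ} {ρ : ℝ}
    (hρ : ∀ᵐ y ∂m, ‖p y - c‖ ≤ ρ) (hz : ρ < ‖z - c‖) :
    ∫ y, Real.log ‖z - p y‖ * f y ∂m = 0 := by
  rcases eq_zero_or_neZero m with hm | hm
  · simp [hm]
  have hρ0 : 0 ≤ ρ := by
    obtain ⟨y, hy⟩ := hρ.exists
    exact (norm_nonneg _).trans hy
  have hzc : 0 < ‖z - c‖ := hρ0.trans_lt hz
  have hzc' : z - c ≠ 0 := norm_pos_iff.1 hzc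
  set q := ρ / ‖z - c‖ with hq
  have hq0 : 0 ≤ q := by positivity
  have hq1 : q < 1 := (div_lt_one hzc).2 hz
  set w : Y → ℂ := fun y => (p y - c) / (z - c) with hw
  have hwq : ∀ᵐ y ∂m, ‖w y‖ ≤ q := by
    filter_upwards [hρ] with y hy
    rw [hw, norm_div]
    exact div_le_div_of_nonneg_right hy (norm_nonneg _)
  -- For `k = 0` division by zero makes the term `0`, in accordance with the missing constant term
  -- of the series of `-log(1 - w)`.
  have hterm : ∀ k : ℕ, ∫ y, w y ^ k / k * f y ∂m = 0 := by
    intro k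
    have := integral_eval_mul_eq_zero hp hB hf h
      (Polynomial.C ((z - c) ^ k * (k : ℂ))⁻¹ * (Polynomial.X - Polynomial.C c) ^ k)
    simp only [Polynomial.eval_mul, Polynomial.eval_C, Polynomial.eval_pow, Polynomial.eval_sub,
      Polynomial.eval_X] at this
    rw [← this]
    congr 1; ext y
    rw [hw, div_pow, mul_inv]
    ring
  have hmw : Measurable w := by fun_prop
  have hsum : HasSum (fun k : ℕ => ∫ y, w y ^ k / k * f y ∂m)
      (∫ y, -Complex.log (1 - w y) * f y ∂m) := by
    refine hasSum_integral_of_dominated_convergence (fun k y => q ^ k * ‖f y‖) ?_ ?_ ?_ ?_ ?_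
    · intro k
      exact (by fun_prop : Measurable fun y => w y ^ k / k).aestronglyMeasurable.mul hf.ofReal.1
    · intro k
      filter_upwards [hwq] with y hy
      rw [norm_mul, norm_div, norm_pow, Complex.norm_real]
      gcongr
      rcases Nat.eq_zero_or_pos k with rfl | hk
      · simp
      · have hk' : (1 : ℝ) ≤ ‖(k : ℂ)‖ := by rw [Complex.norm_natCast]; exact_mod_cast hk
        exact (div_le_self (by positivity) hk').trans (pow_le_pow_left₀ (norm_nonneg _) hy k)
    · exact .of_forall fun y => (summable_geometric_of_lt_one hq0 hq1).mul_right _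
    · simp_rw [tsum_mul_right]
      exact hf.norm.const_mul _
    · filter_upwards [hwq] with y hy
      exact (Complex.hasSum_taylorSeries_neg_log (hy.trans_lt hq1)).mul_right _
  simp_rw [hterm] at hsum
  have hlog : ∫ y, -Complex.log (1 - w y) * f y ∂m = 0 := hsum.unique hasSum_zero
  have hwlt : ∀ᵐ y ∂m, 1 - w y ∈ Complex.slitPlane := by
    filter_upwards [hwq] with y hy
    exact Complex.mem_slitPlane_of_norm_lt_one (z := -w y) (by rw [norm_neg]; linarith)
      |> fun h => by simpa [sub_eq_add_neg] using h
  have hint : Integrable (fun y => -Complex.log (1 - w y) * f y) m := by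
    refine hf.ofReal.bdd_mul (c := (1 - q)⁻¹ / 2 + 1)
      (Complex.measurable_log.comp (measurable_const.sub hmw)).neg.aestronglyMeasurable ?_
    filter_upwards [hwq] with y hy
    rw [norm_neg]
    have h1 := Complex.norm_log_one_add_le (z := -w y) (by rw [norm_neg]; linarith)
    rw [norm_neg, ← sub_eq_add_neg] at h1
    refine h1.trans ?_
    have h2 : (1 - ‖w y‖)⁻¹ ≤ (1 - q)⁻¹ := inv_anti₀ (by linarith) (by linarith)
    have h3 : ‖w y‖ ^ 2 ≤ 1 := pow_le_one₀ (norm_nonneg _) (by linarith)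
    have h4 : ‖w y‖ ^ 2 * (1 - ‖w y‖)⁻¹ ≤ 1 * (1 - q)⁻¹ :=
      mul_le_mul h3 h2 (inv_nonneg.2 (by linarith)) zero_le_one
    linarith
  have hre : ∫ y, Real.log ‖1 - w y‖ * f y ∂m = 0 := by
    have h1 : ∫ y, (-Complex.log (1 - w y) * f y).re ∂m = 0 := by
      have := integral_re hint
      simp only [RCLike.re_to_complex] at this
      rw [this, hlog]; rfl
    rw [← neg_eq_zero, ← integral_neg, ← h1]
    congr 1; ext y
    rw [Complex.re_mul_ofReal, Complex.neg_re, Complex.log_re]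
    ring
  have hf0 : ∫ y, f y ∂m = 0 := by
    have := h 0
    simp only [pow_zero, one_mul] at this
    rw [integral_complex_ofReal] at this
    exact_mod_cast this
  -- The constant `log ‖z - c‖` is killed by the zeroth moment and `log ‖1 - w‖` by the higher ones.
  have hsplit : ∀ᵐ y ∂m, Real.log ‖z - p y‖ * f y
      = Real.log ‖z - c‖ * f y + Real.log ‖1 - w y‖ * f y := by
    filter_upwards [hwlt] with y hy
    rw [← add_mul, ← Real.log_mul hzc.ne' (norm_ne_zero_iff.2 (Complex.slitPlane_ne_zero hy)),
      ← norm_mul]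
    congr 3
    rw [hw]
    field_simp
    ring
  rw [integral_congr_ae hsplit, integral_add (hf.const_mul _), integral_const_mul, hf0, hre]
  · simp
  · have := hint.re.neg
    refine this.congr (.of_forall fun y => ?_)
    simp only [Pi.neg_apply, RCLike.re_to_complex, Complex.re_mul_ofReal, Complex.neg_re,
      Complex.log_re]
    ring

end moments
end SpectralDN

/-! ### Maximum principle and continuity of logarithmic potentials. -/

namespace SpectralDN
open Filter Topology
open scoped ENNReal ComplexConjugate

theorem integral_mul_sq_le {α : Type*} [MeasurableSpace α] {μ : Measure α} {f g : α → ℝ}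
    (hf : MemLp f 2 μ) (hg : MemLp g 2 μ) :
    (∫ x, |f x| * |g x| ∂μ) ^ 2 ≤ (∫ x, f x ^ 2 ∂μ) * ∫ x, g x ^ 2 ∂μ := by
  have h := integral_mul_norm_le_Lp_mul_Lq (μ := μ) (f := f) (g := g)
    Real.HolderConjugate.two_two (by simpa using hf) (by simpa using hg)
  have h2 := pow_le_pow_left₀ (by positivity) h 2
  simp only [Real.norm_eq_abs] at h2
  refine h2.trans (le_of_eq ?_)
  have e : ∀ u : α → ℝ, ((∫ x, |u x| ^ (2 : ℝ) ∂μ) ^ (1 / (2 : ℝ))) ^ 2 = ∫ x, u x ^ 2 ∂μ := by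
    intro u
    have : ∀ x, |u x| ^ (2 : ℝ) = u x ^ 2 := fun x => by
      rw [show (2 : ℝ) = ((2 : ℕ) : ℝ) by norm_num, Real.rpow_natCast, sq_abs]
    simp_rw [this]
    rw [← Real.sqrt_eq_rpow, Real.sq_sqrt (integral_nonneg fun x => sq_nonneg _)]
  rw [mul_pow, e, e]

/-- A continuous function that vanishes outside `Ω` and far away, and is the real part of a
holomorphic function in `Ω`, is not positive. -/
theorem nonpos_of_eq_re_holomorphic {u : ℂ → ℝ} (hu : Continuous u) {Ω : Set ℂ}
    (hΩ : IsOpen Ω) (h0 : ∀ z ∉ Ω, u z = 0) {R : ℝ} (hR : ∀ z, R < ‖z‖ → u z = 0) {G : ℂ → ℂ}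
    (hG : ∀ z ∈ Ω, DifferentiableAt ℂ G z) (hGu : ∀ z ∈ Ω, (G z).re = u z) (z : ℂ) : u z ≤ 0 := by
  by_contra! hz
  have hne : ∃ z₁ : ℂ, R < ‖z₁‖ := by
    refine ⟨((|R| + 1 : ℝ) : ℂ), ?_⟩
    rw [Complex.norm_real, Real.norm_of_nonneg (by positivity)]
    linarith [le_abs_self R]
  obtain ⟨z₀, hz₀⟩ : ∃ z₀, ∀ w, u w ≤ u z₀ := by
    apply hu.exists_forall_ge'
    swap
    · exact z
    rw [← Metric.cobounded_eq_cocompact]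
    have : ∀ᶠ w : ℂ in Bornology.cobounded ℂ, R < ‖w‖ :=
      tendsto_norm_cobounded_atTop.eventually_gt_atTop R
    filter_upwards [this] with w hw
    rw [hR w hw]
    exact hz.le
  have hM : 0 < u z₀ := hz.trans_le (hz₀ z)
  -- A positive maximum can be attained only inside `Ω`. There `‖exp G‖ = exp u` obeys the strong
  -- maximum principle, so the set of maximum points is open and closed, hence the whole plane. This
  -- contradicts the vanishing far away.
  have hopen : IsOpen {w | u w = u z₀} := by
    rw [isOpen_iff_mem_nhds]
    intro w hw
    have hw : u w = u z₀ := hw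
    have hwΩ : w ∈ Ω := by
      by_contra hcon
      rw [h0 w hcon] at hw
      linarith
    have hnear : ∀ᶠ v in 𝓝 w, v ∈ Ω := hΩ.mem_nhds hwΩ
    have hnorm : ∀ v ∈ Ω, ‖Complex.exp (G v)‖ = Real.exp (u v) := fun v hv => by
      rw [Complex.norm_exp, hGu v hv]
    have hmax := Complex.eventually_eq_of_isLocalMax_norm (f := fun v => Complex.exp (G v)) (c := w)
      (hnear.mono fun v hv => (hG v hv).cexp) (by
        filter_upwards [hnear] with v hv
        simp only [Function.comp]
        rw [hnorm v hv, hnorm w hwΩ, hw]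
        exact Real.exp_le_exp.2 (hz₀ v))
    filter_upwards [hmax, hnear] with v hv hvΩ
    have := congrArg norm hv
    rw [hnorm v hvΩ, hnorm w hwΩ] at this
    exact (Real.exp_injective this).trans hw
  have hclosed : IsClosed {w | u w = u z₀} := isClosed_eq hu continuous_const
  have huniv := IsClopen.eq_univ ⟨hclosed, hopen⟩ ⟨z₀, rfl⟩
  obtain ⟨z₁, hz₁⟩ := hne
  have : z₁ ∈ {w | u w = u z₀} := by rw [huniv]; exact mem_univ _
  have h1 : u z₁ = u z₀ := this
  rw [hR z₁ hz₁] at h1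
  linarith

theorem eq_zero_of_eq_re_holomorphic {u : ℂ → ℝ} (hu : Continuous u) {Ω : Set ℂ}
    (hΩ : IsOpen Ω) (h0 : ∀ z ∉ Ω, u z = 0) {R : ℝ} (hR : ∀ z, R < ‖z‖ → u z = 0) {G : ℂ → ℂ}
    (hG : ∀ z ∈ Ω, DifferentiableAt ℂ G z) (hGu : ∀ z ∈ Ω, (G z).re = u z) (z : ℂ) : u z = 0 := by
  refine le_antisymm (nonpos_of_eq_re_holomorphic hu hΩ h0 hR hG hGu z) ?_
  have := nonpos_of_eq_re_holomorphic (u := fun z => -u z) hu.neg hΩ (fun z hz => by simp [h0 z hz])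
    (R := R) (fun z hz => by simp [hR z hz]) (G := fun z => -G z) (fun z hz => (hG z hz).neg)
    (fun z hz => by simp [hGu z hz]) z
  linarith

section potential
variable {Y : Type*} [MeasurableSpace Y] {m : Measure Y} {p : Y → ℂ} {f : Y → ℝ}

/-- The error made by truncating the logarithm at `δ`. It lives where `d < δ`, so its `L²` norm
along a curve is small with `δ`. -/
theorem log_max_sub_log {d δ : ℝ} (hd : 0 < d) (hδ : 0 < δ) :
    Real.log (max d δ) - Real.log d = Real.posLog (δ / d) := by
  rcases le_total d δ with h | h
  · rw [max_eq_right h, ← Real.log_div hδ.ne' hd.ne', Real.posLog_eq_log]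
    rw [abs_of_pos (by positivity)]
    exact (one_le_div hd).2 h
  · rw [max_eq_left h, sub_self, eq_comm, Real.posLog_eq_zero_iff, abs_of_pos (by positivity)]
    exact (div_le_one hd).2 h

/-- The growth condition on a curve under which logarithmic potentials of `L²` densities are
continuous. -/
theorem memLp_posLog_div (hp : Measurable p) {K : ℝ}
    (hK : ∀ z : ℂ, ∀ δ > 0, ∫⁻ y, ENNReal.ofReal (Real.posLog (δ / ‖z - p y‖) ^ 2) ∂m
      ≤ ENNReal.ofReal (K * δ)) (z : ℂ) {δ : ℝ} (hδ : 0 < δ) :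
    MemLp (fun y => Real.posLog (δ / ‖z - p y‖)) 2 m := by
  have hpl : Measurable Real.posLog := Real.continuous_posLog.measurable
  refine memLp_two_of_lintegral
    (hpl.comp (by fun_prop : Measurable fun y => δ / ‖z - p y‖)).aestronglyMeasurable ?_
  refine lt_of_le_of_lt (le_of_eq ?_) ((hK z δ hδ).trans_lt ENNReal.ofReal_lt_top)
  congr 1; ext y
  rw [← ofReal_norm, ← ENNReal.ofReal_pow (norm_nonneg _), Real.norm_eq_abs, sq_abs]

theorem integrable_log_max_mul (hp : Measurable p) {B : ℝ} (hB : ∀ᵐ y ∂m, ‖p y‖ ≤ B)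
    (hf : Integrable f m) (z : ℂ) {δ : ℝ} (hδ : 0 < δ) :
    Integrable (fun y => Real.log (max ‖z - p y‖ δ) * f y) m := by
  refine hf.bdd_mul (c := max |Real.log δ| |Real.log (max (‖z‖ + B) δ)|)
    (by fun_prop : Measurable fun y => Real.log (max ‖z - p y‖ δ)).aestronglyMeasurable
    (hB.mono fun y hBy => ?_)
  rw [Real.norm_eq_abs]
  apply abs_le_max_abs_abs
  · exact Real.log_le_log hδ (le_max_right _ _)
  · refine Real.log_le_log (lt_max_of_lt_right hδ) (max_le_max_right _ ?_)
    exact (norm_sub_le _ _).trans (by linarith [hBy])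

theorem integrable_log_norm_sub_mul [IsFiniteMeasure m] (hp : Measurable p) {B : ℝ} (hB : ∀ᵐ y ∂m, ‖p y‖ ≤ B)
    {K : ℝ} (hK : ∀ z : ℂ, ∀ δ > 0, ∫⁻ y, ENNReal.ofReal (Real.posLog (δ / ‖z - p y‖) ^ 2) ∂m
      ≤ ENNReal.ofReal (K * δ)) (hne : ∀ z : ℂ, ∀ᵐ y ∂m, p y ≠ z) (hf : MemLp f 2 m) (z : ℂ) :
    Integrable (fun y => Real.log ‖z - p y‖ * f y) m := by
  have h1 := integrable_log_max_mul hp hB (hf.integrable (by norm_num)) z one_pos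
  have h2 : Integrable (fun y => Real.posLog (1 / ‖z - p y‖) * f y) m :=
    MemLp.integrable_mul (memLp_posLog_div hp hK z one_pos) hf
  refine (h1.sub h2).congr ?_
  filter_upwards [hne z] with y hy
  have hd : 0 < ‖z - p y‖ := norm_pos_iff.2 (sub_ne_zero.2 (Ne.symm hy))
  simp only [Pi.sub_apply]
  rw [← log_max_sub_log hd one_pos]
  ring

theorem continuous_integral_log_max (hp : Measurable p) {B : ℝ} (hB : ∀ᵐ y ∂m, ‖p y‖ ≤ B)
    (hf : Integrable f m) {δ : ℝ} (hδ : 0 < δ) :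
    Continuous fun z => ∫ y, Real.log (max ‖z - p y‖ δ) * f y ∂m := by
  rw [continuous_iff_continuousAt]
  intro z
  refine continuousAt_of_dominated
    (bound := fun y => max |Real.log δ| |Real.log (max (‖z‖ + 1 + B) δ)| * ‖f y‖)
    (.of_forall fun w => (integrable_log_max_mul hp hB hf w hδ).1) ?_ (hf.norm.const_mul _) ?_
  · filter_upwards [Metric.ball_mem_nhds z one_pos] with w hw
    refine hB.mono fun y hBy => ?_
    have hw' : ‖w‖ ≤ ‖z‖ + 1 := by
      have h1 : ‖w - z‖ < 1 := by simpa [dist_eq_norm] using hw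
      have h2 := norm_add_le (w - z) z
      rw [sub_add_cancel] at h2
      linarith
    rw [norm_mul, Real.norm_eq_abs (Real.log _)]
    gcongr
    apply abs_le_max_abs_abs
    · exact Real.log_le_log hδ (le_max_right _ _)
    · refine Real.log_le_log (lt_max_of_lt_right hδ) (max_le_max_right _ ?_)
      exact (norm_sub_le _ _).trans (by linarith [hBy])
  · refine .of_forall fun y => ?_
    have : ContinuousAt (fun z => Real.log (max ‖z - p y‖ δ)) z :=
      ContinuousAt.log (by fun_prop) (lt_max_of_lt_right hδ).ne'
    exact this.mul continuousAt_const

/-- Logarithmic potentials of `L²` densities are continuous. -/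
theorem continuous_integral_log_norm_sub [IsFiniteMeasure m] (hp : Measurable p) {B : ℝ} (hB : ∀ᵐ y ∂m, ‖p y‖ ≤ B)
    {K : ℝ} (hK : ∀ z : ℂ, ∀ δ > 0, ∫⁻ y, ENNReal.ofReal (Real.posLog (δ / ‖z - p y‖) ^ 2) ∂m
      ≤ ENNReal.ofReal (K * δ)) (hne : ∀ z : ℂ, ∀ᵐ y ∂m, p y ≠ z) (hf : MemLp f 2 m) :
    Continuous fun z => ∫ y, Real.log ‖z - p y‖ * f y ∂m := by
  have hf1 : Integrable f m := hf.integrable (by norm_num)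
  set δ : ℕ → ℝ := fun k => 1 / ((k : ℝ) + 1) with hδ
  have hδpos : ∀ k, 0 < δ k := fun k => Nat.one_div_pos_of_nat
  have hδlim : Tendsto δ atTop (𝓝 0) := tendsto_one_div_add_atTop_nhds_zero_nat
  -- By Cauchy-Schwarz the truncated potentials, which are continuous, converge at a rate `√δ` that
  -- does not depend on `z`. The maximum with `0` is there because `K` has no sign condition.
  have hest : ∀ k z, |(∫ y, Real.log (max ‖z - p y‖ (δ k)) * f y ∂m)
      - ∫ y, Real.log ‖z - p y‖ * f y ∂m| ≤ √(max K 0 * δ k * ∫ y, f y ^ 2 ∂m) := by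
    intro k z
    have hml := memLp_posLog_div hp hK z (hδpos k)
    have e1 : (∫ y, Real.log (max ‖z - p y‖ (δ k)) * f y ∂m)
        - ∫ y, Real.log ‖z - p y‖ * f y ∂m = ∫ y, Real.posLog (δ k / ‖z - p y‖) * f y ∂m := by
      rw [← integral_sub (integrable_log_max_mul hp hB hf1 z (hδpos k))
        (integrable_log_norm_sub_mul hp hB hK hne hf z)]
      apply integral_congr_ae
      filter_upwards [hne z] with y hy
      have hd : 0 < ‖z - p y‖ := norm_pos_iff.2 (sub_ne_zero.2 (Ne.symm hy))
      rw [← log_max_sub_log hd (hδpos k)]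
      ring
    rw [e1]
    apply Real.le_sqrt_of_sq_le
    have h1 : |∫ y, Real.posLog (δ k / ‖z - p y‖) * f y ∂m|
        ≤ ∫ y, |Real.posLog (δ k / ‖z - p y‖)| * |f y| ∂m := by
      simp_rw [← abs_mul]
      exact abs_integral_le_integral_abs
    have h2 := integral_mul_sq_le hml hf
    have h3 : ∫ y, Real.posLog (δ k / ‖z - p y‖) ^ 2 ∂m ≤ max K 0 * δ k := by
      rw [integral_eq_lintegral_of_nonneg_ae (.of_forall fun y => sq_nonneg _)
        hml.integrable_sq.1]
      refine ENNReal.toReal_le_of_le_ofReal (mul_nonneg (le_max_right _ _) (hδpos k).le) ?_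
      refine (hK z _ (hδpos k)).trans (ENNReal.ofReal_le_ofReal ?_)
      exact mul_le_mul_of_nonneg_right (le_max_left _ _) (hδpos k).le
    refine (pow_le_pow_left₀ (abs_nonneg _) h1 2).trans (h2.trans ?_)
    exact mul_le_mul_of_nonneg_right h3 (integral_nonneg fun y => sq_nonneg _)
  have hunif : TendstoUniformly (fun k z => ∫ y, Real.log (max ‖z - p y‖ (δ k)) * f y ∂m)
      (fun z => ∫ y, Real.log ‖z - p y‖ * f y ∂m) atTop := by
    rw [Metric.tendstoUniformly_iff]
    intro ε hε
    have hlim : Tendsto (fun k => √(max K 0 * δ k * ∫ y, f y ^ 2 ∂m)) atTop (𝓝 0) := by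
      have : Tendsto (fun k => √(max K 0 * δ k * ∫ y, f y ^ 2 ∂m)) atTop
          (𝓝 √(max K 0 * 0 * ∫ y, f y ^ 2 ∂m)) :=
        (Real.continuous_sqrt.tendsto _).comp ((hδlim.const_mul _).mul_const _)
      simpa using this
    filter_upwards [hlim.eventually_lt_const hε] with k hk z
    rw [dist_comm, Real.dist_eq]
    exact (hest k z).trans_lt hk
  exact hunif.continuous (.of_forall fun k => continuous_integral_log_max hp hB hf1 (hδpos k))

end potential
end SpectralDN

/-! ### From the potential to the masses of discs. -/

namespace SpectralDN
open Filter Topology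
open scoped ENNReal ComplexConjugate

theorem circleIntegrable_log_norm_sub (a c : ℂ) (ε : ℝ) :
    CircleIntegrable (fun z => Real.log ‖z - a‖) c ε :=
  MeromorphicOn.circleIntegrable_log_norm (f := fun z => z - a) (fun _ _ ↦ by fun_prop)

theorem abs_log_eq (x : ℝ) : |Real.log x| = 2 * Real.posLog x - Real.log x := by
  rw [Real.posLog]
  rcases le_total (Real.log x) 0 with h | h
  · rw [abs_of_nonpos h, max_eq_left h]; ring
  · rw [abs_of_nonneg h, max_eq_right h]; ring

/-- As `|log x| = 2 log⁺ x - log x`, a bound on `log⁺` and the known average of `log ‖z - a‖`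
suffice. The bound depends on `a` only through `‖a‖`, which is what Fubini needs over a bounded
curve. -/
theorem circleAverage_abs_log_le (a c : ℂ) {ε : ℝ} (hε : 0 < ε) :
    ∫ θ in (0)..(2 * Real.pi), |Real.log ‖circleMap c ε θ - a‖|
      ≤ 2 * Real.pi * (2 * Real.posLog (‖c‖ + ε + ‖a‖) + |Real.log ε|) := by
  have h1 := circleIntegrable_log_norm_sub a c ε
  have h2 := circleAverage_log_norm_sub_const_eq_log_radius_add_posLog (c := c) (a := a) hε.ne'
  rw [Real.circleAverage, smul_eq_mul, inv_mul_eq_iff_eq_mul₀ (by positivity)] at h2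
  have hpos : (0 : ℝ) ≤ 2 * Real.pi := by positivity
  have h3 : ∫ θ in (0)..(2 * Real.pi), |Real.log ‖circleMap c ε θ - a‖|
      ≤ ∫ θ in (0)..(2 * Real.pi), (2 * Real.posLog (‖c‖ + ε + ‖a‖)
        - Real.log ‖circleMap c ε θ - a‖) := by
    refine intervalIntegral.integral_mono hpos h1.abs
      (intervalIntegrable_const.sub h1) fun θ => ?_
    dsimp only
    rw [abs_log_eq]
    have h4 : ‖circleMap c ε θ‖ ≤ ‖c‖ + ε := by
      calc ‖circleMap c ε θ‖ = ‖c + (circleMap c ε θ - c)‖ := by congr 1; ring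
        _ ≤ ‖c‖ + ‖circleMap c ε θ - c‖ := norm_add_le _ _
        _ = ‖c‖ + ε := by rw [circleMap_sub_center, norm_circleMap_zero, abs_of_pos hε]
    have h5 : Real.posLog ‖circleMap c ε θ - a‖ ≤ Real.posLog (‖c‖ + ε + ‖a‖) :=
      Real.posLog_le_posLog (norm_nonneg _) ((norm_sub_le _ _).trans (by linarith))
    linarith
  refine h3.trans ?_
  rw [intervalIntegral.integral_sub intervalIntegrable_const h1, h2,
    intervalIntegral.integral_const, smul_eq_mul, sub_zero, ← mul_sub]
  gcongr
  have := Real.posLog_nonneg (x := ε⁻¹ * ‖c - a‖)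
  have := neg_abs_le (Real.log ε)
  linarith

section potential
variable {Y : Type*} [MeasurableSpace Y] {m : Measure Y} {p : Y → ℂ} {f : Y → ℝ}
  [IsFiniteMeasure m]

theorem integrable_circle_log (hp : Measurable p) {B : ℝ} (hB : ∀ᵐ y ∂m, ‖p y‖ ≤ B)
    (hf : Integrable f m) (c : ℂ) {ε : ℝ} (hε : 0 < ε) :
    Integrable (fun x : ℝ × Y => Real.log ‖circleMap c ε x.1 - p x.2‖ * f x.2)
      ((volume.restrict (Ioc 0 (2 * Real.pi))).prod m) := by
  have hmeas : AEStronglyMeasurable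
      (fun x : ℝ × Y => Real.log ‖circleMap c ε x.1 - p x.2‖ * f x.2)
      ((volume.restrict (Ioc 0 (2 * Real.pi))).prod m) := by
    have := (continuous_circleMap c ε).measurable
    exact (by fun_prop : Measurable fun x : ℝ × Y =>
      Real.log ‖circleMap c ε x.1 - p x.2‖).aestronglyMeasurable.mul hf.1.comp_snd
  rw [integrable_prod_iff' hmeas]
  have h2pi : (0 : ℝ) ≤ 2 * Real.pi := by positivity
  constructor
  · refine .of_forall fun y => ?_
    have := (intervalIntegrable_iff_integrableOn_Ioc_of_le h2pi).1
      (circleIntegrable_log_norm_sub (p y) c ε)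
    exact this.mul_const (f y)
  · refine Integrable.mono' (hf.norm.const_mul
      (2 * Real.pi * (2 * Real.posLog (‖c‖ + ε + B) + |Real.log ε|))) ?_ ?_
    · exact hmeas.norm.prod_swap.integral_prod_right'
    · refine hB.mono fun y hBy => ?_
      rw [Real.norm_of_nonneg (integral_nonneg fun θ => norm_nonneg _)]
      simp_rw [norm_mul]
      rw [integral_mul_const]
      gcongr
      rw [← intervalIntegral.integral_of_le h2pi]
      refine (circleAverage_abs_log_le (p y) c hε).trans ?_
      have hpm : Real.posLog (‖c‖ + ε + ‖p y‖) ≤ Real.posLog (‖c‖ + ε + B) :=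
        Real.posLog_le_posLog (by positivity) (by linarith [hBy])
      gcongr

/-- Average the potential over the circle of radius `ε` about `c`: the mean of `log ‖z - a‖` is `log
ε + log⁺(‖c - a‖/ε)`. The term `log ε` drops out because the total mass is zero. -/
theorem integral_posLog_eq_zero (hp : Measurable p) {B : ℝ} (hB : ∀ᵐ y ∂m, ‖p y‖ ≤ B)
    (hf : Integrable f m) (hf0 : ∫ y, f y ∂m = 0)
    (hu : ∀ z : ℂ, ∫ y, Real.log ‖z - p y‖ * f y ∂m = 0) (c : ℂ) {ε : ℝ} (hε : 0 < ε) :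
    ∫ y, Real.posLog (ε⁻¹ * ‖c - p y‖) * f y ∂m = 0 := by
  have h2pi : (0 : ℝ) ≤ 2 * Real.pi := by positivity
  have hsw := integral_integral_swap
    (f := fun θ y => Real.log ‖circleMap c ε θ - p y‖ * f y) (integrable_circle_log hp hB hf c hε)
  simp only [hu, integral_zero] at hsw
  have h1 : ∀ y, ∫ θ in Ioc 0 (2 * Real.pi), Real.log ‖circleMap c ε θ - p y‖ * f y
      = 2 * Real.pi * (Real.log ε * f y + Real.posLog (ε⁻¹ * ‖c - p y‖) * f y) := by
    intro y
    have h2 := circleAverage_log_norm_sub_const_eq_log_radius_add_posLog (c := c) (a := p y) hε.ne'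
    rw [Real.circleAverage, smul_eq_mul, inv_mul_eq_iff_eq_mul₀ (by positivity)] at h2
    rw [integral_mul_const, ← intervalIntegral.integral_of_le h2pi, h2]
    ring
  simp_rw [h1] at hsw
  rw [integral_const_mul, integral_add (hf.const_mul _), integral_const_mul, hf0] at hsw
  · have : 2 * Real.pi ≠ 0 := by positivity
    simpa [this] using hsw.symm
  · have hpl : Measurable Real.posLog := Real.continuous_posLog.measurable
    refine hf.bdd_mul (c := Real.posLog (ε⁻¹ * (‖c‖ + B)))
      (by fun_prop : Measurable fun y => Real.posLog (ε⁻¹ * ‖c - p y‖)).aestronglyMeasurable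
      (hB.mono fun y hBy => ?_)
    rw [Real.norm_of_nonneg Real.posLog_nonneg]
    refine Real.posLog_le_posLog (by positivity) ?_
    gcongr
    exact (norm_sub_le _ _).trans (by linarith [hBy])

/-- As a function of the logarithm of its argument, `log⁺` is 1-Lipschitz. This dominates the
difference quotients in the next proof. -/
theorem posLog_exp_mul_sub {t x : ℝ} (ht : 0 ≤ t) (hx : 0 ≤ x) :
    |Real.posLog (Real.exp t * x) - Real.posLog x| ≤ t := by
  rcases hx.eq_or_lt with rfl | hx
  · simpa using ht
  rw [Real.posLog, Real.posLog, Real.log_mul (Real.exp_pos t).ne' hx.ne', Real.log_exp]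
  refine (abs_max_sub_max_le_max _ _ _ _).trans ?_
  simp [abs_of_nonneg ht, ht]

/-- If the logarithmic potential vanishes identically, so does the mass of each ball. -/
theorem integral_ball_eq_zero (hp : Measurable p) {B : ℝ} (hB : ∀ᵐ y ∂m, ‖p y‖ ≤ B)
    (hf : Integrable f m) (hf0 : ∫ y, f y ∂m = 0)
    (hu : ∀ z : ℂ, ∫ y, Real.log ‖z - p y‖ * f y ∂m = 0) (c : ℂ) {ε : ℝ} (hε : 0 < ε) :
    ∫ y in {y | ‖c - p y‖ < ε}, f y ∂m = 0 := by
  have hpl : Measurable Real.posLog := Real.continuous_posLog.measurable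
  have hS : MeasurableSet {y | ‖c - p y‖ < ε} := measurableSet_lt (by fun_prop) measurable_const
  set t : ℕ → ℝ := fun k => 1 / ((k : ℝ) + 1) with ht
  have htpos : ∀ k, 0 < t k := fun k => Nat.one_div_pos_of_nat
  have htlim : Tendsto t atTop (𝓝 0) := tendsto_one_div_add_atTop_nhds_zero_nat
  have hint : ∀ {s : ℝ}, 0 < s → Integrable (fun y => Real.posLog (s * ‖c - p y‖) * f y) m := by
    intro s hs
    refine hf.bdd_mul (c := Real.posLog (s * (‖c‖ + B)))
      (by fun_prop : Measurable fun y => Real.posLog (s * ‖c - p y‖)).aestronglyMeasurable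
      (hB.mono fun y hBy => ?_)
    rw [Real.norm_of_nonneg Real.posLog_nonneg]
    refine Real.posLog_le_posLog (by positivity) ?_
    gcongr
    exact (norm_sub_le _ _).trans (by linarith [hBy])
  -- Difference quotients in the logarithm of the radius. The right derivative at `t = 0` of
  -- `log⁺(eᵗ x)` is `0` for `x < 1` and `1` for `x ≥ 1`, so in the limit the indicator of the
  -- complement of the open disc appears.
  set D : ℕ → Y → ℝ := fun k y => (Real.posLog (Real.exp (t k) * (ε⁻¹ * ‖c - p y‖))
    - Real.posLog (ε⁻¹ * ‖c - p y‖)) / t k with hD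
  have hD0 : ∀ k, ∫ y, D k y * f y ∂m = 0 := by
    intro k
    have e1 := integral_posLog_eq_zero hp hB hf hf0 hu c hε
    have e2 := integral_posLog_eq_zero hp hB hf hf0 hu c (ε := (Real.exp (t k) * ε⁻¹)⁻¹)
      (by positivity)
    rw [inv_inv] at e2
    have e3 : ∀ y, D k y * f y = (t k)⁻¹ * (Real.posLog (Real.exp (t k) * ε⁻¹ * ‖c - p y‖) * f y
        - Real.posLog (ε⁻¹ * ‖c - p y‖) * f y) := by
      intro y
      simp only [hD]
      rw [mul_assoc (Real.exp _)]
      field_simp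
    simp_rw [e3]
    rw [integral_const_mul, integral_sub (hint (by positivity)) (hint (by positivity)), e1, e2]
    simp
  have hlim : Tendsto (fun k => ∫ y, D k y * f y ∂m) atTop
      (𝓝 (∫ y, ({y | ‖c - p y‖ < ε}ᶜ.indicator 1 y) * f y ∂m)) := by
    refine tendsto_integral_of_dominated_convergence (fun y => ‖f y‖) ?_ hf.norm ?_ ?_
    · intro k
      exact (by fun_prop : Measurable (D k)).aestronglyMeasurable.mul hf.1
    · refine fun k => .of_forall fun y => ?_
      rw [norm_mul]
      apply mul_le_of_le_one_left (norm_nonneg _)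
      rw [Real.norm_eq_abs, hD, abs_div, abs_of_pos (htpos k), div_le_one (htpos k)]
      exact posLog_exp_mul_sub (htpos k).le (by positivity)
    · refine .of_forall fun y => Tendsto.mul_const _ ?_
      by_cases hy : ‖c - p y‖ < ε
      · have h1 : y ∉ {y | ‖c - p y‖ < ε}ᶜ := by simpa using hy
        rw [indicator_of_notMem h1]
        have hlt : ε⁻¹ * ‖c - p y‖ < 1 := by
          rw [inv_mul_lt_iff₀ hε, mul_one]; exact hy
        have h2 : Tendsto (fun k => Real.exp (t k) * (ε⁻¹ * ‖c - p y‖)) atTop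
            (𝓝 (Real.exp 0 * (ε⁻¹ * ‖c - p y‖))) :=
          ((Real.continuous_exp.tendsto _).comp htlim).mul_const _
        rw [Real.exp_zero, one_mul] at h2
        refine tendsto_const_nhds.congr' ?_
        filter_upwards [h2.eventually_lt_const hlt] with k hk
        have e1 : Real.posLog (ε⁻¹ * ‖c - p y‖) = 0 := by
          rw [Real.posLog_eq_zero_iff, abs_of_nonneg (by positivity)]; exact hlt.le
        have e2 : Real.posLog (Real.exp (t k) * (ε⁻¹ * ‖c - p y‖)) = 0 := by
          rw [Real.posLog_eq_zero_iff, abs_of_nonneg (by positivity)]; exact hk.le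
        simp [hD, e1, e2]
      · have h1 : y ∈ {y | ‖c - p y‖ < ε}ᶜ := hy
        rw [indicator_of_mem h1, Pi.one_apply]
        refine tendsto_const_nhds.congr fun k => ?_
        have hge : 1 ≤ ε⁻¹ * ‖c - p y‖ := by
          rw [le_inv_mul_iff₀ hε, mul_one]; exact not_lt.1 hy
        have hge2 : 1 ≤ Real.exp (t k) * (ε⁻¹ * ‖c - p y‖) :=
          one_le_mul_of_one_le_of_one_le (Real.one_le_exp (htpos k).le) hge
        simp only [hD]
        rw [Real.posLog_eq_log (by rwa [abs_of_nonneg (by positivity)]),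
          Real.posLog_eq_log (by rwa [abs_of_nonneg (by positivity)]),
          Real.log_mul (Real.exp_pos _).ne' (by positivity), Real.log_exp, add_sub_cancel_right,
          div_self (htpos k).ne']
  simp_rw [hD0] at hlim
  have h0 := tendsto_nhds_unique hlim tendsto_const_nhds
  have h1 : ∫ y, ({y | ‖c - p y‖ < ε}ᶜ.indicator 1 y) * f y ∂m
      = ∫ y in {y | ‖c - p y‖ < ε}ᶜ, f y ∂m := by
    rw [← integral_indicator hS.compl]
    congr 1; ext y
    by_cases hy : y ∈ {y | ‖c - p y‖ < ε}ᶜ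
    · rw [indicator_of_mem hy, indicator_of_mem hy]; simp
    · rw [indicator_of_notMem hy, indicator_of_notMem hy]; simp
  have h2 := integral_add_compl hS hf
  rw [hf0, ← h1, h0, add_zero] at h2
  exact h2

end potential
end SpectralDN

/-! ### Geometry of the convex polygon. -/

namespace SpectralDN
open Filter Topology
open scoped ENNReal ComplexConjugate

theorem finRotate_ne_self {n : ℕ} (hn : 3 ≤ n) (i : Fin n) : finRotate n i ≠ i := by
  obtain ⟨k, rfl⟩ := Nat.exists_eq_add_of_le' hn
  rw [finRotate_apply]
  simp

theorem finRotate_finRotate_ne_self {n : ℕ} (hn : 3 ≤ n) (i : Fin n) :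
    finRotate n (finRotate n i) ≠ i := by
  obtain ⟨k, rfl⟩ := Nat.exists_eq_add_of_le' hn
  rw [finRotate_apply, finRotate_apply, add_assoc]
  intro h
  have h2 : (1 + 1 : Fin (k + 2 + 1)) = 0 := by simpa using h
  have h3 := congrArg Fin.val h2
  rw [Fin.val_add] at h3
  simp only [Fin.val_one, Fin.val_zero] at h3
  rw [Nat.mod_eq_of_lt (by omega)] at h3
  omega

variable {n : ℕ}

/-- The unit vector along the `i`-th side. -/
noncomputable def dir (P : Polygon ℂ n) (i : Fin n) : ℂ := Complex.exp (Complex.I * angle P i)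

/-- The point of the `j`-th side with arc length parameter `τ`. -/
noncomputable def sidePoint (P : Polygon ℂ n) (y : Fin n × ℝ) : ℂ := midPoint P y.1 + dir P y.1 * y.2

/-- The signed distance to the line of the `i`-th side, positive on the left. -/
noncomputable def height (P : Polygon ℂ n) (i : Fin n) (z : ℂ) : ℝ := (conj (dir P i) * (z - midPoint P i)).im

/-- The exponent of the kernel of the `i`-th component of the operator `T` on the negative
real axis. -/
noncomputable def exponent (P : Polygon ℂ n) (i : Fin n) (y : Fin n × ℝ) : ℂ :=
  -Complex.I * (conj (dir P i) * (sidePoint P y - midPoint P i))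

variable {P : Polygon ℂ n}

theorem norm_dir (i : Fin n) : ‖dir P i‖ = 1 := by
  rw [dir, mul_comm, Complex.norm_exp_ofReal_mul_I]

theorem conj_dir_mul_dir (i : Fin n) : conj (dir P i) * dir P i = 1 := by
  rw [Complex.conj_mul', norm_dir]; norm_num

theorem conj_dir (i : Fin n) : conj (dir P i) = Complex.exp (-Complex.I * angle P i) := by
  rw [dir, ← Complex.exp_conj]; simp

theorem two_mul_halfLength_mul_dir (i : Fin n) :
    2 * (halfLength P i : ℂ) * dir P i = P (finRotate n i) - P i := by
  rw [halfLength, dir, angle, mul_comm Complex.I]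
  have := Complex.norm_mul_exp_arg_mul_I (P (finRotate n i) - P i)
  push_cast
  rw [mul_div_cancel₀ _ two_ne_zero]
  exact this

theorem sidePoint_neg_halfLength (i : Fin n) : sidePoint P (i, -halfLength P i) = P i := by
  have := two_mul_halfLength_mul_dir (P := P) i
  simp only [sidePoint, midPoint]
  push_cast
  linear_combination (-1 / 2 : ℂ) * this

theorem sidePoint_halfLength (i : Fin n) :
    sidePoint P (i, halfLength P i) = P (finRotate n i) := by
  have := two_mul_halfLength_mul_dir (P := P) i
  simp only [sidePoint, midPoint]
  linear_combination (1 / 2 : ℂ) * this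

theorem exponent_re (i : Fin n) (y : Fin n × ℝ) :
    (exponent P i y).re = height P i (sidePoint P y) := by
  rw [exponent, height, mul_comm (-Complex.I)]
  simp

theorem exponent_self (i : Fin n) (τ : ℝ) : exponent P i (i, τ) = -Complex.I * τ := by
  rw [exponent, sidePoint, add_sub_cancel_left, ← mul_assoc (conj _), conj_dir_mul_dir, one_mul]

theorem height_add_real_mul_dir (i : Fin n) (z : ℂ) (t : ℝ) :
    height P i (z + dir P i * t) = height P i z := by
  have : conj (dir P i) * (z + dir P i * t - midPoint P i)
      = conj (dir P i) * (z - midPoint P i) + t := by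
    linear_combination (t : ℂ) * conj_dir_mul_dir (P := P) i
  rw [height, this, height]; simp

theorem height_midPoint (i : Fin n) : height P i (midPoint P i) = 0 := by
  simp [height]

theorem height_self (i : Fin n) : height P i (P i) = 0 := by
  rw [← sidePoint_neg_halfLength, sidePoint, height_add_real_mul_dir, height_midPoint]

theorem height_finRotate (i : Fin n) : height P i (P (finRotate n i)) = 0 := by
  rw [← sidePoint_halfLength, sidePoint, height_add_real_mul_dir, height_midPoint]

theorem height_sidePoint_self (i : Fin n) (τ : ℝ) : height P i (sidePoint P (i, τ)) = 0 := by
  rw [sidePoint, height_add_real_mul_dir, height_midPoint]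

theorem height_sub (i : Fin n) (z w : ℂ) :
    height P i z - height P i w = (conj (dir P i) * (z - w)).im := by
  rw [height, height, ← Complex.sub_im]
  congr 1; ring

theorem exists_ne_ne (hP : IsConvexPolygon P) (i : Fin n) : ∃ j, j ≠ i ∧ j ≠ finRotate n i :=
  ⟨finRotate n (finRotate n i), finRotate_finRotate_ne_self hP.1 i, finRotate_ne_self hP.1 _⟩

theorem halfLength_pos (hP : IsConvexPolygon P) (i : Fin n) : 0 < halfLength P i := by
  obtain ⟨j, h1, h2⟩ := exists_ne_ne hP i
  have h := hP.2 i j h1 h2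
  rw [halfLength]
  apply div_pos _ two_pos
  rw [norm_pos_iff]
  intro h0
  rw [h0] at h
  simp at h

theorem height_vertex_pos (hP : IsConvexPolygon P) {i j : Fin n} (h1 : j ≠ i)
    (h2 : j ≠ finRotate n i) : 0 < height P i (P j) := by
  have h := hP.2 i j h1 h2
  have hσ := halfLength_pos hP i
  rw [← two_mul_halfLength_mul_dir] at h
  have h3 : height P i (P j) = (conj (dir P i) * (P j - P i)).im := by
    rw [← height_sub, height_self, sub_zero]
  rw [h3]
  have h4 : conj (2 * (halfLength P i : ℂ) * dir P i) * (P j - P i)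
      = ((2 * halfLength P i : ℝ) : ℂ) * (conj (dir P i) * (P j - P i)) := by
    simp only [map_mul, Complex.conj_ofReal, Complex.ofReal_mul, Complex.conj_ofNat,
      Complex.ofReal_ofNat]
    ring
  rw [h4, Complex.im_ofReal_mul] at h
  exact pos_of_mul_pos_right h (by positivity)

theorem height_vertex_nonneg (hP : IsConvexPolygon P) (i j : Fin n) : 0 ≤ height P i (P j) := by
  by_cases h1 : j = i
  · rw [h1, height_self]
  by_cases h2 : j = finRotate n i
  · rw [h2, height_finRotate]
  exact (height_vertex_pos hP h1 h2).le

/-- The height is affine along each side. This is linear interpolation between the two endpoints,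
cleared of denominators. -/
theorem two_mul_halfLength_mul_height (i j : Fin n) (τ : ℝ) :
    2 * halfLength P j * height P i (sidePoint P (j, τ)) =
      (halfLength P j - τ) * height P i (P j)
        + (halfLength P j + τ) * height P i (P (finRotate n j)) := by
  have h1 : height P i (sidePoint P (j, τ)) - height P i (P j)
      = (conj (dir P i) * dir P j).im * (τ + halfLength P j) := by
    rw [← sidePoint_neg_halfLength (P := P) j, height_sub, ← Complex.im_mul_ofReal]
    congr 1
    simp only [sidePoint]
    push_cast; ring
  have h2 : height P i (P (finRotate n j)) - height P i (sidePoint P (j, τ))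
      = (conj (dir P i) * dir P j).im * (halfLength P j - τ) := by
    rw [← sidePoint_halfLength (P := P) j, height_sub, ← Complex.im_mul_ofReal]
    congr 1
    simp only [sidePoint]
    push_cast; ring
  linear_combination (halfLength P j - τ) * h1 - (halfLength P j + τ) * h2

theorem height_sidePoint_nonneg (hP : IsConvexPolygon P) (i j : Fin n) {τ : ℝ}
    (hτ : τ ∈ Icc (-halfLength P j) (halfLength P j)) : 0 ≤ height P i (sidePoint P (j, τ)) := by
  have h := two_mul_halfLength_mul_height (P := P) i j τ
  have hσ := halfLength_pos hP j
  have h1 : 0 ≤ (halfLength P j - τ) * height P i (P j) :=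
    mul_nonneg (by linarith [hτ.2]) (height_vertex_nonneg hP i j)
  have h2 : 0 ≤ (halfLength P j + τ) * height P i (P (finRotate n j)) :=
    mul_nonneg (by linarith [hτ.1]) (height_vertex_nonneg hP i _)
  exact nonneg_of_mul_nonneg_right (by linarith : 0 ≤ 2 * halfLength P j * _) (by positivity)

/-- One of the endpoints of a side different from the `i`-th one is off the `i`-th line. -/
theorem height_endpoint_pos (hP : IsConvexPolygon P) {i j : Fin n} (hij : j ≠ i) :
    0 < height P i (P j) ∨ 0 < height P i (P (finRotate n j)) := by
  by_cases h2 : j = finRotate n i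
  · right
    subst h2
    exact height_vertex_pos hP (finRotate_finRotate_ne_self hP.1 i) (finRotate_ne_self hP.1 _)
  · exact Or.inl (height_vertex_pos hP hij h2)

theorem height_sidePoint_pos (hP : IsConvexPolygon P) {i j : Fin n} (hij : j ≠ i) {τ : ℝ}
    (hτ : τ ∈ Ioo (-halfLength P j) (halfLength P j)) : 0 < height P i (sidePoint P (j, τ)) := by
  have h := two_mul_halfLength_mul_height (P := P) i j τ
  have hσ := halfLength_pos hP j
  have h1 := height_vertex_nonneg hP i j
  have h2 := height_vertex_nonneg hP i (finRotate n j)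
  have h3 : 0 < halfLength P j - τ := by linarith [hτ.2]
  have h4 : 0 < halfLength P j + τ := by linarith [hτ.1]
  have h5 : 0 < 2 * halfLength P j * height P i (sidePoint P (j, τ)) := by
    rw [h]
    rcases height_endpoint_pos hP hij with h' | h'
    · have := mul_pos h3 h'; have := mul_nonneg h4.le h2; linarith
    · have := mul_pos h4 h'; have := mul_nonneg h3.le h1; linarith
  exact pos_of_mul_pos_right h5 (by positivity)

/-- The interior angle at a vertex. -/
theorem exists_interior_angle (hP : IsConvexPolygon P) (i : Fin n) :
    ∃ θ : ℝ, 0 < θ ∧ θ < Real.pi ∧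
      dir P (finRotate n i) = -Complex.exp (-(θ * Complex.I)) * dir P i := by
  set w := conj (dir P i) * dir P (finRotate n i) with hw
  have hwn : ‖w‖ = 1 := by rw [hw, norm_mul, RCLike.norm_conj, norm_dir, norm_dir, one_mul]
  -- The end of the next side lies strictly to the left of side `i`, so the boundary makes a genuine
  -- left turn.
  have hpos : 0 < w.im := by
    have h1 := height_vertex_pos hP (finRotate_finRotate_ne_self hP.1 i)
      (finRotate_ne_self hP.1 (finRotate n i))
    have h2 := height_finRotate (P := P) i
    have h3 := height_sub (P := P) i (P (finRotate n (finRotate n i))) (P (finRotate n i))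
    rw [h2, sub_zero, ← two_mul_halfLength_mul_dir] at h3
    have h4 : conj (dir P i) * (2 * (halfLength P (finRotate n i) : ℂ) * dir P (finRotate n i))
        = ((2 * halfLength P (finRotate n i) : ℝ) : ℂ) * w := by
      rw [hw]; push_cast; ring
    rw [h4, Complex.im_ofReal_mul] at h3
    rw [h3] at h1
    exact pos_of_mul_pos_right h1 (by have := halfLength_pos hP (finRotate n i); positivity)
  have harg1 : 0 < w.arg := by
    rcases (Complex.arg_nonneg_iff.2 hpos.le).eq_or_lt with h | h
    · exfalso
      have := Complex.arg_eq_zero_iff.1 h.symm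
      linarith [this.2]
    · exact h
  have harg2 : w.arg < Real.pi := by
    rcases (Complex.arg_le_pi w).eq_or_lt with h | h
    · exfalso
      have := Complex.arg_eq_pi_iff.1 h
      linarith [this.2]
    · exact h
  -- The argument of `w` is the exterior angle at the common vertex.
  refine ⟨Real.pi - w.arg, by linarith, by linarith, ?_⟩
  have h1 : dir P (finRotate n i) = w * dir P i := by
    rw [hw]; linear_combination (-dir P (finRotate n i)) * conj_dir_mul_dir (P := P) i
  have h2 : w = -Complex.exp (-((Real.pi - w.arg : ℝ) * Complex.I)) := by
    have h3 := Complex.norm_mul_exp_arg_mul_I w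
    rw [hwn, Complex.ofReal_one, one_mul] at h3
    rw [show (-((Real.pi - w.arg : ℝ) * Complex.I) : ℂ)
      = w.arg * Complex.I - Real.pi * Complex.I by push_cast; ring, Complex.exp_sub,
      Complex.exp_pi_mul_I, h3]
    ring
  rw [← h2, h1]

end SpectralDN

/-! ### Arc length measure on the boundary. -/

namespace SpectralDN
open Filter Topology
open scoped ENNReal ComplexConjugate

section fiber
variable {n : ℕ} {ν : Fin n → Measure ℝ}

/-- The measure on the disjoint union of `n` lines with prescribed restrictions. -/
noncomputable def fiberMeasure (ν : Fin n → Measure ℝ) : Measure (Fin n × ℝ) :=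
  ∑ j, (ν j).map (Prod.mk j)

theorem lintegral_fiberMeasure (f : Fin n × ℝ → ℝ≥0∞) :
    ∫⁻ y, f y ∂fiberMeasure ν = ∑ j, ∫⁻ τ, f (j, τ) ∂ν j := by
  rw [fiberMeasure, lintegral_finsetSum_measure]
  exact Finset.sum_congr rfl fun j _ => (measurableEmbedding_prodMk_left j).lintegral_map _

theorem ae_fiberMeasure_iff {q : Fin n × ℝ → Prop} :
    (∀ᵐ y ∂fiberMeasure ν, q y) ↔ ∀ j, ∀ᵐ τ ∂ν j, q (j, τ) := by
  simp only [fiberMeasure, ae_finsetSum_measure_iff, Finset.mem_univ, true_implies,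
    (measurableEmbedding_prodMk_left _).ae_map_iff]

theorem integrable_fiberMeasure_iff {E : Type*} [NormedAddCommGroup E] {f : Fin n × ℝ → E} :
    Integrable f (fiberMeasure ν) ↔ ∀ j, Integrable (fun τ => f (j, τ)) (ν j) := by
  simp only [fiberMeasure, integrable_finsetSum_measure, Finset.mem_univ, true_implies,
    (measurableEmbedding_prodMk_left _).integrable_map_iff]
  rfl

theorem integral_fiberMeasure {E : Type*} [NormedAddCommGroup E] [NormedSpace ℝ E]
    {f : Fin n × ℝ → E} (hf : Integrable f (fiberMeasure ν)) :
    ∫ y, f y ∂fiberMeasure ν = ∑ j, ∫ τ, f (j, τ) ∂ν j := by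
  have hf' := hf
  rw [fiberMeasure] at hf' ⊢
  rw [integrable_finsetSum_measure] at hf'
  rw [integral_finsetSum_measure hf']
  exact Finset.sum_congr rfl fun j _ => (measurableEmbedding_prodMk_left j).integral_map _

theorem aestronglyMeasurable_fiberMeasure_iff {E : Type*} [NormedAddCommGroup E]
    {f : Fin n × ℝ → E} : AEStronglyMeasurable f (fiberMeasure ν) ↔
      ∀ j, AEStronglyMeasurable (fun τ => f (j, τ)) (ν j) := by
  rw [fiberMeasure, ← Measure.sum_fintype, aestronglyMeasurable_sum_measure_iff]
  exact forall_congr' fun j =>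
    (measurableEmbedding_prodMk_left (β := ℝ) j).aestronglyMeasurable_map_iff

theorem memLp_two_fiberMeasure_iff {E : Type*} [NormedAddCommGroup E] {f : Fin n × ℝ → E} :
    MemLp f 2 (fiberMeasure ν) ↔ ∀ j, MemLp (fun τ => f (j, τ)) 2 (ν j) := by
  constructor
  · intro h j
    refine memLp_two_of_lintegral (aestronglyMeasurable_fiberMeasure_iff.1 h.1 j) ?_
    have h2 := lintegral_enorm_sq_lt_top h
    rw [lintegral_fiberMeasure] at h2
    exact (ENNReal.sum_lt_top.1 h2) j (Finset.mem_univ j)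
  · intro h
    refine memLp_two_of_lintegral (aestronglyMeasurable_fiberMeasure_iff.2 fun j => (h j).1) ?_
    rw [lintegral_fiberMeasure]
    exact ENNReal.sum_lt_top.2 fun j _ => lintegral_enorm_sq_lt_top (h j)

instance [∀ j, IsFiniteMeasure (ν j)] : IsFiniteMeasure (fiberMeasure ν) := by
  refine ⟨?_⟩
  rw [← lintegral_one, lintegral_fiberMeasure]
  refine ENNReal.sum_lt_top.2 fun j _ => ?_
  rw [lintegral_one]
  exact measure_lt_top _ _

end fiber

variable {n : ℕ} {P : Polygon ℂ n}

/-- The arc length measure of the boundary. -/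
noncomputable def bdryMeasure (P : Polygon ℂ n) : Measure (Fin n × ℝ) :=
  fiberMeasure fun j => volume.restrict (Icc (-halfLength P j) (halfLength P j))

instance : IsFiniteMeasure (bdryMeasure P) := by
  unfold bdryMeasure; infer_instance

theorem ae_bdryMeasure_of_forall {q : Fin n × ℝ → Prop}
    (h : ∀ j, ∀ τ ∈ Icc (-halfLength P j) (halfLength P j), q (j, τ)) :
    ∀ᵐ y ∂bdryMeasure P, q y :=
  ae_fiberMeasure_iff.2 fun j => by
    filter_upwards [ae_restrict_mem measurableSet_Icc] with τ hτ using h j τ hτ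

theorem continuous_fst_iff {X : Type*} [TopologicalSpace X] {f : Fin n × ℝ → X} :
    Continuous f ↔ ∀ j, Continuous fun τ => f (j, τ) := by
  rw [continuous_prod_of_discrete_left]

theorem continuous_sidePoint : Continuous (sidePoint P) := by
  rw [continuous_fst_iff]
  intro j
  unfold sidePoint
  fun_prop

theorem measurable_sidePoint : Measurable (sidePoint P) := continuous_sidePoint.measurable

theorem continuous_exponent (i : Fin n) : Continuous (exponent P i) := by
  have := continuous_sidePoint (P := P)
  unfold exponent
  fun_prop

theorem measurable_exponent (i : Fin n) : Measurable (exponent P i) :=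
  (continuous_exponent i).measurable

theorem ae_exponent_re_nonneg (hP : IsConvexPolygon P) (i : Fin n) :
    ∀ᵐ y ∂bdryMeasure P, 0 ≤ (exponent P i y).re :=
  ae_bdryMeasure_of_forall fun j τ hτ => by
    rw [exponent_re]; exact height_sidePoint_nonneg hP i j hτ

theorem exists_bound_sidePoint (P : Polygon ℂ n) : ∃ B : ℝ, ∀ j,
    ∀ τ ∈ Icc (-halfLength P j) (halfLength P j), ‖sidePoint P (j, τ)‖ ≤ B := by
  have h : ∀ j, ∃ B : ℝ, ∀ τ ∈ Icc (-halfLength P j) (halfLength P j),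
      ‖sidePoint P (j, τ)‖ ≤ B := fun j =>
    isCompact_Icc.exists_bound_of_continuousOn
      ((continuous_fst_iff.1 continuous_sidePoint j).continuousOn)
  choose B hB using h
  refine ⟨∑ j, |B j|, fun j τ hτ => (hB j τ hτ).trans ((le_abs_self _).trans ?_)⟩
  exact Finset.single_le_sum (f := fun j => |B j|) (fun j _ => abs_nonneg _) (Finset.mem_univ j)

/-- The bound `log x ≤ 4 x^{1/4}` gives `log⁺(δ/|t|)² ≤ 16 (δ/|t|)^{1/2}` for `0 < |t| ≤ δ`. The
integral of the right side over `[-δ, δ]` is `2 · 16 · 2 δ = 64 δ`. -/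
theorem lintegral_posLog_div_abs {δ : ℝ} (hδ : 0 < δ) (x : ℝ) :
    ∫⁻ τ, ENNReal.ofReal (Real.posLog (δ / |x - τ|) ^ 2) ≤ ENNReal.ofReal (64 * δ) := by
  set g : ℝ → ℝ := (Ioc 0 δ).indicator fun s => 16 * δ ^ (1 / 2 : ℝ) * s ^ (-(1 / 2) : ℝ) with hg
  have hg0 : ∀ s, 0 ≤ g s := by
    intro s
    rw [hg]
    apply indicator_nonneg
    intro s hs
    have := hs.1
    positivity
  have hgi : ∫ t, g |t| = 64 * δ := by
    rw [integral_comp_abs, ← integral_indicator measurableSet_Ioi, hg, indicator_indicator,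
      inter_eq_right.2 Ioc_subset_Ioi_self, integral_indicator measurableSet_Ioc,
      ← intervalIntegral.integral_of_le hδ.le, intervalIntegral.integral_const_mul,
      integral_rpow (Or.inl (by norm_num))]
    norm_num
    have : δ ^ (1 / 2 : ℝ) * δ ^ (1 / 2 : ℝ) = δ := by
      rw [← Real.rpow_add hδ]; norm_num
    linear_combination 64 * this
  have hgint : Integrable fun t => g |t| := by
    apply Integrable.of_integral_ne_zero
    rw [hgi]; positivity
  have hle : ∀ t : ℝ, t ≠ 0 → Real.posLog (δ / |t|) ^ 2 ≤ g |t| := by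
    intro t ht
    have ht' : 0 < |t| := abs_pos.2 ht
    by_cases h : |t| ≤ δ
    · rw [hg, indicator_of_mem (show |t| ∈ Ioc 0 δ from ⟨ht', h⟩)]
      have h1 : 1 ≤ δ / |t| := (one_le_div ht').2 h
      rw [Real.posLog_eq_log (by rwa [abs_of_pos (by positivity)])]
      have h2 := Real.log_le_rpow_div (x := δ / |t|) (by positivity) (show (0 : ℝ) < 1 / 4 by norm_num)
      refine (pow_le_pow_left₀ (Real.log_nonneg h1) h2 2).trans (le_of_eq ?_)
      rw [Real.div_rpow hδ.le ht'.le, Real.rpow_neg ht'.le, div_div_eq_mul_div, div_one,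
        mul_pow, div_pow,
        ← Real.rpow_natCast, ← Real.rpow_natCast (|t| ^ _), ← Real.rpow_mul hδ.le,
        ← Real.rpow_mul ht'.le]
      norm_num
      ring
    · have : Real.posLog (δ / |t|) = 0 := by
        rw [Real.posLog_eq_zero_iff, abs_of_pos (by positivity), div_le_one ht']
        exact (not_le.1 h).le
      rw [this]
      simpa using hg0 _
  rw [lintegral_sub_left_eq_self (fun t => ENNReal.ofReal (Real.posLog (δ / |t|) ^ 2)) x]
  rw [← hgi, ofReal_integral_eq_lintegral_ofReal hgint (.of_forall fun t => hg0 _)]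
  apply lintegral_mono_ae
  have : ∀ᵐ t : ℝ, t ≠ 0 := by simp [ae_iff, measure_singleton]
  filter_upwards [this] with t ht
  exact ENNReal.ofReal_le_ofReal (hle t ht)

/-- Orthogonal projection onto the line of a side does not increase distances. This reduces
logarithmic singularities on the boundary to one dimension. -/
theorem abs_re_sub_le_norm_sub_sidePoint (j : Fin n) (z : ℂ) (τ : ℝ) :
    |(conj (dir P j) * (z - midPoint P j)).re - τ| ≤ ‖z - sidePoint P (j, τ)‖ := by
  have h : conj (dir P j) * (z - sidePoint P (j, τ))
      = conj (dir P j) * (z - midPoint P j) - τ := by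
    rw [sidePoint]
    linear_combination (-τ : ℂ) * conj_dir_mul_dir (P := P) j
  have h2 : ‖z - sidePoint P (j, τ)‖ = ‖conj (dir P j) * (z - sidePoint P (j, τ))‖ := by
    rw [norm_mul, RCLike.norm_conj, norm_dir, one_mul]
  rw [h2, h]
  refine le_trans (le_of_eq ?_) (Complex.abs_re_le_norm _)
  simp

theorem ae_sidePoint_ne (z : ℂ) : ∀ᵐ y ∂bdryMeasure P, sidePoint P y ≠ z := by
  refine ae_fiberMeasure_iff.2 fun j => ae_restrict_of_ae ?_
  have : ∀ᵐ τ : ℝ, τ ≠ (conj (dir P j) * (z - midPoint P j)).re := by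
    simp [ae_iff, measure_singleton]
  filter_upwards [this] with τ hτ h
  have h1 := abs_re_sub_le_norm_sub_sidePoint (P := P) j z τ
  rw [h, sub_self, norm_zero] at h1
  have h2 := abs_eq_zero.1 (le_antisymm h1 (abs_nonneg _))
  exact hτ (by linarith)

theorem lintegral_posLog_div_norm_le (z : ℂ) {δ : ℝ} (hδ : 0 < δ) :
    ∫⁻ y, ENNReal.ofReal (Real.posLog (δ / ‖z - sidePoint P y‖) ^ 2) ∂bdryMeasure P
      ≤ ENNReal.ofReal (n * 64 * δ) := by
  rw [bdryMeasure, lintegral_fiberMeasure]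
  calc _ ≤ ∑ _j : Fin n, ENNReal.ofReal (64 * δ) := by
        refine Finset.sum_le_sum fun j _ => ?_
        set x := (conj (dir P j) * (z - midPoint P j)).re with hx
        refine (lintegral_mono_ae ?_).trans ((lintegral_mono' Measure.restrict_le_self le_rfl).trans
          (lintegral_posLog_div_abs hδ x))
        have : ∀ᵐ τ : ℝ, τ ≠ x := by simp [ae_iff, measure_singleton]
        filter_upwards [ae_restrict_of_ae this] with τ hτ
        have h1 : 0 < |x - τ| := abs_pos.2 (sub_ne_zero.2 hτ.symm)
        have h2 := abs_re_sub_le_norm_sub_sidePoint (P := P) j z τ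
        apply ENNReal.ofReal_le_ofReal
        refine pow_le_pow_left₀ Real.posLog_nonneg (Real.posLog_le_posLog (by positivity) ?_) 2
        exact div_le_div_of_nonneg_left hδ.le h1 h2
    _ = ENNReal.ofReal (n * 64 * δ) := by
        rw [Finset.sum_const, Finset.card_univ, Fintype.card_fin, ← ENNReal.ofReal_nsmul]
        congr 1; simp; ring

end SpectralDN

/-! ### Injectivity: a boundary density with vanishing moments is zero. -/

namespace SpectralDN
open Filter Topology
open scoped ENNReal ComplexConjugate

variable {n : ℕ} {P : Polygon ℂ n} {f : Fin n × ℝ → ℝ}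

theorem continuous_height (i : Fin n) : Continuous (height P i) := by
  unfold height
  fun_prop

/-- A point strictly outside the line of some side is separated from the polygon by a large circle
centred far to the left of that side, so the moment criterion for vanishing potentials applies. -/
theorem potential_eq_zero_of_height_neg (hP : IsConvexPolygon P) (hf : Integrable f (bdryMeasure P))
    (hmom : ∀ k : ℕ, ∫ y, sidePoint P y ^ k * f y ∂bdryMeasure P = 0) {i : Fin n} {z : ℂ}
    (hz : height P i z < 0) :
    ∫ y, Real.log ‖z - sidePoint P y‖ * f y ∂bdryMeasure P = 0 := by
  obtain ⟨B, hB⟩ := exists_bound_sidePoint P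
  have hBae : ∀ᵐ y ∂bdryMeasure P, ‖sidePoint P y‖ ≤ B := ae_bdryMeasure_of_forall hB
  set h₀ := -height P i z with hh₀
  have hpos : 0 < h₀ := by linarith
  -- The centre is `z + s i dirᵢ`. In the rotated frame a boundary point `w` relative to `z` has
  -- `‖w‖ ≤ B + ‖z‖` and `Im w ≥ h₀`. Hence `‖w - is‖² ≤ (B + ‖z‖)² - 2 s h₀ + s² = s² - 1` for this
  -- `s`, whereas `z` is at distance `s`.
  set s := ((B + ‖z‖) ^ 2 + 1) / (2 * h₀) with hs
  have hs0 : 0 < s := by positivity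
  have hs2 : 2 * s * h₀ = (B + ‖z‖) ^ 2 + 1 := by rw [hs]; field_simp
  refine integral_log_norm_sub_eq_zero measurable_sidePoint hBae hf hmom
    (c := z + s * Complex.I * dir P i) (ρ := √(s ^ 2 - 1)) ?_ ?_
  · refine ae_bdryMeasure_of_forall fun j τ hτ => Real.le_sqrt_of_sq_le ?_
    set w := conj (dir P i) * (sidePoint P (j, τ) - z) with hw
    have hwim : h₀ ≤ w.im := by
      rw [hw, ← height_sub]
      linarith [height_sidePoint_nonneg hP i j hτ]
    have hwn : ‖w‖ ≤ B + ‖z‖ := by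
      rw [hw, norm_mul, RCLike.norm_conj, norm_dir, one_mul]
      exact (norm_sub_le _ _).trans (by linarith [hB j τ hτ])
    have h1 : ‖sidePoint P (j, τ) - (z + s * Complex.I * dir P i)‖ = ‖w - s * Complex.I‖ := by
      have : w - s * Complex.I
          = conj (dir P i) * (sidePoint P (j, τ) - (z + s * Complex.I * dir P i)) := by
        rw [hw]; linear_combination (s * Complex.I) * conj_dir_mul_dir (P := P) i
      rw [this, norm_mul, RCLike.norm_conj, norm_dir, one_mul]
    rw [h1, ← Complex.normSq_eq_norm_sq, Complex.normSq_apply]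
    have h2 : w.re * w.re + w.im * w.im ≤ (B + ‖z‖) ^ 2 := by
      rw [← Complex.normSq_apply, Complex.normSq_eq_norm_sq]
      exact pow_le_pow_left₀ (norm_nonneg _) hwn 2
    simp
    nlinarith [mul_le_mul_of_nonneg_left hwim hs0.le]
  · have : ‖z - (z + s * Complex.I * dir P i)‖ = s := by
      rw [sub_add_cancel_left, norm_neg, norm_mul, norm_mul, norm_dir, Complex.norm_I,
        Complex.norm_real, Real.norm_of_nonneg hs0.le, mul_one, mul_one]
    rw [this, Real.sqrt_lt' hs0]
    linarith

/-- The kernel of the complex potential, in terms of a branch of the logarithm that is holomorphic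
to the left of the side. -/
noncomputable def complexKernel (P : Polygon ℂ n) (z : ℂ) (y : Fin n × ℝ) : ℂ :=
  -Complex.I * (conj (dir P y.1) * (z - sidePoint P y))

theorem complexKernel_re (z : ℂ) (y : Fin n × ℝ) :
    (complexKernel P z y).re = height P y.1 z := by
  have h1 := height_sub (P := P) y.1 z (sidePoint P y)
  rw [height_sidePoint_self y.1 y.2, sub_zero] at h1
  rw [h1, complexKernel]
  simp

theorem norm_complexKernel (z : ℂ) (y : Fin n × ℝ) :
    ‖complexKernel P z y‖ = ‖z - sidePoint P y‖ := by
  rw [complexKernel, norm_mul, norm_mul, norm_neg, Complex.norm_I, RCLike.norm_conj, norm_dir,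
    one_mul, one_mul]

theorem measurable_conj_dir : Measurable fun y : Fin n × ℝ => conj (dir P y.1) :=
  (continuous_fst_iff.2 fun j =>
    (continuous_const : Continuous fun _ : ℝ => conj (dir P j))).measurable

theorem measurable_complexKernel (z : ℂ) : Measurable (complexKernel P z) := by
  have := measurable_sidePoint (P := P)
  have := measurable_conj_dir (P := P)
  unfold complexKernel
  fun_prop

theorem exists_height_ge {z : ℂ} (hz : ∀ i, 0 < height P i z) : ∃ d > 0, ∀ i, d ≤ height P i z := by
  rcases isEmpty_or_nonempty (Fin n) with he | he
  · exact ⟨1, one_pos, fun i => he.elim i⟩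
  · obtain ⟨i, hi⟩ := Finite.exists_min fun i => height P i z
    exact ⟨_, hz i, hi⟩

theorem integrable_log_complexKernel (hf : Integrable f (bdryMeasure P)) {z : ℂ}
    (hz : ∀ i, 0 < height P i z) :
    Integrable (fun y => Complex.log (complexKernel P z y) * f y) (bdryMeasure P) := by
  obtain ⟨B, hB⟩ := exists_bound_sidePoint P
  have hBae : ∀ᵐ y ∂bdryMeasure P, ‖sidePoint P y‖ ≤ B := ae_bdryMeasure_of_forall hB
  obtain ⟨d, hd, hdi⟩ := exists_height_ge hz
  refine hf.ofReal.bdd_mul (c := max |Real.log d| |Real.log (‖z‖ + B)| + Real.pi)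
    (Complex.measurable_log.comp (measurable_complexKernel z)).aestronglyMeasurable ?_
  filter_upwards [hBae] with y hy
  refine (Complex.norm_le_abs_re_add_abs_im _).trans (add_le_add ?_ ?_)
  · rw [Complex.log_re]
    have h1 : d ≤ ‖complexKernel P z y‖ :=
      (hdi y.1).trans ((complexKernel_re z y).symm.le.trans (Complex.re_le_norm _))
    apply abs_le_max_abs_abs
    · exact Real.log_le_log hd h1
    · refine Real.log_le_log (lt_of_lt_of_le hd h1) ?_
      rw [norm_complexKernel]
      exact (norm_sub_le _ _).trans (by linarith)
  · rw [Complex.log_im]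
    exact Complex.abs_arg_le_pi _

/-- The function whose real part is the potential is holomorphic inside the polygon. -/
theorem differentiableAt_complexPotential (hf : Integrable f (bdryMeasure P)) {z : ℂ}
    (hz : ∀ i, 0 < height P i z) :
    DifferentiableAt ℂ (fun z => ∫ y, Complex.log (complexKernel P z y) * f y ∂bdryMeasure P) z := by
  obtain ⟨d, hd, hdi⟩ := exists_height_ge hz
  -- Heights are 1-Lipschitz. On this disc the kernel therefore has real part at least `d/2`, away
  -- from both the branch cut and the zero of the argument, uniformly in the boundary point.
  have hball : ∀ w ∈ Metric.ball z (d / 2), ∀ i, d / 2 ≤ height P i w := by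
    intro w hw i
    have h1 := height_sub (P := P) i z w
    have h2 : (conj (dir P i) * (z - w)).im ≤ ‖z - w‖ := by
      refine (Complex.im_le_norm _).trans (le_of_eq ?_)
      rw [norm_mul, RCLike.norm_conj, norm_dir, one_mul]
    have h3 : ‖z - w‖ < d / 2 := by rw [← dist_eq_norm, dist_comm]; exact hw
    linarith [hdi i]
  have hslit : ∀ w ∈ Metric.ball z (d / 2), ∀ y, complexKernel P w y ∈ Complex.slitPlane :=
    fun w hw y => by
      left
      rw [complexKernel_re]
      linarith [hball w hw y.1]
  have key := hasDerivAt_integral_of_dominated_loc_of_deriv_le (μ := bdryMeasure P)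
    (F := fun w y => Complex.log (complexKernel P w y) * f y)
    (F' := fun w y => (-Complex.I * conj (dir P y.1)) / complexKernel P w y * f y)
    (bound := fun y => (d / 2)⁻¹ * ‖f y‖) (Metric.ball_mem_nhds z (half_pos hd))
    (.of_forall fun w => (Complex.measurable_log.comp
      (measurable_complexKernel w)).aestronglyMeasurable.mul hf.ofReal.1)
    (integrable_log_complexKernel hf hz) ?_ ?_ (hf.norm.const_mul _) ?_
  · exact key.2.differentiableAt
  · have hm := measurable_complexKernel (P := P) z
    have := measurable_conj_dir (P := P)
    exact (by fun_prop : Measurable fun y =>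
      (-Complex.I * conj (dir P y.1)) / complexKernel P z y).aestronglyMeasurable.mul hf.ofReal.1
  · refine .of_forall fun y w hw => ?_
    have h1 : d / 2 ≤ ‖complexKernel P w y‖ :=
        (hball w hw y.1).trans ((complexKernel_re w y).symm.le.trans (Complex.re_le_norm _))
    rw [norm_mul, Complex.norm_real, norm_div, norm_mul, norm_neg, Complex.norm_I,
      RCLike.norm_conj, norm_dir, one_mul, one_div]
    have h2 := inv_anti₀ (half_pos hd) h1
    exact mul_le_mul_of_nonneg_right h2 (norm_nonneg _)
  · refine .of_forall fun y w hw => ?_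
    have h1 : HasDerivAt (fun w => complexKernel P w y) (-Complex.I * conj (dir P y.1)) w := by
      have := (((hasDerivAt_id' w).sub_const (sidePoint P y)).const_mul
        (conj (dir P y.1))).const_mul (-Complex.I)
      simpa [complexKernel] using this
    exact (h1.clog (hslit w hw y)).mul_const _

theorem re_complexPotential (hf : Integrable f (bdryMeasure P)) {z : ℂ}
    (hz : ∀ i, 0 < height P i z) :
    (∫ y, Complex.log (complexKernel P z y) * f y ∂bdryMeasure P).re
      = ∫ y, Real.log ‖z - sidePoint P y‖ * f y ∂bdryMeasure P := by
  have h := integral_re (integrable_log_complexKernel hf hz)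
  simp only [RCLike.re_to_complex] at h
  rw [← h]
  congr 1; ext y
  rw [Complex.re_mul_ofReal, Complex.log_re, norm_complexKernel]

/-- A density of zero logarithmic potential vanishes. -/
theorem potential_eq_zero (hP : IsConvexPolygon P) (hf : MemLp f 2 (bdryMeasure P))
    (hmom : ∀ k : ℕ, ∫ y, sidePoint P y ^ k * f y ∂bdryMeasure P = 0) (z : ℂ) :
    ∫ y, Real.log ‖z - sidePoint P y‖ * f y ∂bdryMeasure P = 0 := by
  obtain ⟨B, hB⟩ := exists_bound_sidePoint P
  have hBae : ∀ᵐ y ∂bdryMeasure P, ‖sidePoint P y‖ ≤ B := ae_bdryMeasure_of_forall hB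
  have hf1 : Integrable f (bdryMeasure P) := hf.integrable (by norm_num)
  have hcont := continuous_integral_log_norm_sub measurable_sidePoint hBae (K := n * 64)
    (fun z δ hδ => lintegral_posLog_div_norm_le z hδ) ae_sidePoint_ne hf
  refine eq_zero_of_eq_re_holomorphic hcont (Ω := {z | ∀ i, 0 < height P i z}) ?_ ?_ (R := B) ?_
    (fun z hz => differentiableAt_complexPotential hf1 hz) (fun z hz => re_complexPotential hf1 hz) z
  · simp only [Set.ofPred_forall]
    exact isOpen_iInter_of_finite fun i => isOpen_lt continuous_const (continuous_height i)
  · intro z hz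
    simp only [Set.mem_ofPred_eq, not_forall, not_lt] at hz
    obtain ⟨i, hi⟩ := hz
    -- Points on the line of side `i` are reached from the strictly outer side along the inward
    -- normal, and continuity carries the vanishing over.
    have hlim : Tendsto (fun t : ℝ => ∫ y, Real.log ‖(z - t * (Complex.I * dir P i))
        - sidePoint P y‖ * f y ∂bdryMeasure P) (𝓝[>] 0)
        (𝓝 (∫ y, Real.log ‖z - sidePoint P y‖ * f y ∂bdryMeasure P)) := by
      have h1 : Continuous fun t : ℝ => z - t * (Complex.I * dir P i) := by fun_prop
      have h2 := (hcont.comp h1).tendsto 0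
      simp only [Function.comp, Complex.ofReal_zero, zero_mul, sub_zero] at h2
      exact h2.mono_left nhdsWithin_le_nhds
    refine tendsto_nhds_unique hlim (tendsto_const_nhds.congr' ?_)
    filter_upwards [self_mem_nhdsWithin] with t ht
    have ht : 0 < t := ht
    refine (potential_eq_zero_of_height_neg hP hf1 hmom (i := i) ?_).symm
    have h3 := height_sub (P := P) i (z - t * (Complex.I * dir P i)) z
    have h4 : conj (dir P i) * (z - t * (Complex.I * dir P i) - z) = -(t * Complex.I) := by
      linear_combination (-t * Complex.I) * conj_dir_mul_dir (P := P) i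
    rw [h4] at h3
    simp at h3
    linarith
  · intro z hz
    exact integral_log_norm_sub_eq_zero measurable_sidePoint hBae hf1 hmom (c := 0) (ρ := B)
      (by simpa using hBae) (by simpa using hz)

/-- Interior points of side `j` have positive height over the line of any other side, whose own
points have height zero. -/
theorem sidePoint_ne_of_ne (hP : IsConvexPolygon P) {j k : Fin n} (hjk : k ≠ j) {x : ℝ}
    (hx : x ∈ Ioo (-halfLength P j) (halfLength P j)) (τ : ℝ) :
    sidePoint P (k, τ) ≠ sidePoint P (j, x) := by
  intro h
  have h1 := height_sidePoint_pos hP hjk.symm hx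
  rw [← h, height_sidePoint_self] at h1
  exact lt_irrefl _ h1

/-- Discs centred at an interior point of a side eventually meet the boundary only in a symmetric
interval of that side. Lebesgue differentiation on the line then applies. -/
theorem ae_eq_zero_of_integral_ball (hP : IsConvexPolygon P) (hf : Integrable f (bdryMeasure P))
    (hball : ∀ (c : ℂ) (ε : ℝ), 0 < ε →
      ∫ y in {y | ‖c - sidePoint P y‖ < ε}, f y ∂bdryMeasure P = 0) :
    ∀ᵐ y ∂bdryMeasure P, f y = 0 := by
  refine ae_fiberMeasure_iff.2 fun j => ?_
  have hfj := integrable_fiberMeasure_iff.1 hf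
  set σ := halfLength P j with hσ
  set g : ℝ → ℝ := (Icc (-σ) σ).indicator fun τ => f (j, τ) with hg
  have hgi : Integrable g := (integrable_indicator_iff measurableSet_Icc).2 (hfj j)
  rw [ae_restrict_iff' measurableSet_Icc]
  have hend : ∀ᵐ τ : ℝ, τ ≠ -σ ∧ τ ≠ σ := by
    refine Filter.Eventually.and ?_ ?_ <;> simp [ae_iff, measure_singleton]
  filter_upwards [hend, IsUnifLocDoublingMeasure.ae_tendsto_average volume hgi.locallyIntegrable 1]
    with x hx hleb hxI
  have hxO : x ∈ Ioo (-σ) σ := ⟨lt_of_le_of_ne hxI.1 hx.1.symm, lt_of_le_of_ne hxI.2 hx.2⟩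
  set S : Set ℂ := ⋃ k ∈ {k : Fin n | k ≠ j},
    (fun τ => sidePoint P (k, τ)) '' Icc (-halfLength P k) (halfLength P k) with hS
  have hSc : IsClosed S := by
    refine (Set.toFinite _).isClosed_biUnion fun k _ => ?_
    exact (isCompact_Icc.image (continuous_fst_iff.1 continuous_sidePoint k)).isClosed
  have hcS : sidePoint P (j, x) ∉ S := by
    intro h
    simp only [hS, mem_iUnion, mem_image] at h
    obtain ⟨k, hk, τ, _, hτ⟩ := h
    exact sidePoint_ne_of_ne hP hk hxO τ hτ
  -- Up to radius `ε₀` the disc misses all other closed sides, so in the sum over sides only the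
  -- `j`-th term survives.
  obtain ⟨ε₀, hε₀, hdisj⟩ := Metric.isOpen_iff.1 hSc.isOpen_compl _ hcS
  have hzero : ∀ ε, 0 < ε → ε ≤ ε₀ → ∫ τ in Metric.closedBall x ε, g τ = 0 := by
    intro ε hε hle
    have h := hball (sidePoint P (j, x)) ε hε
    have hmS : MeasurableSet {y | ‖sidePoint P (j, x) - sidePoint P y‖ < ε} := by
      have := measurable_sidePoint (P := P)
      exact measurableSet_lt (by fun_prop) measurable_const
    rw [← integral_indicator hmS, bdryMeasure, integral_fiberMeasure (hf.indicator hmS),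
      Finset.sum_eq_single j] at h
    · rw [← h, ← integral_indicator measurableSet_Icc,
        ← integral_indicator Metric.isClosed_closedBall.measurableSet, Real.closedBall_eq_Icc]
      have hsub : ∀ τ : ℝ, ‖sidePoint P (j, x) - sidePoint P (j, τ)‖ = |x - τ| := by
        intro τ
        have : sidePoint P (j, x) - sidePoint P (j, τ) = dir P j * ((x - τ : ℝ) : ℂ) := by
          simp only [sidePoint]; push_cast; ring
        rw [this, norm_mul, norm_dir, one_mul, Complex.norm_real, Real.norm_eq_abs]
      have hne : ∀ᵐ τ : ℝ, τ ≠ x - ε ∧ τ ≠ x + ε := by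
        refine Filter.Eventually.and ?_ ?_ <;> simp [ae_iff, measure_singleton]
      apply integral_congr_ae
      filter_upwards [hne] with τ hτ
      have hiff : τ ∈ Icc (x - ε) (x + ε) ↔ ‖sidePoint P (j, x) - sidePoint P (j, τ)‖ < ε := by
        rw [hsub, abs_lt]
        constructor
        · intro h
          have h1 := lt_of_le_of_ne h.1 hτ.1.symm
          have h2 := lt_of_le_of_ne h.2 hτ.2
          constructor <;> linarith
        · intro h
          constructor <;> linarith [h.1, h.2]
      by_cases h1 : τ ∈ Icc (x - ε) (x + ε) <;> by_cases h2 : τ ∈ Icc (-σ) σ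
      · rw [indicator_of_mem h1, hg, indicator_of_mem h2, indicator_of_mem h2, indicator_of_mem]
        exact hiff.1 h1
      · rw [indicator_of_mem h1, hg, indicator_of_notMem h2, indicator_of_notMem h2]
      · rw [indicator_of_notMem h1, indicator_of_mem h2, indicator_of_notMem]
        exact fun h => h1 (hiff.2 h)
      · rw [indicator_of_notMem h1, indicator_of_notMem h2]
    · intro k _ hk
      refine setIntegral_eq_zero_of_forall_eq_zero fun τ hτ => indicator_of_notMem ?_ _
      intro hcon
      have h1 : sidePoint P (k, τ) ∈ Metric.ball (sidePoint P (j, x)) ε₀ := by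
        rw [Metric.mem_ball, dist_comm, dist_eq_norm]
        exact lt_of_lt_of_le hcon hle
      apply hdisj h1
      simp only [hS, mem_iUnion, mem_image]
      exact ⟨k, hk, τ, hτ, rfl⟩
    · exact fun h => absurd (Finset.mem_univ j) h
  set δ : ℕ → ℝ := fun k => 1 / ((k : ℝ) + 1) with hδ
  have hδpos : ∀ k, 0 < δ k := fun k => Nat.one_div_pos_of_nat
  have hδlim : Tendsto δ atTop (𝓝 0) := tendsto_one_div_add_atTop_nhds_zero_nat
  have hlim := hleb (fun _ : ℕ => x) δ
    (tendsto_nhdsWithin_iff.2 ⟨hδlim, .of_forall hδpos⟩)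
    (.of_forall fun k => Metric.mem_closedBall_self (by have := hδpos k; linarith))
  have h0 : g x = 0 := by
    refine tendsto_nhds_unique hlim (tendsto_const_nhds.congr' ?_)
    filter_upwards [hδlim.eventually_le_const hε₀] with k hk
    rw [setAverage_eq, hzero _ (hδpos k) hk, smul_zero]
  rwa [hg, indicator_of_mem hxI] at h0

/-- Injectivity: a density whose transform vanishes near infinity on a ray is zero. -/
theorem ae_eq_zero_of_expTransform_eq_zero (hP : IsConvexPolygon P)
    (hf : MemLp f 2 (bdryMeasure P)) (i : Fin n) {R : ℝ}
    (h : ∀ r, R < r → expTransform (bdryMeasure P) (exponent P i) f r = 0) :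
    ∀ᵐ y ∂bdryMeasure P, f y = 0 := by
  obtain ⟨B, hB⟩ := exists_bound_sidePoint P
  have hBae : ∀ᵐ y ∂bdryMeasure P, ‖sidePoint P y‖ ≤ B := ae_bdryMeasure_of_forall hB
  have hf1 : Integrable f (bdryMeasure P) := hf.integrable (by norm_num)
  -- The exponent is affine in the boundary point, with a slope of modulus one. Its transform
  -- therefore determines the moments of the density.
  have hexp : exponent P i = fun y => (-Complex.I * conj (dir P i)) * sidePoint P y
      + Complex.I * conj (dir P i) * midPoint P i := by
    ext y; rw [exponent]; ring
  have hα : -Complex.I * conj (dir P i) ≠ 0 := by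
    rw [← norm_ne_zero_iff, norm_mul, norm_neg, Complex.norm_I, RCLike.norm_conj, norm_dir]
    norm_num
  rw [hexp] at h
  have hmom := integral_pow_mul_eq_zero measurable_sidePoint hBae hf1 hα h
  have hf0 : ∫ y, f y ∂bdryMeasure P = 0 := by
    have := hmom 0
    simp only [pow_zero, one_mul] at this
    rw [integral_complex_ofReal] at this
    exact_mod_cast this
  exact ae_eq_zero_of_integral_ball hP hf1 fun c ε hε =>
    integral_ball_eq_zero measurable_sidePoint hBae hf1 hf0 (potential_eq_zero hP hf hmom) c hε

end SpectralDN

/-! ### Boundedness of the boundary transform on `L²`. -/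

namespace SpectralDN
open Filter Topology
open scoped ENNReal ComplexConjugate

theorem eLpNorm_two_sq {α : Type*} [MeasurableSpace α] {μ : Measure α} {E : Type*}
    [NormedAddCommGroup E] (f : α → E) : eLpNorm f 2 μ ^ 2 = ∫⁻ x, ‖f x‖ₑ ^ 2 ∂μ := by
  have := eLpNorm_nnreal_pow_eq_lintegral (f := f) (μ := μ) (p := 2) (by norm_num)
  simpa using this

theorem eLpNorm_two_le_of_lintegral {α β : Type*} [MeasurableSpace α] {μ : Measure α}
    [MeasurableSpace β] {ν : Measure β} {E F : Type*} [NormedAddCommGroup E]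
    [NormedAddCommGroup F] {f : α → E} {g : β → F} {C : NNReal}
    (h : ∫⁻ x, ‖f x‖ₑ ^ 2 ∂μ ≤ (C : ℝ≥0∞) ^ 2 * ∫⁻ x, ‖g x‖ₑ ^ 2 ∂ν) :
    eLpNorm f 2 μ ≤ C * eLpNorm g 2 ν := by
  rw [← eLpNorm_two_sq, ← eLpNorm_two_sq, ← mul_pow] at h
  exact (ENNReal.pow_le_pow_left_iff two_ne_zero).1 h

/-- The map `e` is the distance from the endpoint at which `Re ξ` may vanish. In this variable the
transform is dominated by a Laplace transform on the half line. -/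
theorem lintegral_enorm_expTransform_sq_le_of_le {s : Set ℝ} (hs : MeasurableSet s) {c : ℝ}
    (hc : 0 < c) {ξ : ℝ → ℂ} (e : ℝ ≃ᵐ ℝ) (he : MeasurePreserving e) (hes : ∀ τ ∈ s, 0 ≤ e τ)
    (hξ0 : ∀ τ ∈ s, c * e τ ≤ (ξ τ).re) {f : ℝ → ℝ}
    (hf : AEStronglyMeasurable f (volume.restrict s)) :
    ∫⁻ r in Ioi (0 : ℝ), ‖expTransform (volume.restrict s) ξ f r‖ₑ ^ 2
      ≤ ENNReal.ofReal (Real.pi / c) * ∫⁻ t in s, ‖f t‖ₑ ^ 2 := by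
  set F : ℝ → ℝ := s.indicator f with hF
  have hFm : AEStronglyMeasurable F volume := (aestronglyMeasurable_indicator_iff hs).2 hf
  set g : ℝ → ℝ≥0∞ := fun t => ‖F (e.symm t)‖ₑ with hg
  have hge : ∀ τ, g (e τ) = s.indicator (fun τ => ‖f τ‖ₑ) τ := by
    intro τ
    simp only [hg, e.symm_apply_apply, hF]
    exact enorm_indicator_eq_indicator_enorm f τ
  have hgm : AEMeasurable g volume :=
    (hFm.comp_measurePreserving (he.symm e)).enorm
  have h0 : ∀ᵐ τ : ℝ, τ ≠ 0 := by simp [ae_iff, measure_singleton]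
  have hpos : ∀ᵐ t : ℝ, t ∈ (Ioi (0 : ℝ))ᶜ → g t = 0 := by
    filter_upwards [h0] with t ht htn
    have : g t = g (e (e.symm t)) := by rw [e.apply_symm_apply]
    rw [this, hge]
    refine indicator_of_notMem (fun hmem => htn ?_) _
    have := hes _ hmem
    rw [e.apply_symm_apply] at this
    exact lt_of_le_of_ne this ht.symm
  have hset : ∀ k : ℝ → ℝ≥0∞, ∫⁻ t, k t * g t = ∫⁻ t in Ioi (0 : ℝ), k t * g t := by
    intro k
    rw [← lintegral_indicator measurableSet_Ioi]
    apply lintegral_congr_ae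
    filter_upwards [hpos] with t ht
    by_cases h : t ∈ Ioi (0 : ℝ)
    · rw [indicator_of_mem h]
    · rw [indicator_of_notMem h, ht h, mul_zero]
  have hsq : ∫⁻ t in Ioi (0 : ℝ), g t ^ 2 = ∫⁻ t in s, ‖f t‖ₑ ^ 2 := by
    simp_rw [sq]
    rw [← hset g, ← lintegral_indicator hs, ← he.lintegral_comp_emb e.measurableEmbedding]
    congr 1; ext τ
    rw [hge]
    by_cases h : τ ∈ s
    · simp [h]
    · simp [h]
  rw [← hsq]
  refine le_trans (lintegral_mono_ae ?_) (lintegral_laplace_sq_le' hc hgm.restrict)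
  filter_upwards [ae_restrict_mem measurableSet_Ioi] with r hr
  have hr : 0 < r := hr
  refine pow_le_pow_left' ?_ 2
  rw [← hset, ← he.lintegral_comp_emb e.measurableEmbedding]
  refine (enorm_integral_le_lintegral_enorm _).trans ?_
  rw [← lintegral_indicator hs]
  refine lintegral_mono fun τ => ?_
  by_cases h : τ ∈ s
  · rw [indicator_of_mem h, hge, indicator_of_mem h, enorm_mul]
    refine mul_le_mul' ?_ (le_of_eq ?_)
    · rw [← ofReal_norm]
      refine ENNReal.ofReal_le_ofReal ?_
      rw [Complex.norm_exp]
      refine Real.exp_le_exp.2 ?_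
      have := mul_le_mul_of_nonneg_left (hξ0 τ h) hr.le
      simp
      linarith
    · simp [enorm_eq_nnnorm]
  · rw [indicator_of_notMem h]; exact zero_le

variable {n : ℕ} {P : Polygon ℂ n} {f : Fin n × ℝ → ℝ}

/-- An affine function that is nonnegative on a segment and positive at one endpoint dominates a
multiple of the distance to the other endpoint. -/
theorem height_sidePoint_ge (hP : IsConvexPolygon P) {i j : Fin n} (hij : j ≠ i) :
    ∃ c > 0, (∀ τ ∈ Icc (-halfLength P j) (halfLength P j),
        c * (halfLength P j + τ) ≤ height P i (sidePoint P (j, τ))) ∨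
      ∀ τ ∈ Icc (-halfLength P j) (halfLength P j),
        c * (halfLength P j - τ) ≤ height P i (sidePoint P (j, τ)) := by
  have hσ := halfLength_pos hP j
  have h1 := height_vertex_nonneg hP i j
  have h2 := height_vertex_nonneg hP i (finRotate n j)
  rcases height_endpoint_pos hP hij with h | h
  · refine ⟨height P i (P j) / (2 * halfLength P j), by positivity, Or.inr fun τ hτ => ?_⟩
    have h3 := two_mul_halfLength_mul_height (P := P) i j τ
    rw [div_mul_eq_mul_div, div_le_iff₀ (by positivity)]
    nlinarith [hτ.1, hτ.2]
  · refine ⟨height P i (P (finRotate n j)) / (2 * halfLength P j), by positivity,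
      Or.inl fun τ hτ => ?_⟩
    have h3 := two_mul_halfLength_mul_height (P := P) i j τ
    rw [div_mul_eq_mul_div, div_le_iff₀ (by positivity)]
    nlinarith [hτ.1, hτ.2]

theorem lintegral_enorm_expTransform_neg_line {s : Set ℝ} (hs : MeasurableSet s) {f : ℝ → ℝ}
    (hf1 : IntegrableOn f s) (hf : MemLp f 2 (volume.restrict s)) :
    ∫⁻ r in Ioi (0 : ℝ), ‖expTransform (volume.restrict s) (fun τ : ℝ => -Complex.I * τ) f r‖ₑ ^ 2
      = ENNReal.ofReal Real.pi * ∫⁻ t in s, ‖f t‖ₑ ^ 2 := by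
  set F : ℝ → ℝ := fun τ => s.indicator f (-τ) with hF
  have hmp : MeasurePreserving (Neg.neg : ℝ → ℝ) := Measure.measurePreserving_neg volume
  have hF1 : Integrable F := by
    have := (integrable_indicator_iff hs).2 hf1
    exact (hmp.integrable_comp this.1).2 this
  have hF2 : MemLp F 2 := ((memLp_indicator_iff_restrict hs).2 hf).comp_measurePreserving hmp
  have h1 : expTransform (volume.restrict s) (fun τ : ℝ => -Complex.I * τ) f
      = expTransform volume (fun τ : ℝ => Complex.I * τ) F := by
    ext r
    rw [expTransform_restrict hs, expTransform, expTransform, ← integral_neg_eq_self]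
    simp [hF]
  have h2 : ∫ τ, F τ ^ 2 = ∫ τ in s, ‖f τ‖ ^ 2 := by
    rw [← integral_neg_eq_self, ← integral_indicator hs]
    congr 1; ext τ
    by_cases h : τ ∈ s <;> simp [hF, h]
  rw [h1, lintegral_enorm_sq_eq ((memLp_two_expTransform_line hF1 hF2).restrict _),
    integral_norm_sq_expTransform_line hF1 hF2, ENNReal.ofReal_mul Real.pi_pos.le, h2,
    lintegral_enorm_sq_eq hf]

/-- The `i`-th side is handled by Plancherel. On any other side the exponent has real part growing
linearly from an endpoint, and the Laplace bound applies. -/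
theorem exists_lintegral_expTransform_side_le (hP : IsConvexPolygon P) (i j : Fin n) :
    ∃ C : NNReal, ∀ f : ℝ → ℝ,
      MemLp f 2 (volume.restrict (Icc (-halfLength P j) (halfLength P j))) →
      ∫⁻ r in Ioi (0 : ℝ),
        ‖expTransform (volume.restrict (Icc (-halfLength P j) (halfLength P j)))
          (fun τ => exponent P i (j, τ)) f r‖ₑ ^ 2
        ≤ (C : ℝ≥0∞) ^ 2 * ∫⁻ t in Icc (-halfLength P j) (halfLength P j), ‖f t‖ₑ ^ 2 := by
  have hsq : ∀ x : ℝ, 0 ≤ x → ((Real.toNNReal √x : NNReal) : ℝ≥0∞) ^ 2 = ENNReal.ofReal x := by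
    intro x hx
    change ENNReal.ofReal √x ^ 2 = _
    rw [← ENNReal.ofReal_pow (Real.sqrt_nonneg _), Real.sq_sqrt hx]
  by_cases hij : j = i
  · subst hij
    refine ⟨Real.toNNReal √Real.pi, fun f hf => le_of_eq ?_⟩
    rw [hsq _ Real.pi_pos.le,
      ← lintegral_enorm_expTransform_neg_line measurableSet_Icc (hf.integrable (by norm_num)) hf]
    simp_rw [exponent_self]
  · obtain ⟨c, hc, h⟩ := height_sidePoint_ge hP hij
    refine ⟨Real.toNNReal √(Real.pi / c), fun f hf => ?_⟩
    rw [hsq _ (by positivity)]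
    rcases h with h | h
    · refine lintegral_enorm_expTransform_sq_le_of_le measurableSet_Icc hc
        (MeasurableEquiv.addLeft (halfLength P j)) (measurePreserving_add_left _ _) ?_ ?_ hf.1
      · intro τ hτ; simp; linarith [hτ.1]
      · intro τ hτ; rw [exponent_re]; exact h τ hτ
    · refine lintegral_enorm_expTransform_sq_le_of_le measurableSet_Icc hc
        (MeasurableEquiv.subLeft (halfLength P j)) (volume.measurePreserving_sub_left _) ?_ ?_ hf.1
      · intro τ hτ; change 0 ≤ halfLength P j - τ; linarith [hτ.2]
      · intro τ hτ; rw [exponent_re]; exact h τ hτ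

/-- The values on the negative real axis of the `i`-th component of the operator `T`, in terms of
densities on the boundary. -/
noncomputable def bdryTransform (P : Polygon ℂ n) (i : Fin n) (f : Fin n × ℝ → ℝ) : ℝ → ℂ :=
  expTransform (bdryMeasure P) (exponent P i) f

theorem bdryTransform_eq_sum (hP : IsConvexPolygon P) (i : Fin n)
    (hf : Integrable f (bdryMeasure P)) {r : ℝ} (hr : 0 ≤ r) : bdryTransform P i f r
      = ∑ j, expTransform (volume.restrict (Icc (-halfLength P j) (halfLength P j)))
          (fun τ => exponent P i (j, τ)) (fun τ => f (j, τ)) r :=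
  integral_fiberMeasure
    (integrable_exp_neg_mul (measurable_exponent i) (ae_exponent_re_nonneg hP i) hf hr)

theorem aestronglyMeasurable_bdryTransform (hP : IsConvexPolygon P) (i : Fin n)
    (hf : Integrable f (bdryMeasure P)) :
    AEStronglyMeasurable (bdryTransform P i f) (volume.restrict (Ioi 0)) :=
  aestronglyMeasurable_expTransform (measurable_exponent i) (ae_exponent_re_nonneg hP i) hf

theorem exists_eLpNorm_bdryTransform_le (hP : IsConvexPolygon P) (i : Fin n) :
    ∃ C : NNReal, ∀ f : Fin n × ℝ → ℝ, MemLp f 2 (bdryMeasure P) →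
      eLpNorm (bdryTransform P i f) 2 (volume.restrict (Ioi 0))
        ≤ C * eLpNorm f 2 (bdryMeasure P) := by
  choose C hC using exists_lintegral_expTransform_side_le hP i
  refine ⟨∑ j, C j, fun f hf => ?_⟩
  have hfj := memLp_two_fiberMeasure_iff.1 hf
  have hre : ∀ j, ∀ᵐ τ ∂volume.restrict (Icc (-halfLength P j) (halfLength P j)),
      0 ≤ (exponent P i (j, τ)).re := ae_fiberMeasure_iff.1 (ae_exponent_re_nonneg hP i)
  have hcongr : eLpNorm (bdryTransform P i f) 2 (volume.restrict (Ioi 0))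
      = eLpNorm (∑ j, expTransform (volume.restrict (Icc (-halfLength P j) (halfLength P j)))
          (fun τ => exponent P i (j, τ)) (fun τ => f (j, τ))) 2 (volume.restrict (Ioi 0)) := by
    apply eLpNorm_congr_ae
    filter_upwards [ae_restrict_mem measurableSet_Ioi] with r hr
    rw [bdryTransform_eq_sum hP i (hf.integrable (by norm_num)) (le_of_lt hr), Finset.sum_apply]
  rw [hcongr]
  refine (eLpNorm_sum_le (fun j _ => aestronglyMeasurable_expTransform
    ((continuous_fst_iff.1 (continuous_exponent i) j).measurable) (hre j)
      ((hfj j).integrable (by norm_num))) (by norm_num)).trans ?_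
  push_cast
  rw [Finset.sum_mul]
  refine Finset.sum_le_sum fun j _ => eLpNorm_two_le_of_lintegral ((hC j _ (hfj j)).trans ?_)
  gcongr
  rw [bdryMeasure, lintegral_fiberMeasure]
  exact Finset.single_le_sum (f := fun j => ∫⁻ t in Icc (-halfLength P j) (halfLength P j),
    ‖f (j, t)‖ₑ ^ 2) (fun _ _ => zero_le) (Finset.mem_univ j)

theorem memLp_two_bdryTransform (hP : IsConvexPolygon P) (i : Fin n)
    (hf : MemLp f 2 (bdryMeasure P)) :
    MemLp (bdryTransform P i f) 2 (volume.restrict (Ioi 0)) := by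
  obtain ⟨C, hC⟩ := exists_eLpNorm_bdryTransform_le hP i
  exact ⟨aestronglyMeasurable_bdryTransform hP i (hf.integrable (by norm_num)),
    (hC f hf).trans_lt (ENNReal.mul_lt_top ENNReal.coe_lt_top hf.2)⟩

end SpectralDN

/-! ### Weakly null sequences and pieces with a bounded kernel. -/

namespace SpectralDN
open Filter Topology
open scoped ENNReal ComplexConjugate

section weak
variable {Y : Type*} [MeasurableSpace Y] {μ : Measure Y}

/-- Multiplication by the indicator function of a set, on square integrable functions. -/
noncomputable def indicatorOp (μ : Measure Y) {E : Set Y} (hE : MeasurableSet E) :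
    Lp ℝ 2 μ →L[ℝ] Lp ℝ 2 μ :=
  LinearMap.mkContinuous
    { toFun := fun φ => ((Lp.memLp φ).indicator hE).toLp
      map_add' := fun φ ψ => by
        rw [← MemLp.toLp_add]
        apply MemLp.toLp_congr
        filter_upwards [Lp.coeFn_add φ ψ] with y hy
        by_cases h : y ∈ E
        · simp only [indicator_of_mem h, Pi.add_apply]; exact hy
        · simp only [indicator_of_notMem h, Pi.add_apply, add_zero]
      map_smul' := fun c φ => by
        rw [RingHom.id_apply, ← MemLp.toLp_const_smul]
        apply MemLp.toLp_congr
        filter_upwards [Lp.coeFn_smul c φ] with y hy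
        by_cases h : y ∈ E
        · simp only [indicator_of_mem h, Pi.smul_apply]; exact hy
        · simp only [indicator_of_notMem h, Pi.smul_apply, smul_zero] } 1 fun φ => by
    rw [one_mul, LinearMap.coe_mk, AddHom.coe_mk, Lp.norm_toLp, Lp.norm_def]
    exact ENNReal.toReal_mono (Lp.eLpNorm_ne_top φ) (eLpNorm_indicator_le _)

theorem indicatorOp_apply {E : Set Y} (hE : MeasurableSet E) (φ : Lp ℝ 2 μ) :
    indicatorOp μ hE φ = ((Lp.memLp φ).indicator hE).toLp := rfl

theorem coeFn_indicatorOp {E : Set Y} (hE : MeasurableSet E) (φ : Lp ℝ 2 μ) :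
    indicatorOp μ hE φ =ᵐ[μ] E.indicator φ := by
  rw [indicatorOp_apply]
  exact MemLp.coeFn_toLp _

theorem norm_sq_eq_integral (φ : Lp ℝ 2 μ) : ‖φ‖ ^ 2 = ∫ y, φ y ^ 2 ∂μ := by
  rw [← real_inner_self_eq_norm_sq, L2.inner_def]
  congr 1; ext y
  simp [sq]

/-- Bounded sequences that converge weakly to zero. -/
structure WeaklyNull (φ : ℕ → Lp ℝ 2 μ) : Prop where
  bounded : ∃ M, ∀ k, ‖φ k‖ ≤ M
  tendsto_inner : ∀ g : Lp ℝ 2 μ, Tendsto (fun k => inner ℝ g (φ k)) atTop (𝓝 0)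

variable {φ : ℕ → Lp ℝ 2 μ}

theorem WeaklyNull.tendsto_integral_mul (h : WeaklyNull φ) {g : Y → ℝ} (hg : MemLp g 2 μ) :
    Tendsto (fun k => ∫ y, g y * φ k y ∂μ) atTop (𝓝 0) := by
  refine (h.tendsto_inner hg.toLp).congr fun k => ?_
  rw [L2.inner_def]
  apply integral_congr_ae
  filter_upwards [hg.coeFn_toLp] with y hy
  rw [hy]
  simp [mul_comm]

theorem WeaklyNull.tendsto_integral (h : WeaklyNull φ) {g : Y → ℂ} (hg : MemLp g 2 μ) :
    Tendsto (fun k => ∫ y, g y * φ k y ∂μ) atTop (𝓝 0) := by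
  have hint : ∀ k, Integrable (fun y => g y * φ k y) μ := fun k =>
    MemLp.integrable_mul hg (Lp.memLp (φ k)).ofReal
  have h1 := h.tendsto_integral_mul hg.re
  have h2 := h.tendsto_integral_mul hg.im
  have h3 := (Complex.continuous_ofReal.tendsto _).comp h1
  have h4 := ((Complex.continuous_ofReal.tendsto _).comp h2).mul_const Complex.I
  have h5 := h3.add h4
  simp only [Complex.ofReal_zero, zero_mul, add_zero] at h5
  refine h5.congr fun k => ?_
  have e := integral_re_add_im (hint k)
  simp only [RCLike.re_to_complex, RCLike.im_to_complex, Complex.re_mul_ofReal,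
    Complex.im_mul_ofReal] at e
  exact e

/-- A bounded kernel on a finite measure space is Hilbert-Schmidt, hence compact. Concretely, the
inner integrals tend to zero pointwise by weak convergence and boundedly, so they tend to zero in
`L²`. Cauchy-Schwarz finishes. -/
theorem WeaklyNull.tendsto_integral_prod [IsFiniteMeasure μ] (h : WeaklyNull φ)
    {K : Y × Y → ℂ} (hK : Measurable K) {C : ℝ} (hC : ∀ z, ‖K z‖ ≤ C) :
    Tendsto (fun k => ∫ z, (φ k z.1 : ℂ) * (K z * φ k z.2) ∂μ.prod μ) atTop (𝓝 0) := by
  obtain ⟨M, hM⟩ := h.bounded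
  have hφ1 : ∀ k, Integrable (φ k) μ := fun k => (Lp.memLp (φ k)).integrable (by norm_num)
  set G : ℕ → Y → ℂ := fun k p => ∫ q, K (p, q) * φ k q ∂μ with hG
  have hGm : ∀ k, AEStronglyMeasurable (G k) μ := fun k => by
    have h1 : StronglyMeasurable fun z : Y × Y => K z * φ k z.2 := by
      have := (Lp.stronglyMeasurable (φ k)).measurable
      exact (by fun_prop : Measurable fun z : Y × Y => K z * φ k z.2).stronglyMeasurable
    exact h1.integral_prod_right.aestronglyMeasurable
  have hGlim : ∀ p, Tendsto (fun k => G k p) atTop (𝓝 0) := fun p => by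
    refine h.tendsto_integral (MemLp.of_bound (C := C)
      (hK.comp measurable_prodMk_left).aestronglyMeasurable (.of_forall fun q => hC _))
  have hone : MemLp (fun _ : Y => (1 : ℝ)) 2 μ := memLp_const 1
  have hL1 : ∀ k, ∫ y, ‖φ k y‖ ∂μ ≤ √(M ^ 2 * μ.real univ) := fun k => by
    apply Real.le_sqrt_of_sq_le
    have h1 := integral_mul_sq_le (Lp.memLp (φ k)) hone
    simp only [abs_one, mul_one, one_pow, integral_const, smul_eq_mul] at h1
    refine h1.trans (mul_le_mul_of_nonneg_right ?_ measureReal_nonneg)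
    rw [← norm_sq_eq_integral]
    exact pow_le_pow_left₀ (norm_nonneg _) (hM k) 2
  have hC0 : 0 ≤ max C 0 := le_max_right _ _
  set B := max C 0 * √(M ^ 2 * μ.real univ) with hB
  have hGb : ∀ k p, ‖G k p‖ ≤ B := fun k p => by
    refine (norm_integral_le_integral_norm _).trans ?_
    calc _ ≤ ∫ q, max C 0 * ‖φ k q‖ ∂μ := by
          refine integral_mono_of_nonneg (.of_forall fun _ => norm_nonneg _)
            ((hφ1 k).norm.const_mul _) (.of_forall fun q => ?_)
          simp only [norm_mul, Complex.norm_real]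
          exact mul_le_mul_of_nonneg_right ((hC _).trans (le_max_left _ _)) (norm_nonneg _)
      _ ≤ B := by
          rw [integral_const_mul]
          exact mul_le_mul_of_nonneg_left (hL1 k) hC0
  have hGL : ∀ k, MemLp (fun p => ‖G k p‖) 2 μ := fun k =>
    (MemLp.of_bound (hGm k) B (.of_forall (hGb k))).norm
  have hG2 : Tendsto (fun k => ∫ p, ‖G k p‖ ^ 2 ∂μ) atTop (𝓝 0) := by
    have := tendsto_integral_of_dominated_convergence (μ := μ) (F := fun k p => ‖G k p‖ ^ 2)
      (f := fun _ => 0) (fun _ => B ^ 2) (fun k => (hGL k).integrable_sq.1) (integrable_const _)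
      (fun k => .of_forall fun p => by
        rw [Real.norm_of_nonneg (sq_nonneg _)]
        exact pow_le_pow_left₀ (norm_nonneg _) (hGb k p) 2)
      (.of_forall fun p => by
        have := ((hGlim p).norm).pow 2
        simpa using this)
    simpa using this
  have hbound : ∀ k, ‖∫ z, (φ k z.1 : ℂ) * (K z * φ k z.2) ∂μ.prod μ‖
      ≤ √(M ^ 2 * ∫ p, ‖G k p‖ ^ 2 ∂μ) := fun k => by
    have hint : Integrable (fun z : Y × Y => (φ k z.1 : ℂ) * (K z * φ k z.2)) (μ.prod μ) := by
      have h1 : Integrable (fun z : Y × Y => (φ k z.1 : ℂ) * (φ k z.2 : ℂ)) (μ.prod μ) :=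
        (hφ1 k).ofReal.mul_prod (hφ1 k).ofReal
      refine (h1.bdd_mul (c := C) hK.aestronglyMeasurable (.of_forall hC)).congr
        (.of_forall fun z => ?_)
      ring
    rw [integral_prod _ hint]
    apply Real.le_sqrt_of_sq_le
    have h1 := integral_mul_sq_le (Lp.memLp (φ k)) (hGL k)
    rw [← norm_sq_eq_integral] at h1
    refine le_trans (pow_le_pow_left₀ (norm_nonneg _) ?_ 2) (h1.trans ?_)
    · refine (norm_integral_le_integral_norm _).trans (le_of_eq ?_)
      congr 1; ext p
      simp only
      rw [integral_const_mul, norm_mul, Complex.norm_real, abs_of_nonneg (norm_nonneg (G k p))]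
      rfl
    · exact mul_le_mul_of_nonneg_right (pow_le_pow_left₀ (norm_nonneg _) (hM k) 2)
        (integral_nonneg fun _ => sq_nonneg _)
  have hlim : Tendsto (fun k => √(M ^ 2 * ∫ p, ‖G k p‖ ^ 2 ∂μ)) atTop (𝓝 0) := by
    have := (Real.continuous_sqrt.tendsto _).comp (hG2.const_mul (M ^ 2))
    simpa [Function.comp_def] using this
  exact squeeze_zero_norm hbound hlim

end weak

variable {n : ℕ} {P : Polygon ℂ n} {f : Fin n × ℝ → ℝ}

theorem bdryTransform_add (hP : IsConvexPolygon P) (i : Fin n) {f g : Fin n × ℝ → ℝ}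
    (hf : Integrable f (bdryMeasure P)) (hg : Integrable g (bdryMeasure P)) {r : ℝ} (hr : 0 ≤ r) :
    bdryTransform P i (f + g) r = bdryTransform P i f r + bdryTransform P i g r :=
  expTransform_add (measurable_exponent i) (ae_exponent_re_nonneg hP i) hf hg hr

theorem bdryTransform_const_smul (i : Fin n) (c : ℝ) (f : Fin n × ℝ → ℝ) (r : ℝ) :
    bdryTransform P i (c • f) r = c • bdryTransform P i f r := by
  unfold bdryTransform expTransform
  rw [← integral_smul]
  congr 1; ext y
  simp
  ring

theorem bdryTransform_congr (i : Fin n) {f g : Fin n × ℝ → ℝ} (h : f =ᵐ[bdryMeasure P] g) :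
    bdryTransform P i f = bdryTransform P i g := by
  ext r
  apply integral_congr_ae
  filter_upwards [h] with y hy
  rw [hy]

/-- The transform as a bounded operator between spaces of square integrable functions. -/
noncomputable def bdryOp (hP : IsConvexPolygon P) (i : Fin n) :
    Lp ℝ 2 (bdryMeasure P) →L[ℝ] Lp ℂ 2 (volume.restrict (Ioi (0 : ℝ))) :=
  LinearMap.mkContinuousOfExistsBound
    { toFun := fun φ => (memLp_two_bdryTransform hP i (Lp.memLp φ)).toLp
      map_add' := fun φ ψ => by
        rw [← MemLp.toLp_add]
        apply MemLp.toLp_congr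
        filter_upwards [ae_restrict_mem measurableSet_Ioi] with r hr
        rw [bdryTransform_congr i (Lp.coeFn_add φ ψ)]
        exact bdryTransform_add hP i ((Lp.memLp φ).integrable (by norm_num))
          ((Lp.memLp ψ).integrable (by norm_num)) (le_of_lt hr)
      map_smul' := fun c φ => by
        rw [RingHom.id_apply, ← MemLp.toLp_const_smul]
        apply MemLp.toLp_congr
        refine .of_forall fun r => ?_
        rw [bdryTransform_congr i (Lp.coeFn_smul c φ)]
        exact bdryTransform_const_smul i c φ r } (by
    obtain ⟨C, hC⟩ := exists_eLpNorm_bdryTransform_le hP i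
    refine ⟨C, fun φ => ?_⟩
    rw [LinearMap.coe_mk, AddHom.coe_mk, Lp.norm_toLp, Lp.norm_def]
    refine (ENNReal.toReal_mono (ENNReal.mul_ne_top ENNReal.coe_ne_top (Lp.eLpNorm_ne_top φ))
      (hC φ (Lp.memLp φ))).trans (le_of_eq ?_)
    rw [ENNReal.toReal_mul]; rfl)

theorem coeFn_bdryOp (hP : IsConvexPolygon P) (i : Fin n) (φ : Lp ℝ 2 (bdryMeasure P)) :
    bdryOp hP i φ =ᵐ[volume.restrict (Ioi (0 : ℝ))] bdryTransform P i φ :=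
  MemLp.coeFn_toLp (memLp_two_bdryTransform hP i (Lp.memLp φ))

theorem norm_sq_bdryOp (hP : IsConvexPolygon P) (i : Fin n) (φ : Lp ℝ 2 (bdryMeasure P)) :
    ‖bdryOp hP i φ‖ ^ 2 = ∫ r in Ioi (0 : ℝ), ‖bdryTransform P i φ r‖ ^ 2 := by
  rw [← integral_norm_sq_toLp]
  apply integral_congr_ae
  filter_upwards [coeFn_bdryOp hP i φ] with r hr
  rw [hr]

theorem inner_bdryOp (hP : IsConvexPolygon P) (i : Fin n) (φ ψ : Lp ℝ 2 (bdryMeasure P)) :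
    inner ℂ (bdryOp hP i φ) (bdryOp hP i ψ)
      = ∫ r in Ioi (0 : ℝ), conj (bdryTransform P i φ r) * bdryTransform P i ψ r := by
  rw [L2.inner_def]
  apply integral_congr_ae
  filter_upwards [coeFn_bdryOp hP i φ, coeFn_bdryOp hP i ψ] with r h1 h2
  rw [h1, h2, RCLike.inner_apply, mul_comm]

/-- The pairing is a double integral over `E × F` with kernel `1/(conj ξ + ξ')`, here bounded by
`1/δ`, so compactness of bounded kernels applies. -/
theorem tendsto_inner_bdryOp_indicator (hP : IsConvexPolygon P) (i : Fin n) {E F : Set (Fin n × ℝ)}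
    (hE : MeasurableSet E) (hF : MeasurableSet F) {δ : ℝ} (hδ : 0 < δ)
    (hEF : ∀ p ∈ E, ∀ q ∈ F, δ ≤ ‖conj (exponent P i p) + exponent P i q‖)
    {φ : ℕ → Lp ℝ 2 (bdryMeasure P)} (hφ : WeaklyNull φ) :
    Tendsto (fun k => (inner ℂ (bdryOp hP i (indicatorOp _ hE (φ k)))
      (bdryOp hP i (indicatorOp _ hF (φ k))) : ℂ)) atTop (𝓝 0) := by
  set K : (Fin n × ℝ) × (Fin n × ℝ) → ℂ := (E ×ˢ F).indicator
    fun z => (conj (exponent P i z.1) + exponent P i z.2)⁻¹ with hKdef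
  have hξ := measurable_exponent (P := P) i
  have hconj := Complex.continuous_conj.measurable
  have hK : Measurable K := Measurable.indicator (by fun_prop) (hE.prod hF)
  have hKb : ∀ z, ‖K z‖ ≤ δ⁻¹ := by
    intro z
    by_cases hz : z ∈ E ×ˢ F
    · rw [hKdef, indicator_of_mem hz, norm_inv]
      exact inv_anti₀ hδ (hEF _ hz.1 _ hz.2)
    · rw [hKdef, indicator_of_notMem hz, norm_zero]
      exact inv_nonneg.2 hδ.le
  refine (hφ.tendsto_integral_prod hK hKb).congr fun k => ?_
  have hφ1 : Integrable (φ k) (bdryMeasure P) := (Lp.memLp (φ k)).integrable (by norm_num)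
  have hT : ∀ {E : Set (Fin n × ℝ)} (hE : MeasurableSet E), bdryTransform P i (indicatorOp _ hE (φ k))
      = expTransform ((bdryMeasure P).restrict E) (exponent P i) (φ k) := by
    intro E hE
    ext r
    rw [expTransform_restrict hE, bdryTransform_congr i (coeFn_indicatorOp hE (φ k))]
    rfl
  have hM : ∀ {E : Set (Fin n × ℝ)} (_ : MeasurableSet E),
      MemLp (expTransform ((bdryMeasure P).restrict E) (exponent P i) (φ k)) 2
        (volume.restrict (Ioi 0)) := by
    intro E hE
    rw [← hT hE]
    exact memLp_two_bdryTransform hP i (Lp.memLp _)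
  have hae : ∀ᵐ z ∂((bdryMeasure P).restrict E).prod ((bdryMeasure P).restrict F),
      z ∈ E ×ˢ F := by
    rw [Measure.prod_restrict]
    exact ae_restrict_mem (hE.prod hF)
  have hre := ae_exponent_re_nonneg hP i
  rw [inner_bdryOp, hT hE, hT hF, integral_conj_expTransform_mul hξ hξ (ae_restrict_of_ae hre)
    (ae_restrict_of_ae hre) ?_ hφ1.integrableOn hφ1.integrableOn (hM hE) (hM hF) ?_,
    Measure.prod_restrict, ← integral_indicator (hE.prod hF)]
  · congr 1; ext z
    by_cases hz : z ∈ E ×ˢ F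
    · rw [indicator_of_mem hz, hKdef, indicator_of_mem hz, div_eq_mul_inv]
      push_cast
      ring
    · rw [indicator_of_notMem hz, hKdef, indicator_of_notMem hz, zero_mul, mul_zero]
  · filter_upwards [hae] with z hz h0
    have := hEF _ hz.1 _ hz.2
    rw [h0, norm_zero] at this
    linarith
  · have h1 : Integrable (fun z : (Fin n × ℝ) × (Fin n × ℝ) => ((φ k z.1 * φ k z.2 : ℝ) : ℂ))
        (((bdryMeasure P).restrict E).prod ((bdryMeasure P).restrict F)) :=
      (hφ1.integrableOn.mul_prod hφ1.integrableOn).ofReal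
    refine (h1.bdd_mul (f := fun z => (conj (exponent P i z.1) + exponent P i z.2)⁻¹)
      (c := δ⁻¹) (Measurable.aestronglyMeasurable (by fun_prop)) ?_).congr
      (.of_forall fun z => ?_)
    · filter_upwards [hae] with z hz
      rw [norm_inv]
      exact inv_anti₀ hδ (hEF _ hz.1 _ hz.2)
    · simp only
      rw [div_eq_mul_inv, mul_comm]

/-- A set at positive distance from the line of side `i` can be paired with itself, since the kernel
there has denominator with real part at least `2δ`. -/
theorem tendsto_bdryOp_indicator_of_height_ge (hP : IsConvexPolygon P) (i : Fin n)
    {E : Set (Fin n × ℝ)} (hE : MeasurableSet E) {δ : ℝ} (hδ : 0 < δ)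
    (hEδ : ∀ p ∈ E, δ ≤ height P i (sidePoint P p))
    {φ : ℕ → Lp ℝ 2 (bdryMeasure P)} (hφ : WeaklyNull φ) :
    Tendsto (fun k => bdryOp hP i (indicatorOp _ hE (φ k))) atTop (𝓝 0) := by
  have h := tendsto_inner_bdryOp_indicator hP i hE hE hδ (fun p hp q hq => by
    refine le_trans ?_ (Complex.re_le_norm _)
    rw [Complex.add_re, Complex.conj_re, exponent_re, exponent_re]
    linarith [hEδ p hp, hEδ q hq]) hφ
  rw [tendsto_zero_iff_norm_tendsto_zero]
  have h2 := h.norm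
  simp only [inner_self_eq_norm_sq_to_K, norm_pow, RCLike.norm_ofReal, abs_norm, norm_zero] at h2
  have h3 := (Real.continuous_sqrt.tendsto _).comp h2
  simpa [Function.comp_def] using h3

/-- Orthogonality of disjoint pieces of the same side. -/
theorem re_inner_bdryOp_indicator_eq_zero (hP : IsConvexPolygon P) (i : Fin n) {E F : Set ℝ}
    (hE : MeasurableSet ((Prod.mk i) '' E)) (hF : MeasurableSet ((Prod.mk i) '' F))
    (hEF : Disjoint E F) (φ : Lp ℝ 2 (bdryMeasure P)) :
    (inner ℂ (bdryOp hP i (indicatorOp _ hE φ)) (bdryOp hP i (indicatorOp _ hF φ)) : ℂ).re = 0 := by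
  -- On densities carried by side `i` the operator is `√π` times a real isometry, by Plancherel.
  -- Polarisation over the reals transports orthogonality only to the real part of the complex inner
  -- product.
  have key : ∀ ψ : Lp ℝ 2 (bdryMeasure P), (∀ᵐ y ∂bdryMeasure P, y.1 ≠ i → ψ y = 0) →
      ‖bdryOp hP i ψ‖ ^ 2 = Real.pi * ‖ψ‖ ^ 2 := by
    intro ψ hψ
    set s := Icc (-halfLength P i) (halfLength P i) with hs
    have hψi : ∀ j, MemLp (fun τ => ψ (j, τ)) 2
        (volume.restrict (Icc (-halfLength P j) (halfLength P j))) :=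
      memLp_two_fiberMeasure_iff.1 (Lp.memLp ψ)
    have hψj := ae_fiberMeasure_iff.1 hψ
    have h1 : ∀ r, 0 < r → bdryTransform P i ψ r
        = expTransform (volume.restrict s) (fun τ : ℝ => -Complex.I * τ) (fun τ => ψ (i, τ)) r := by
      intro r hr
      rw [bdryTransform_eq_sum hP i ((Lp.memLp ψ).integrable (by norm_num)) hr.le,
        Finset.sum_eq_single i]
      · simp_rw [exponent_self]; rfl
      · intro j _ hj
        apply integral_eq_zero_of_ae
        filter_upwards [hψj j] with τ hτ
        rw [hτ hj]; simp
      · exact fun h => absurd (Finset.mem_univ i) h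
    have h2 := lintegral_enorm_expTransform_neg_line measurableSet_Icc
      ((hψi i).integrable (by norm_num)) (hψi i)
    have h3 : ∫⁻ r in Ioi (0 : ℝ), ‖bdryTransform P i ψ r‖ₑ ^ 2
        = ENNReal.ofReal Real.pi * ∫⁻ y, ‖ψ y‖ₑ ^ 2 ∂bdryMeasure P := by
      rw [show ∫⁻ y, ‖ψ y‖ₑ ^ 2 ∂bdryMeasure P = _ from lintegral_fiberMeasure _,
        Finset.sum_eq_single i]
      · rw [← h2]
        refine setLIntegral_congr_fun measurableSet_Ioi fun r hr => ?_
        rw [h1 r hr]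
      · intro j _ hj
        rw [lintegral_eq_zero_iff' (by
          exact ((hψi j).1.enorm.pow_const 2))]
        filter_upwards [hψj j] with τ hτ
        have : ψ (j, τ) = 0 := hτ hj
        rw [this]; simp
      · exact fun h => absurd (Finset.mem_univ i) h
    have h4 := congrArg ENNReal.toReal h3
    rw [lintegral_enorm_sq_eq (memLp_two_bdryTransform hP i (Lp.memLp ψ)),
      lintegral_enorm_sq_eq (Lp.memLp ψ), ENNReal.toReal_mul,
      ENNReal.toReal_ofReal Real.pi_pos.le,
      ENNReal.toReal_ofReal (integral_nonneg fun _ => sq_nonneg _),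
      ENNReal.toReal_ofReal (integral_nonneg fun _ => sq_nonneg _)] at h4
    rw [norm_sq_bdryOp, h4, norm_sq_eq_integral]
    simp
  have hsup : ∀ {E : Set ℝ} (hE : MeasurableSet ((Prod.mk i) '' E)),
      ∀ᵐ y ∂bdryMeasure P, y.1 ≠ i → indicatorOp _ hE φ y = 0 := by
    intro E hE
    filter_upwards [coeFn_indicatorOp hE φ] with y hy hyi
    rw [hy, indicator_of_notMem]
    rintro ⟨τ, _, rfl⟩
    exact hyi rfl
  have h1 := key _ (hsup hE)
  have h2 := key _ (hsup hF)
  have h3 := key (indicatorOp _ hE φ + indicatorOp _ hF φ) (by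
    filter_upwards [hsup hE, hsup hF, Lp.coeFn_add (indicatorOp _ hE φ) (indicatorOp _ hF φ)]
      with y h1 h2 h3 hy
    rw [h3, Pi.add_apply, h1 hy, h2 hy, add_zero])
  rw [map_add, norm_add_sq (𝕜 := ℂ), norm_add_sq_real] at h3
  have h4 : inner ℝ (indicatorOp _ hE φ) (indicatorOp _ hF φ) = 0 := by
    rw [L2.inner_def]
    apply integral_eq_zero_of_ae
    filter_upwards [coeFn_indicatorOp hE φ, coeFn_indicatorOp hF φ] with y h1 h2
    rw [h1, h2]
    by_cases h : y ∈ Prod.mk i '' E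
    · have : y ∉ Prod.mk i '' F := by
        obtain ⟨τ, hτ, rfl⟩ := h
        rintro ⟨τ', hτ', he⟩
        rw [Prod.mk.injEq] at he
        exact disjoint_left.1 hEF hτ (he.2 ▸ hτ')
      simp [indicator_of_notMem this]
    · simp [indicator_of_notMem h]
  rw [h4] at h3
  simp only [RCLike.re_to_complex] at h3
  nlinarith

end SpectralDN

/-! ### Localisation at the vertices. -/

namespace SpectralDN
open Filter Topology
open scoped ENNReal ComplexConjugate

variable {n : ℕ} {P : Polygon ℂ n}

/-- The first half of the `j`-th side. -/
def lowerHalf (P : Polygon ℂ n) (j : Fin n) : Set (Fin n × ℝ) :=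
  Prod.mk j '' Ico (-halfLength P j) 0

/-- The second half of the `j`-th side. -/
def upperHalf (P : Polygon ℂ n) (j : Fin n) : Set (Fin n × ℝ) :=
  Prod.mk j '' Icc 0 (halfLength P j)

/-- The part of the boundary close to the end of the `w`-th side. -/
def corner (P : Polygon ℂ n) (w : Fin n) : Set (Fin n × ℝ) :=
  upperHalf P w ∪ lowerHalf P (finRotate n w)

theorem measurableSet_lowerHalf (P : Polygon ℂ n) (j : Fin n) : MeasurableSet (lowerHalf P j) :=
  (measurableEmbedding_prodMk_left j).measurableSet_image.2 measurableSet_Ico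

theorem measurableSet_upperHalf (P : Polygon ℂ n) (j : Fin n) : MeasurableSet (upperHalf P j) :=
  (measurableEmbedding_prodMk_left j).measurableSet_image.2 measurableSet_Icc

theorem measurableSet_corner (P : Polygon ℂ n) (w : Fin n) : MeasurableSet (corner P w) :=
  (measurableSet_upperHalf P w).union (measurableSet_lowerHalf P _)

theorem mk_mem_upperHalf {j k : Fin n} {τ : ℝ} :
    (k, τ) ∈ upperHalf P j ↔ k = j ∧ τ ∈ Icc 0 (halfLength P j) := by
  simp only [upperHalf, mem_image, Prod.mk.injEq]
  constructor
  · rintro ⟨x, hx, rfl, rfl⟩; exact ⟨rfl, hx⟩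
  · rintro ⟨rfl, hx⟩; exact ⟨τ, hx, rfl, rfl⟩

theorem mk_mem_lowerHalf {j k : Fin n} {τ : ℝ} :
    (k, τ) ∈ lowerHalf P j ↔ k = j ∧ τ ∈ Ico (-halfLength P j) 0 := by
  simp only [lowerHalf, mem_image, Prod.mk.injEq]
  constructor
  · rintro ⟨x, hx, rfl, rfl⟩; exact ⟨rfl, hx⟩
  · rintro ⟨rfl, hx⟩; exact ⟨τ, hx, rfl, rfl⟩

theorem disjoint_upperHalf_lowerHalf (hP : IsConvexPolygon P) (w : Fin n) :
    Disjoint (upperHalf P w) (lowerHalf P (finRotate n w)) := by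
  rw [disjoint_left]
  rintro ⟨k, τ⟩ h1 h2
  rw [mk_mem_upperHalf] at h1
  rw [mk_mem_lowerHalf] at h2
  exact finRotate_ne_self hP.1 w (h2.1.symm.trans h1.1)

theorem indicatorOp_union {Y : Type*} [MeasurableSpace Y] {μ : Measure Y} {E F : Set Y}
    (hE : MeasurableSet E) (hF : MeasurableSet F) (hEF : Disjoint E F) (φ : Lp ℝ 2 μ) :
    indicatorOp μ (hE.union hF) φ = indicatorOp μ hE φ + indicatorOp μ hF φ := by
  apply Lp.ext
  filter_upwards [coeFn_indicatorOp (hE.union hF) φ, coeFn_indicatorOp hE φ,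
    coeFn_indicatorOp hF φ, Lp.coeFn_add (indicatorOp μ hE φ) (indicatorOp μ hF φ)]
    with y h1 h2 h3 h4
  rw [h1, h4, Pi.add_apply, h2, h3, indicator_union_of_disjoint hEF]

theorem indicatorOp_corner (hP : IsConvexPolygon P) (w : Fin n) (φ : Lp ℝ 2 (bdryMeasure P)) :
    indicatorOp _ (measurableSet_corner P w) φ = indicatorOp _ (measurableSet_upperHalf P w) φ
      + indicatorOp _ (measurableSet_lowerHalf P (finRotate n w)) φ :=
  indicatorOp_union _ _ (disjoint_upperHalf_lowerHalf hP w) φ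

theorem sum_indicatorOp_corner (φ : Lp ℝ 2 (bdryMeasure P)) :
    ∑ w, indicatorOp _ (measurableSet_corner P w) φ = φ := by
  apply Lp.ext
  have h1 : ∀ᵐ y ∂bdryMeasure P, ∀ w,
      indicatorOp _ (measurableSet_corner P w) φ y = (corner P w).indicator φ y :=
    ae_all_iff.2 fun w => coeFn_indicatorOp _ φ
  have h2 : ∀ᵐ y ∂bdryMeasure P, ∑ w, (corner P w).indicator φ y = φ y := by
    refine ae_bdryMeasure_of_forall fun j τ hτ => ?_
    by_cases h0 : 0 ≤ τ
    · rw [Finset.sum_eq_single j]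
      · rw [indicator_of_mem]
        exact Or.inl (mk_mem_upperHalf.2 ⟨rfl, h0, hτ.2⟩)
      · intro w _ hw
        rw [indicator_of_notMem]
        rintro (h | h)
        · exact hw (mk_mem_upperHalf.1 h).1.symm
        · exact not_lt.2 h0 (mk_mem_lowerHalf.1 h).2.2
      · exact fun h => absurd (Finset.mem_univ j) h
    · rw [Finset.sum_eq_single ((finRotate n).symm j)]
      · rw [indicator_of_mem]
        refine Or.inr (mk_mem_lowerHalf.2 ?_)
        rw [Equiv.apply_symm_apply]
        exact ⟨rfl, hτ.1, not_le.1 h0⟩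
      · intro w _ hw
        rw [indicator_of_notMem]
        rintro (h | h)
        · exact h0 (mk_mem_upperHalf.1 h).2.1
        · exact hw ((Equiv.eq_symm_apply _).2 (mk_mem_lowerHalf.1 h).1.symm)
      · exact fun h => absurd (Finset.mem_univ _) h
  filter_upwards [h1, h2, Lp.coeFn_finsetSum Finset.univ
    fun w => indicatorOp (bdryMeasure P) (measurableSet_corner P w) φ] with y h1 h2 h3
  rw [h3, ← h2, Finset.sum_apply]
  exact Finset.sum_congr rfl fun w _ => h1 w

/-- A corner whose vertex is off the line of side `i` stays away from that line: on the half of a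
side nearest the vertex, interpolation gives at least half of the vertex height. -/
theorem height_corner_ge (hP : IsConvexPolygon P) {i w : Fin n} (h1 : w ≠ i)
    (h2 : finRotate n w ≠ i) :
    ∃ δ > 0, ∀ p ∈ corner P w, δ ≤ height P i (sidePoint P p) := by
  have hv : 0 < height P i (P (finRotate n w)) :=
    height_vertex_pos hP h2 fun h => h1 ((finRotate n).injective h)
  refine ⟨_, half_pos hv, ?_⟩
  rintro ⟨j, τ⟩ (h | h)
  · obtain ⟨rfl, hτ⟩ := mk_mem_upperHalf.1 h
    have h3 := two_mul_halfLength_mul_height (P := P) i j τ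
    have h4 := height_vertex_nonneg hP i j
    have hσ := halfLength_pos hP j
    have h5 : halfLength P j * height P i (P (finRotate n j))
        ≤ 2 * halfLength P j * height P i (sidePoint P (j, τ)) := by
      rw [h3]; nlinarith [hτ.1, hτ.2]
    by_contra! hlt
    nlinarith
  · obtain ⟨rfl, hτ⟩ := mk_mem_lowerHalf.1 h
    set v := finRotate n w with hvw
    have h3 := two_mul_halfLength_mul_height (P := P) i v τ
    have h4 := height_vertex_nonneg hP i (finRotate n v)
    have hσ := halfLength_pos hP v
    have h5 : halfLength P v * height P i (P v)
        ≤ 2 * halfLength P v * height P i (sidePoint P (v, τ)) := by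
      rw [h3]; nlinarith [hτ.1, hτ.2]
    by_contra! hlt
    nlinarith

theorem exponent_eq_of_sidePoint_eq (i : Fin n) {p q : Fin n × ℝ}
    (h : sidePoint P p = sidePoint P q) : exponent P i p = exponent P i q := by
  rw [exponent, exponent, h]

/-- The preceding side touches the line of a side only in the common vertex, and there the exponent
may be computed from the start of the latter side. -/
theorem exponent_prev_of_height_eq_zero (hP : IsConvexPolygon P) (w : Fin n) {τ : ℝ}
    (h : height P (finRotate n w) (sidePoint P (w, τ)) = 0) :
    exponent P (finRotate n w) (w, τ) = Complex.I * halfLength P (finRotate n w) := by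
  have h3 := two_mul_halfLength_mul_height (P := P) (finRotate n w) w τ
  have hpos : 0 < height P (finRotate n w) (P w) :=
    height_vertex_pos hP (finRotate_ne_self hP.1 w).symm (finRotate_finRotate_ne_self hP.1 w).symm
  rw [h, height_self, mul_zero, mul_zero, add_zero, zero_eq_mul] at h3
  have hτ : τ = halfLength P w := by
    rcases h3 with h3 | h3
    · linarith
    · exact absurd h3 hpos.ne'
  rw [hτ, exponent_eq_of_sidePoint_eq (q := (finRotate n w, -halfLength P (finRotate n w))),
    exponent_self]
  · push_cast; ring
  · rw [sidePoint_halfLength, sidePoint_neg_halfLength]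

theorem exponent_next_of_height_eq_zero (hP : IsConvexPolygon P) (i : Fin n) {τ : ℝ}
    (h : height P i (sidePoint P (finRotate n i, τ)) = 0) :
    exponent P i (finRotate n i, τ) = -Complex.I * halfLength P i := by
  have h3 := two_mul_halfLength_mul_height (P := P) i (finRotate n i) τ
  have hpos : 0 < height P i (P (finRotate n (finRotate n i))) :=
    height_vertex_pos hP (finRotate_finRotate_ne_self hP.1 i) (finRotate_ne_self hP.1 _)
  rw [h, height_finRotate, mul_zero, mul_zero, zero_add, zero_eq_mul] at h3
  have hτ : τ = -halfLength P (finRotate n i) := by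
    rcases h3 with h3 | h3
    · linarith
    · exact absurd h3 hpos.ne'
  rw [hτ, exponent_eq_of_sidePoint_eq (q := (i, halfLength P i)), exponent_self]
  rw [sidePoint_halfLength, sidePoint_neg_halfLength]

/-- Both real parts are heights, hence nonnegative, so `conj ξ + ξ'` can vanish only when both
heights are zero and the imaginary parts agree. Compactness turns nonvanishing into a lower bound.
-/
theorem exists_le_norm_conj_exponent_add (hP : IsConvexPolygon P) (i j k : Fin n) {a b c d : ℝ}
    (hab : Icc a b ⊆ Icc (-halfLength P j) (halfLength P j))
    (hcd : Icc c d ⊆ Icc (-halfLength P k) (halfLength P k))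
    (h : ∀ s ∈ Icc a b, ∀ t ∈ Icc c d, height P i (sidePoint P (j, s)) = 0 →
      height P i (sidePoint P (k, t)) = 0 → (exponent P i (j, s)).im ≠ (exponent P i (k, t)).im) :
    ∃ δ > 0, ∀ s ∈ Icc a b, ∀ t ∈ Icc c d,
      δ ≤ ‖conj (exponent P i (j, s)) + exponent P i (k, t)‖ := by
  have hc : Continuous fun z : ℝ × ℝ => ‖conj (exponent P i (j, z.1)) + exponent P i (k, z.2)‖ := by
    have h1 := continuous_exponent (P := P) i
    have h2 := Complex.continuous_conj
    fun_prop
  obtain ⟨δ, hδ, h1⟩ := ((isCompact_Icc (a := a) (b := b)).prod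
    (isCompact_Icc (a := c) (b := d))).exists_forall_le' hc.continuousOn (a := 0) (by
      rintro ⟨s, t⟩ ⟨hs, ht⟩
      refine norm_pos_iff.2 fun h0 => ?_
      have hre := congrArg Complex.re h0
      have him := congrArg Complex.im h0
      simp only [Complex.add_re, Complex.add_im, Complex.conj_re, Complex.conj_im, exponent_re,
        Complex.zero_re, Complex.zero_im] at hre him
      have h3 := height_sidePoint_nonneg hP i j (hab hs)
      have h4 := height_sidePoint_nonneg hP i k (hcd ht)
      exact h s hs t ht (by linarith) (by linarith) (by linarith))
  exact ⟨δ, hδ, fun s hs t ht => h1 (s, t) ⟨hs, ht⟩⟩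

/-- For `i` the side after `w`, the two corners at its ends split into four pairs of half sides.
Three pairs have a kernel bounded away from its singularity. The two halves of side `i` itself touch
at its midpoint, so no such bound holds there, but their images are orthogonal in the real sense. -/
theorem re_inner_corner_tendsto (hP : IsConvexPolygon P) (w : Fin n)
    {φ : ℕ → Lp ℝ 2 (bdryMeasure P)} (hφ : WeaklyNull φ) :
    Tendsto (fun k => (inner ℂ
      (bdryOp hP (finRotate n w) (indicatorOp _ (measurableSet_corner P (finRotate n w)) (φ k)))
      (bdryOp hP (finRotate n w) (indicatorOp _ (measurableSet_corner P w) (φ k))) : ℂ).re)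
      atTop (𝓝 0) := by
  set i := finRotate n w with hi
  set j := finRotate n i with hj
  have hσi := halfLength_pos hP i
  have hσj := halfLength_pos hP j
  have hσw := halfLength_pos hP w
  obtain ⟨δ₁, hδ₁, h₁⟩ := exists_le_norm_conj_exponent_add hP i i w (a := 0) (b := halfLength P i)
    (c := 0) (d := halfLength P w) (Icc_subset_Icc_left (by linarith))
    (Icc_subset_Icc_left (by linarith)) (fun s hs t ht _ h0 => by
      rw [exponent_prev_of_height_eq_zero hP w h0, exponent_self, ← hi]
      simp only [neg_mul, Complex.neg_im, Complex.I_mul_im, Complex.ofReal_re]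
      intro h
      linarith [hs.1])
  obtain ⟨δ₂, hδ₂, h₂⟩ := exists_le_norm_conj_exponent_add hP i j w (a := -halfLength P j) (b := 0)
    (c := 0) (d := halfLength P w) (Icc_subset_Icc_right (by linarith))
    (Icc_subset_Icc_left (by linarith)) (fun s hs t ht h0' h0 => by
      rw [exponent_prev_of_height_eq_zero hP w h0, exponent_next_of_height_eq_zero hP i h0',
        ← hi]
      simp only [neg_mul, Complex.neg_im, Complex.I_mul_im, Complex.ofReal_re]
      intro h
      linarith)
  obtain ⟨δ₃, hδ₃, h₃⟩ := exists_le_norm_conj_exponent_add hP i j i (a := -halfLength P j) (b := 0)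
    (c := -halfLength P i) (d := 0) (Icc_subset_Icc_right (by linarith))
    (Icc_subset_Icc_right (by linarith)) (fun s hs t ht h0' h0 => by
      rw [exponent_self, exponent_next_of_height_eq_zero hP i h0']
      simp
      linarith [ht.2])
  have t₁ := tendsto_inner_bdryOp_indicator hP i (measurableSet_upperHalf P i)
    (measurableSet_upperHalf P w) hδ₁ (by
      rintro _ ⟨s, hs, rfl⟩ _ ⟨t, ht, rfl⟩
      exact h₁ s hs t ht) hφ
  have t₂ := tendsto_inner_bdryOp_indicator hP i (measurableSet_lowerHalf P j)
    (measurableSet_upperHalf P w) hδ₂ (by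
      rintro _ ⟨s, hs, rfl⟩ _ ⟨t, ht, rfl⟩
      exact h₂ s (Ico_subset_Icc_self hs) t ht) hφ
  have t₃ := tendsto_inner_bdryOp_indicator hP i (measurableSet_lowerHalf P j)
    (measurableSet_lowerHalf P i) hδ₃ (by
      rintro _ ⟨s, hs, rfl⟩ _ ⟨t, ht, rfl⟩
      exact h₃ s (Ico_subset_Icc_self hs) t (Ico_subset_Icc_self ht)) hφ
  have t₄ := (Complex.continuous_re.tendsto _).comp ((t₁.add t₂).add t₃)
  simp only [add_zero, Complex.zero_re] at t₄
  refine t₄.congr fun k => ?_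
  have h4 : (inner ℂ (bdryOp hP i (indicatorOp _ (measurableSet_upperHalf P i) (φ k)))
      (bdryOp hP i (indicatorOp _ (measurableSet_lowerHalf P i) (φ k))) : ℂ).re = 0 :=
    re_inner_bdryOp_indicator_eq_zero hP i (measurableSet_upperHalf P i)
    (measurableSet_lowerHalf P i) (by
      rw [disjoint_left]
      exact fun x h1 h2 => not_lt.2 h1.1 h2.2) (φ k)
  have e := indicatorOp_corner hP w (φ k)
  rw [← hi] at e
  rw [e, indicatorOp_corner hP i, map_add, map_add, inner_add_left,
    inner_add_right, inner_add_right]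
  simp only [Function.comp, Complex.add_re]
  linarith

theorem norm_tendsto_zero_of_add {V : Type*} [NormedAddCommGroup V] [InnerProductSpace ℂ V]
    {u v : ℕ → V} (h : Tendsto (fun k => u k + v k) atTop (𝓝 0))
    (huv : Tendsto (fun k => (inner ℂ (u k) (v k) : ℂ).re) atTop (𝓝 0)) :
    Tendsto (fun k => ‖u k‖ ^ 2) atTop (𝓝 0) ∧ Tendsto (fun k => ‖v k‖ ^ 2) atTop (𝓝 0) := by
  have h1 := (h.norm.pow 2).sub (huv.const_mul 2)
  simp only [norm_zero, ne_eq, OfNat.ofNat_ne_zero, not_false_eq_true, zero_pow, mul_zero,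
    sub_zero] at h1
  have h2 : ∀ k, ‖u k + v k‖ ^ 2 - 2 * (inner ℂ (u k) (v k) : ℂ).re = ‖u k‖ ^ 2 + ‖v k‖ ^ 2 := by
    intro k
    rw [norm_add_sq (𝕜 := ℂ)]
    simp only [RCLike.re_to_complex]
    ring
  simp_rw [h2] at h1
  exact ⟨squeeze_zero (fun k => sq_nonneg _) (fun k => le_add_of_nonneg_right (sq_nonneg _)) h1,
    squeeze_zero (fun k => sq_nonneg _) (fun k => le_add_of_nonneg_left (sq_nonneg _)) h1⟩

/-- Corners not adjacent to a side contribute vanishing terms to its component. The two adjacent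
ones have a sum tending to zero and are asymptotically orthogonal, so each tends to zero separately.
-/
theorem norm_sq_bdryOp_corner_tendsto (hP : IsConvexPolygon P) (w : Fin n)
    {φ : ℕ → Lp ℝ 2 (bdryMeasure P)} (hφ : WeaklyNull φ)
    (h0 : Tendsto (fun k => bdryOp hP (finRotate n w) (φ k)) atTop (𝓝 0)) :
    Tendsto (fun k => ‖bdryOp hP (finRotate n w)
        (indicatorOp _ (measurableSet_corner P (finRotate n w)) (φ k))‖ ^ 2) atTop (𝓝 0) ∧
      Tendsto (fun k => ‖bdryOp hP (finRotate n w)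
        (indicatorOp _ (measurableSet_corner P w) (φ k))‖ ^ 2) atTop (𝓝 0) := by
  refine norm_tendsto_zero_of_add ?_ (re_inner_corner_tendsto hP w hφ)
  set i := finRotate n w with hi
  have hiw : i ≠ w := finRotate_ne_self hP.1 w
  have hrest : Tendsto (fun k => ∑ u ∈ (Finset.univ.erase i).erase w,
      bdryOp hP i (indicatorOp _ (measurableSet_corner P u) (φ k))) atTop (𝓝 0) := by
    have h := tendsto_finsetSum (x := atTop) ((Finset.univ.erase i).erase w)
      (f := fun u k => bdryOp hP i (indicatorOp _ (measurableSet_corner P u) (φ k)))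
      (a := fun _ => 0) ?_
    · rwa [Finset.sum_const_zero] at h
    intro u hu
    simp only [Finset.mem_erase, Finset.mem_univ, and_true] at hu
    obtain ⟨δ, hδ, h⟩ := height_corner_ge hP (i := i) (w := u) hu.2
      fun h => hu.1 ((finRotate n).injective h)
    exact tendsto_bdryOp_indicator_of_height_ge hP i _ hδ h hφ
  have h1 := h0.sub hrest
  rw [sub_zero] at h1
  refine h1.congr fun k => ?_
  have h2 := congrArg (bdryOp hP i) (sum_indicatorOp_corner (φ k))
  rw [map_sum, ← Finset.add_sum_erase _ _ (Finset.mem_univ i),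
    ← Finset.add_sum_erase _ _ (Finset.mem_erase.2 ⟨hiw.symm, Finset.mem_univ w⟩)] at h2
  rw [← h2]
  abel

end SpectralDN

/-! ### The corner estimate on the polygon. -/

namespace SpectralDN
open Filter Topology
open scoped ENNReal ComplexConjugate

theorem setIntegral_eq_setIntegral_Ioi_comp {E : Type*} [NormedAddCommGroup E] [NormedSpace ℝ E]
    {s : Set ℝ} (e : ℝ ≃ᵐ ℝ) (he : MeasurePreserving e) {G : ℝ → E}
    (hGs : ∀ τ ∉ s, G τ = 0) (hG0 : ∀ t < 0, G (e t) = 0) :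
    ∫ τ in s, G τ = ∫ t in Ioi (0 : ℝ), G (e t) := by
  rw [setIntegral_eq_integral_of_forall_compl_eq_zero hGs,
    ← he.integral_comp e.measurableEmbedding, ← integral_Ici_eq_integral_Ioi,
    setIntegral_eq_integral_of_forall_compl_eq_zero (s := Ici (0 : ℝ)) fun t ht =>
      hG0 t (not_le.1 ht)]

theorem expTransform_const_add {Y : Type*} [MeasurableSpace Y] (m : Measure Y) (c : ℂ)
    (η : Y → ℂ) (f : Y → ℝ) (r : ℝ) :
    expTransform m (fun y => c + η y) f r = Complex.exp (-(r * c)) * expTransform m η f r := by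
  unfold expTransform
  rw [← integral_const_mul]
  congr 1; ext y
  rw [← mul_assoc, ← Complex.exp_add]
  congr 2; ring

theorem expTransform_conj {Y : Type*} [MeasurableSpace Y] (m : Measure Y)
    (η : Y → ℂ) (f : Y → ℝ) (r : ℝ) :
    expTransform m (fun y => conj (η y)) f r = conj (expTransform m η f r) := by
  unfold expTransform
  rw [← integral_conj]
  congr 1; ext y
  simp [← Complex.exp_conj]

variable {n : ℕ} {P : Polygon ℂ n}

theorem exponent_self_sub (w : Fin n) (t : ℝ) : exponent P w (w, halfLength P w - t)
    = -(Complex.I * halfLength P w) + rayExponent 0 t := by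
  rw [exponent_self, rayExponent_zero]
  push_cast; ring

theorem exponent_self_add (v : Fin n) (t : ℝ) : exponent P v (v, t - halfLength P v)
    = Complex.I * halfLength P v + conj (rayExponent 0 t) := by
  rw [exponent_self, rayExponent_zero]
  simp
  ring

theorem sidePoint_next_sub (w : Fin n) (t : ℝ) :
    sidePoint P (finRotate n w, t - halfLength P (finRotate n w))
      = midPoint P w + dir P w * halfLength P w + dir P (finRotate n w) * t := by
  have h1 := sidePoint_halfLength (P := P) w
  have h2 := sidePoint_neg_halfLength (P := P) (finRotate n w)
  simp only [sidePoint] at h1 h2 ⊢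
  push_cast at h2 ⊢
  linear_combination h2 - h1

/-- Measured by the distance `t` from the common vertex, the next side is a ray of the model corner.
The imaginary constant is the one that also occurs on side `w`, so it contributes a common phase. -/
theorem exponent_next {w : Fin n} {θ : ℝ}
    (hθ : dir P (finRotate n w) = -Complex.exp (-(θ * Complex.I)) * dir P w) (t : ℝ) :
    exponent P w (finRotate n w, t - halfLength P (finRotate n w))
      = -(Complex.I * halfLength P w) + rayExponent θ t := by
  rw [exponent, sidePoint_next_sub, hθ, rayExponent]
  linear_combination (-Complex.I * (halfLength P w - Complex.exp (-(θ * Complex.I)) * t))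
    * conj_dir_mul_dir (P := P) w

theorem exponent_prev {w : Fin n} {θ : ℝ}
    (hθ : dir P (finRotate n w) = -Complex.exp (-(θ * Complex.I)) * dir P w) (t : ℝ) :
    exponent P (finRotate n w) (w, halfLength P w - t)
      = Complex.I * halfLength P (finRotate n w) + conj (rayExponent θ t) := by
  have h0 := sidePoint_next_sub (P := P) w 0
  have h1 : conj (dir P (finRotate n w)) = -Complex.exp (θ * Complex.I) * conj (dir P w) := by
    rw [hθ, map_mul, map_neg, ← Complex.exp_conj]
    simp
  have h2 := conj_dir_mul_dir (P := P) w
  have h3 := conj_dir_mul_dir (P := P) (finRotate n w)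
  have h4 : conj (rayExponent θ t) = -Complex.I * (Complex.exp (θ * Complex.I) * t) := by
    rw [rayExponent, map_mul, map_mul, ← Complex.exp_conj]
    simp
  have h5 : sidePoint P (w, halfLength P w - t) - midPoint P (finRotate n w)
      = -(dir P (finRotate n w) * halfLength P (finRotate n w)) - dir P w * t := by
    simp only [sidePoint] at h0 ⊢
    push_cast at h0 ⊢
    linear_combination -h0
  have h6 : conj (dir P (finRotate n w)) * dir P w = -Complex.exp (θ * Complex.I) := by
    rw [h1]; linear_combination (-Complex.exp (θ * Complex.I)) * h2
  rw [exponent, h4, h5]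
  linear_combination (Complex.I * halfLength P (finRotate n w)) * h3 + (Complex.I * t) * h6

/-- Up to phases and complex conjugation, which do not affect moduli, the two components belonging
to the sides at a vertex are those of the model corner. -/
theorem corner_norm_sq_le (hP : IsConvexPolygon P) (w : Fin n) : ∃ c > 0,
    ∀ φ : Lp ℝ 2 (bdryMeasure P), c * ‖indicatorOp _ (measurableSet_corner P w) φ‖ ^ 2 ≤
      2 * (‖bdryOp hP w (indicatorOp _ (measurableSet_corner P w) φ)‖ ^ 2
        + ‖bdryOp hP (finRotate n w) (indicatorOp _ (measurableSet_corner P w) φ)‖ ^ 2) := by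
  obtain ⟨θ, hθ0, hθπ, hθ⟩ := exists_interior_angle hP w
  have hwv : w ≠ finRotate n w := (finRotate_ne_self hP.1 w).symm
  set v := finRotate n w with hv
  have hcos : Real.cos (θ / 2) < 1 := by
    rw [← Real.cos_zero]
    exact Real.cos_lt_cos_of_nonneg_of_le_pi le_rfl (by linarith) (by linarith)
  refine ⟨(1 - Real.cos (θ / 2)) * Real.pi, mul_pos (by linarith) Real.pi_pos, fun φ => ?_⟩
  set ψ := indicatorOp _ (measurableSet_corner P w) φ with hψ
  set F : Fin n × ℝ → ℝ := (corner P w).indicator φ with hF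
  have hψF : ψ =ᵐ[bdryMeasure P] F := coeFn_indicatorOp _ φ
  have hFL : MemLp F 2 (bdryMeasure P) := (memLp_congr_ae hψF).1 (Lp.memLp ψ)
  have hF1 : Integrable F (bdryMeasure P) := hFL.integrable (by norm_num)
  have hFj : ∀ j, MemLp (fun τ => F (j, τ)) 2
      (volume.restrict (Icc (-halfLength P j) (halfLength P j))) :=
    memLp_two_fiberMeasure_iff.1 hFL
  have hFw : ∀ τ, τ ∉ Icc 0 (halfLength P w) → F (w, τ) = 0 := fun τ hτ => by
    refine indicator_of_notMem ?_ _
    rintro (h | h)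
    · exact hτ (mk_mem_upperHalf.1 h).2
    · exact hwv (mk_mem_lowerHalf.1 h).1
  have hFv : ∀ τ, τ ∉ Ico (-halfLength P v) 0 → F (v, τ) = 0 := fun τ hτ => by
    refine indicator_of_notMem ?_ _
    rintro (h | h)
    · exact hwv (mk_mem_upperHalf.1 h).1.symm
    · exact hτ (mk_mem_lowerHalf.1 h).2
  have hFz : ∀ j, j ≠ w ∧ j ≠ v → ∀ τ, F (j, τ) = 0 := fun j hj τ => by
    refine indicator_of_notMem ?_ _
    rintro (h | h)
    · exact hj.1 (mk_mem_upperHalf.1 h).1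
    · exact hj.2 (mk_mem_lowerHalf.1 h).1
  have hσw := halfLength_pos hP w
  have hσv := halfLength_pos hP v
  have hsw : ∀ τ, τ ∉ Icc (-halfLength P w) (halfLength P w) → F (w, τ) = 0 := fun τ hτ =>
    hFw τ fun h => hτ ⟨by linarith [h.1], h.2⟩
  have hsv : ∀ τ, τ ∉ Icc (-halfLength P v) (halfLength P v) → F (v, τ) = 0 := fun τ hτ =>
    hFv τ fun h => hτ ⟨h.1, by linarith [h.2]⟩
  have hw0 : ∀ t < 0, F (w, halfLength P w - t) = 0 := fun t ht =>
    hFw _ fun h => by linarith [h.2]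
  have hv0 : ∀ t < 0, F (v, t - halfLength P v) = 0 := fun t ht =>
    hFv _ fun h => by linarith [h.1]
  have hew : MeasurePreserving (MeasurableEquiv.subLeft (halfLength P w)) :=
    volume.measurePreserving_sub_left _
  have hev : MeasurePreserving (MeasurableEquiv.subRight (halfLength P v)) :=
    measurePreserving_sub_right volume _
  have hfull : ∀ j, (∀ τ, τ ∉ Icc (-halfLength P j) (halfLength P j) → F (j, τ) = 0) →
      MemLp (fun τ => F (j, τ)) 2 ∧ Integrable (fun τ => F (j, τ)) := by
    intro j hj
    have : (Icc (-halfLength P j) (halfLength P j)).indicator (fun τ => F (j, τ))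
        = fun τ => F (j, τ) := indicator_eq_self.2 fun τ hτ => by
      by_contra h
      exact hτ (hj τ h)
    rw [← this]
    exact ⟨(memLp_indicator_iff_restrict measurableSet_Icc).2 (hFj j),
      (integrable_indicator_iff measurableSet_Icc).2 ((hFj j).integrable (by norm_num))⟩
  -- Both densities become functions of the distance to the common vertex, extended by zero to the
  -- half line.
  set f : ℝ → ℝ := fun t => F (w, halfLength P w - t) with hf
  set g : ℝ → ℝ := fun t => F (v, t - halfLength P v) with hg
  have hfL : MemLp f 2 := (hfull w hsw).1.comp_measurePreserving hew
  have hgL : MemLp g 2 := (hfull v hsv).1.comp_measurePreserving hev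
  have hf1 : Integrable f := (hew.integrable_comp (hfull w hsw).2.1).2 (hfull w hsw).2
  have hg1 : Integrable g := (hev.integrable_comp (hfull v hsv).2.1).2 (hfull v hsv).2
  have hsum : ∀ {E : Type} [AddCommMonoid E] (a : Fin n → E),
      (∀ j, j ≠ w ∧ j ≠ v → a j = 0) → ∑ j, a j = a w + a v := fun a ha =>
    Finset.sum_eq_add w v hwv (fun j _ hj => ha j hj)
      (fun h => absurd (Finset.mem_univ _) h) fun h => absurd (Finset.mem_univ _) h
  have htrans : ∀ i r, 0 < r → bdryTransform P i ψ r
      = expTransform (volume.restrict (Ioi 0)) (fun t => exponent P i (w, halfLength P w - t)) f r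
      + expTransform (volume.restrict (Ioi 0)) (fun t => exponent P i (v, t - halfLength P v)) g r := by
    intro i r hr
    rw [bdryTransform_congr i hψF, bdryTransform_eq_sum hP i hF1 hr.le, hsum]
    · congr 1
      · have h := setIntegral_eq_setIntegral_Ioi_comp
          (s := Icc (-halfLength P w) (halfLength P w)) (MeasurableEquiv.subLeft (halfLength P w))
          hew (G := fun τ => Complex.exp (-((r : ℂ) * exponent P i (w, τ))) * (F (w, τ) : ℂ))
          (fun τ hτ => by rw [hsw τ hτ]; simp)
          (fun t ht => by
            have := hw0 t ht
            change _ * ((F (w, halfLength P w - t) : ℝ) : ℂ) = 0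
            rw [this]; simp)
        exact h
      · have h := setIntegral_eq_setIntegral_Ioi_comp
          (s := Icc (-halfLength P v) (halfLength P v)) (MeasurableEquiv.subRight (halfLength P v))
          hev (G := fun τ => Complex.exp (-((r : ℂ) * exponent P i (v, τ))) * (F (v, τ) : ℂ))
          (fun τ hτ => by rw [hsv τ hτ]; simp)
          (fun t ht => by
            have := hv0 t ht
            change _ * ((F (v, t - halfLength P v) : ℝ) : ℂ) = 0
            rw [this]; simp)
        exact h
    · intro j hj
      simp [expTransform, hFz j hj]
  have hnorm : ‖ψ‖ ^ 2 = (∫ t in Ioi (0 : ℝ), f t ^ 2) + ∫ t in Ioi (0 : ℝ), g t ^ 2 := by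
    have h1 : ∫ y, ψ y ^ 2 ∂bdryMeasure P = ∫ y, F y ^ 2 ∂bdryMeasure P :=
      integral_congr_ae (hψF.mono fun y hy => by simp only; rw [hy])
    rw [norm_sq_eq_integral, h1, show ∫ y, F y ^ 2 ∂bdryMeasure P = _ from
      integral_fiberMeasure hFL.integrable_sq, hsum]
    · congr 1
      · exact setIntegral_eq_setIntegral_Ioi_comp
          (s := Icc (-halfLength P w) (halfLength P w)) (MeasurableEquiv.subLeft (halfLength P w))
          hew (G := fun τ => F (w, τ) ^ 2) (fun τ hτ => by rw [hsw τ hτ]; simp)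
          (fun t ht => by
            have := hw0 t ht
            change F (w, halfLength P w - t) ^ 2 = 0
            rw [this]; simp)
      · exact setIntegral_eq_setIntegral_Ioi_comp
          (s := Icc (-halfLength P v) (halfLength P v)) (MeasurableEquiv.subRight (halfLength P v))
          hev (G := fun τ => F (v, τ) ^ 2) (fun τ hτ => by rw [hsv τ hτ]; simp)
          (fun t ht => by
            have := hv0 t ht
            change F (v, t - halfLength P v) ^ 2 = 0
            rw [this]; simp)
    · intro j hj
      simp [hFz j hj]
  have hphase : ∀ (s r : ℝ), ‖Complex.exp (-(r * (Complex.I * s)))‖ = 1 := fun s r => by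
    rw [Complex.norm_exp]; simp
  have hphase' : ∀ (s r : ℝ), ‖Complex.exp (-(r * -(Complex.I * s)))‖ = 1 := fun s r => by
    rw [Complex.norm_exp]; simp
  have hw : ‖bdryOp hP w ψ‖ ^ 2 = ∫ r in Ioi (0 : ℝ),
      ‖expTransform (volume.restrict (Ioi 0)) (rayExponent 0) f r
        + expTransform (volume.restrict (Ioi 0)) (rayExponent θ) g r‖ ^ 2 := by
    rw [norm_sq_bdryOp]
    refine setIntegral_congr_fun measurableSet_Ioi fun r hr => ?_
    rw [htrans w r hr]
    simp_rw [exponent_self_sub, hv, exponent_next hθ]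
    rw [expTransform_const_add, expTransform_const_add, ← mul_add, norm_mul, hphase', one_mul]
  -- Seen from the second side the ray exponents are conjugated. Since the density is real the whole
  -- transform is conjugated, and the modulus is that of the model with `f` and `g` exchanged.
  have hv' : ‖bdryOp hP v ψ‖ ^ 2 = ∫ r in Ioi (0 : ℝ),
      ‖expTransform (volume.restrict (Ioi 0)) (rayExponent 0) g r
        + expTransform (volume.restrict (Ioi 0)) (rayExponent θ) f r‖ ^ 2 := by
    rw [norm_sq_bdryOp]
    refine setIntegral_congr_fun measurableSet_Ioi fun r hr => ?_
    rw [htrans v r hr]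
    simp_rw [exponent_self_add, hv, exponent_prev hθ]
    rw [expTransform_const_add, expTransform_const_add, expTransform_conj, expTransform_conj,
      ← mul_add, norm_mul, hphase, one_mul, ← map_add, RCLike.norm_conj, add_comm]
  rw [hnorm, hw, hv']
  exact corner_estimate hθ0 hθπ hf1.integrableOn (hfL.restrict _) hg1.integrableOn
    (hgL.restrict _)

theorem tendsto_zero_of_tendsto_bdryOp (hP : IsConvexPolygon P)
    {φ : ℕ → Lp ℝ 2 (bdryMeasure P)} (hφ : WeaklyNull φ)
    (h0 : ∀ i, Tendsto (fun k => bdryOp hP i (φ k)) atTop (𝓝 0)) :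
    Tendsto φ atTop (𝓝 0) := by
  have hcorner : ∀ w, Tendsto (fun k => indicatorOp _ (measurableSet_corner P w) (φ k))
      atTop (𝓝 0) := by
    intro w
    obtain ⟨c, hc, hle⟩ := corner_norm_sq_le hP w
    -- The corner is the end of its own side and the start of the following one. Writing the side as
    -- a successor lets localisation be applied to both components.
    obtain ⟨u, rfl⟩ := (finRotate n).surjective w
    have h1 := (norm_sq_bdryOp_corner_tendsto hP u hφ (h0 _)).1
    have h2 := (norm_sq_bdryOp_corner_tendsto hP (finRotate n u) hφ (h0 _)).2
    have h3 := (((h1.add h2).const_mul 2).const_mul c⁻¹).sqrt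
    simp only [add_zero, mul_zero, Real.sqrt_zero] at h3
    refine squeeze_zero_norm (fun k => ?_) h3
    refine Real.le_sqrt_of_sq_le ?_
    rw [inv_mul_eq_div, le_div_iff₀ hc, mul_comm]
    exact hle (φ k)
  have h := tendsto_finsetSum (x := atTop) Finset.univ
    (f := fun w k => indicatorOp _ (measurableSet_corner P w) (φ k))
    (a := fun _ => 0) fun w _ => hcorner w
  rw [Finset.sum_const_zero] at h
  exact h.congr fun k => sum_indicatorOp_corner (φ k)

end SpectralDN

/-! ### Hilbert space arguments: compactness, projection, variational form. -/

namespace SpectralDN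
open Filter Topology
open scoped ENNReal ComplexConjugate

section abstract
variable {H W : Type*} [NormedAddCommGroup H] [InnerProductSpace ℝ H] [CompleteSpace H]
  [NormedAddCommGroup W] [InnerProductSpace ℝ W]

/-- Sequential Banach-Alaoglu in the dual of a separable space, carried back by the Riesz
isomorphism. -/
theorem exists_subseq_tendsto_inner [TopologicalSpace.SeparableSpace H] {φ : ℕ → H} {M : ℝ}
    (hM : ∀ k, ‖φ k‖ ≤ M) : ∃ (φ₀ : H) (ι : ℕ → ℕ), StrictMono ι ∧
      ∀ g : H, Tendsto (fun k => inner ℝ g (φ (ι k))) atTop (𝓝 (inner ℝ g φ₀)) := by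
  have hcomp := WeakDual.isSeqCompact_closedBall ℝ H 0 M
  obtain ⟨x, _, ι, hι, hx⟩ := hcomp
    (x := fun k => StrongDual.toWeakDual (InnerProductSpace.toDual ℝ H (φ k))) (fun k => by
      simpa using hM k)
  refine ⟨(InnerProductSpace.toDual ℝ H).symm (WeakDual.toStrongDual x), ι, hι, fun g => ?_⟩
  have h := (WeakDual.eval_continuous g).continuousAt.tendsto.comp hx
  rw [real_inner_comm, InnerProductSpace.toDual_symm_apply]
  refine h.congr fun k => ?_
  rw [real_inner_comm]
  rfl

/-- If the bound failed, unit vectors with images tending to zero would have a weak limit along a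
subsequence. The adjoint shows that this limit lies in the kernel, hence is zero, and `hnull` would
force unit vectors to converge to zero. -/
theorem exists_mul_norm_le_of_weakly_null [TopologicalSpace.SeparableSpace H] [CompleteSpace W]
    (A : H →L[ℝ] W)
    (hinj : ∀ φ, A φ = 0 → φ = 0)
    (hnull : ∀ φ : ℕ → H, (∃ M, ∀ k, ‖φ k‖ ≤ M) →
      (∀ g : H, Tendsto (fun k => inner ℝ g (φ k)) atTop (𝓝 0)) →
      Tendsto (fun k => A (φ k)) atTop (𝓝 0) → Tendsto φ atTop (𝓝 0)) :
    ∃ c > 0, ∀ φ, c * ‖φ‖ ≤ ‖A φ‖ := by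
  by_contra! hcon
  have h1 : ∀ k : ℕ, ∃ φ : H, ‖φ‖ = 1 ∧ ‖A φ‖ ≤ 1 / ((k : ℝ) + 1) := by
    intro k
    obtain ⟨φ, hφ⟩ := hcon (1 / ((k : ℝ) + 1)) Nat.one_div_pos_of_nat
    have hpos : 0 < ‖φ‖ := by
      by_contra! h
      have h0 : φ = 0 := norm_le_zero_iff.1 h
      rw [h0] at hφ
      simp at hφ
    refine ⟨‖φ‖⁻¹ • φ, by rw [norm_smul, norm_inv, norm_norm, inv_mul_cancel₀ hpos.ne'], ?_⟩
    rw [map_smul, norm_smul, norm_inv, norm_norm, inv_mul_le_iff₀ hpos, mul_comm]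
    exact hφ.le
  choose φ hφ1 hφA using h1
  have hA : Tendsto (fun k => A (φ k)) atTop (𝓝 0) :=
    squeeze_zero_norm hφA tendsto_one_div_add_atTop_nhds_zero_nat
  obtain ⟨φ₀, ι, hι, hw⟩ := exists_subseq_tendsto_inner fun k => (hφ1 k).le
  have hA' := hA.comp hι.tendsto_atTop
  have hφ0 : φ₀ = 0 := by
    apply hinj
    refine ext_inner_left ℝ fun w => ?_
    rw [inner_zero_right]
    have h2 := hw (ContinuousLinearMap.adjoint A w)
    simp only [ContinuousLinearMap.adjoint_inner_left] at h2
    have h3 := (tendsto_const_nhds (x := w)).inner (𝕜 := ℝ) hA'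
    rw [inner_zero_right] at h3
    exact tendsto_nhds_unique h2 h3
  rw [hφ0] at hw
  simp only [inner_zero_right] at hw
  have h4 := (hnull (φ ∘ ι) ⟨1, fun k => (hφ1 _).le⟩ hw hA').norm
  simp only [Function.comp_apply, hφ1, norm_zero] at h4
  exact one_ne_zero (tendsto_nhds_unique tendsto_const_nhds h4)

/-- The lower bound makes the range complete, so `b` has an orthogonal projection onto it. Its
preimage is the solution, unique by the same bound. -/
theorem existsUnique_inner_eq (A : H →L[ℝ] W) {c : ℝ} (hc : 0 < c) (hA : ∀ φ, c * ‖φ‖ ≤ ‖A φ‖)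
    (b : W) : ∃! φ, ∀ ψ, inner ℝ (A φ) (A ψ) = inner ℝ b (A ψ) := by
  have hanti : AntilipschitzWith (Real.toNNReal c⁻¹) A :=
    A.antilipschitz_of_bound fun φ => by
      rw [Real.coe_toNNReal _ (inv_nonneg.2 hc.le), ← div_eq_inv_mul, le_div_iff₀ hc, mul_comm]
      exact hA φ
  have hcomplete : IsComplete (LinearMap.range A.toLinearMap : Set W) :=
    hanti.isComplete_range A.uniformContinuous
  have : CompleteSpace (LinearMap.range A.toLinearMap) := hcomplete.completeSpace_coe
  obtain ⟨φ, hφ⟩ : ∃ φ, A φ = (LinearMap.range A.toLinearMap).starProjection b :=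
    Submodule.starProjection_apply_mem (LinearMap.range A.toLinearMap) b
  have hsol : ∀ ψ, inner ℝ (A φ) (A ψ) = inner ℝ b (A ψ) := fun ψ => by
    have h := Submodule.starProjection_inner_eq_zero (K := LinearMap.range A.toLinearMap) b (A ψ)
      ⟨ψ, rfl⟩
    rw [inner_sub_left, ← hφ] at h
    linarith
  refine ⟨φ, hsol, fun φ' hφ' => ?_⟩
  have h0 : A (φ' - φ) = 0 := by
    rw [← inner_self_eq_zero (𝕜 := ℝ)]
    nth_rewrite 1 [map_sub]
    rw [inner_sub_left, hφ' (φ' - φ), hsol (φ' - φ), sub_self]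
  have h1 := hA (φ' - φ)
  rw [h0, norm_zero] at h1
  have h2 : ‖φ' - φ‖ ≤ 0 := by
    by_contra! h
    exact not_lt.2 h1 (mul_pos hc h)
  exact sub_eq_zero.1 (norm_le_zero_iff.1 h2)

end abstract

theorem inner_eq_iff_forall_norm_sub_le {H W : Type*} [NormedAddCommGroup H]
    [InnerProductSpace ℝ H] [NormedAddCommGroup W] [InnerProductSpace ℝ W] (A : H →L[ℝ] W) (b : W) (φ : H) :
    (∀ ψ, inner ℝ (A φ) (A ψ) = inner ℝ b (A ψ)) ↔
      ∀ ψ, ‖A φ - b‖ ^ 2 ≤ ‖A ψ - b‖ ^ 2 := by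
  constructor
  · intro h ψ
    have h1 : A ψ - b = (A φ - b) + A (ψ - φ) := by rw [map_sub]; abel
    rw [h1, norm_add_sq_real, inner_sub_left, h, sub_self]
    nlinarith [sq_nonneg ‖A (ψ - φ)‖]
  · intro h ψ
    set p := inner ℝ (A φ - b) (A ψ) with hp
    have key : ∀ t : ℝ, 0 ≤ 2 * t * p + t ^ 2 * ‖A ψ‖ ^ 2 := fun t => by
      have h1 := h (φ + t • ψ)
      have h2 : A (φ + t • ψ) - b = (A φ - b) + t • A ψ := by rw [map_add, map_smul]; abel
      rw [h2, norm_add_sq_real, inner_smul_right, norm_smul, mul_pow, Real.norm_eq_abs,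
        sq_abs] at h1
      linarith
    have hp0 : p = 0 := by
      by_contra hne
      -- Nearly the minimiser in `t` of the quadratic. The `+ 1` covers the case `A ψ = 0`.
      have h3 := key (-p / (‖A ψ‖ ^ 2 + 1))
      have h4 : 0 < ‖A ψ‖ ^ 2 + 1 := by positivity
      have h5 : 2 * (-p / (‖A ψ‖ ^ 2 + 1)) * p + (-p / (‖A ψ‖ ^ 2 + 1)) ^ 2 * ‖A ψ‖ ^ 2
          = -(p ^ 2 * (‖A ψ‖ ^ 2 + 2)) / (‖A ψ‖ ^ 2 + 1) ^ 2 := by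
        field_simp
        ring
      rw [h5] at h3
      have h6 : 0 < p ^ 2 * (‖A ψ‖ ^ 2 + 2) / (‖A ψ‖ ^ 2 + 1) ^ 2 := by positivity
      rw [neg_div] at h3
      linarith
    rw [hp, inner_sub_left] at hp0
    linarith

end SpectralDN

/-! ### The operator on the contours. -/

namespace SpectralDN
open Filter Topology
open scoped ENNReal ComplexConjugate

variable {n : ℕ} {P : Polygon ℂ n}

/-- The `i`-th component of the operator `T`, in terms of densities on the boundary. -/
noncomputable def bdryLaplace (P : Polygon ℂ n) (i : Fin n) (f : Fin n × ℝ → ℝ) (z : ℂ) : ℂ :=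
  ∫ y, Complex.exp (z * exponent P i y) * f y ∂bdryMeasure P

/-- The tuple of Fourier transforms of a density on the boundary. -/
noncomputable def bdryFourier (P : Polygon ℂ n) (f : Fin n × ℝ → ℝ) (j : Fin n) : ℂ → ℂ :=
  fourier (halfLength P j) fun τ => f (j, τ)

theorem bdryLaplace_neg (i : Fin n) (f : Fin n × ℝ → ℝ) (r : ℝ) :
    bdryLaplace P i f (-(r : ℂ)) = bdryTransform P i f r := by
  simp only [bdryLaplace, bdryTransform, expTransform, neg_mul]

theorem exists_bound_exponent (P : Polygon ℂ n) (i : Fin n) :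
    ∃ B : ℝ, 0 ≤ B ∧ ∀ᵐ y ∂bdryMeasure P, ‖exponent P i y‖ ≤ B := by
  obtain ⟨B, hB⟩ := exists_bound_sidePoint P
  refine ⟨max B 0 + ‖midPoint P i‖, by positivity, ?_⟩
  filter_upwards [ae_bdryMeasure_of_forall (q := fun y => ‖sidePoint P y‖ ≤ B) hB] with y hy
  rw [exponent, norm_mul, norm_mul, norm_neg, Complex.norm_I, RCLike.norm_conj, norm_dir, one_mul,
    one_mul]
  exact (norm_sub_le _ _).trans (by gcongr; exact hy.trans (le_max_left _ _))

theorem norm_exp_mul_le {z ξ : ℂ} {R B : ℝ} (hz : ‖z‖ ≤ R) (hξ : ‖ξ‖ ≤ B) :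
    ‖Complex.exp (z * ξ)‖ ≤ Real.exp (R * B) := by
  rw [Complex.norm_exp]
  refine Real.exp_le_exp.2 ((Complex.re_le_norm _).trans ?_)
  rw [norm_mul]
  exact mul_le_mul hz hξ (norm_nonneg _) ((norm_nonneg _).trans hz)

theorem integrable_bdryLaplace (i : Fin n) {f : Fin n × ℝ → ℝ}
    (hf : Integrable f (bdryMeasure P)) (z : ℂ) :
    Integrable (fun y => Complex.exp (z * exponent P i y) * f y) (bdryMeasure P) := by
  obtain ⟨B, _, hB⟩ := exists_bound_exponent P i
  have hm := measurable_exponent (P := P) i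
  refine hf.ofReal.bdd_mul (c := Real.exp (‖z‖ * B))
    (Measurable.aestronglyMeasurable (by fun_prop)) ?_
  filter_upwards [hB] with y hy using norm_exp_mul_le le_rfl hy

theorem exists_norm_bdryLaplace_le (P : Polygon ℂ n) (i : Fin n) : ∃ B : ℝ,
    ∀ f : Fin n × ℝ → ℝ, Integrable f (bdryMeasure P) → ∀ (z : ℂ) (R : ℝ), ‖z‖ ≤ R →
      ‖bdryLaplace P i f z‖ ≤ Real.exp (R * B) * ∫ y, ‖f y‖ ∂bdryMeasure P := by
  obtain ⟨B, _, hB⟩ := exists_bound_exponent P i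
  refine ⟨B, fun f hf z R hz => ?_⟩
  refine (norm_integral_le_integral_norm _).trans ?_
  rw [← integral_const_mul]
  refine integral_mono_ae (integrable_bdryLaplace i hf z).norm (hf.norm.const_mul _) ?_
  filter_upwards [hB] with y hy
  rw [norm_mul, Complex.norm_real]
  exact mul_le_mul_of_nonneg_right (norm_exp_mul_le hz hy) (norm_nonneg _)

theorem continuous_bdryLaplace (i : Fin n) {f : Fin n × ℝ → ℝ}
    (hf : Integrable f (bdryMeasure P)) : Continuous (bdryLaplace P i f) := by
  obtain ⟨B, _, hB⟩ := exists_bound_exponent P i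
  rw [continuous_iff_continuousAt]
  intro z
  refine continuousAt_of_dominated (bound := fun y => Real.exp ((‖z‖ + 1) * B) * ‖f y‖)
    (.of_forall fun w => (integrable_bdryLaplace i hf w).1) ?_ (hf.norm.const_mul _)
    (.of_forall fun y => by fun_prop)
  filter_upwards [Metric.ball_mem_nhds z one_pos] with w hw
  have hw' : ‖w‖ ≤ ‖z‖ + 1 := by
    have h1 : ‖w - z‖ < 1 := by rw [← dist_eq_norm]; exact hw
    have h2 := norm_add_le (w - z) z
    rw [sub_add_cancel] at h2
    linarith
  filter_upwards [hB] with y hy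
  rw [norm_mul, Complex.norm_real]
  exact mul_le_mul_of_nonneg_right (norm_exp_mul_le hw' hy) (norm_nonneg _)

theorem halfLength_nonneg (j : Fin n) : 0 ≤ halfLength P j := by
  unfold halfLength; positivity

theorem fourier_eq_setIntegral {σ : ℝ} (hσ : 0 ≤ σ) (φ : ℝ → ℝ) (z : ℂ) :
    fourier σ φ z = ∫ τ in Icc (-σ) σ, Complex.exp (-Complex.I * z * τ) * φ τ := by
  rw [fourier, intervalIntegral.integral_of_le (by linarith), integral_Icc_eq_integral_Ioc]

/-- The shift by `mᵢ - mⱼ` and the rotation by `αᵢ - αⱼ` combine with the Fourier kernel into one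
exponential of the boundary point. This is the reason for the form of `T`. -/
theorem T_bdryFourier {f : Fin n × ℝ → ℝ} (hf : Integrable f (bdryMeasure P)) (i : Fin n)
    (z : ℂ) : T P (bdryFourier P f) i z = bdryLaplace P i f z := by
  rw [T, show bdryLaplace P i f z = _ from integral_fiberMeasure (integrable_bdryLaplace i hf z),
    ← Finset.add_sum_erase _ _ (Finset.mem_univ i)]
  congr 1
  · rw [bdryFourier, fourier_eq_setIntegral (halfLength_nonneg i)]
    congr 1; ext τ
    rw [exponent_self]
    congr 2; ring
  · refine Finset.sum_congr rfl fun j _ => ?_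
    rw [bdryFourier, fourier_eq_setIntegral (halfLength_nonneg j), ← integral_const_mul]
    congr 1; ext τ
    rw [← mul_assoc, ← Complex.exp_add]
    congr 2
    have h1 : Complex.exp (-Complex.I * (angle P i - angle P j : ℝ))
        = Complex.exp (-Complex.I * angle P i) * dir P j := by
      rw [dir, ← Complex.exp_add]
      congr 1; push_cast; ring
    rw [h1, exponent, sidePoint, conj_dir]
    ring

theorem mem_Xsym_iff {Φ : Fin n → ℂ → ℂ} :
    Φ ∈ Xsym P ↔ ∃ φ : Lp ℝ 2 (bdryMeasure P), Φ = bdryFourier P φ := by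
  constructor
  · intro h
    choose φ hφ hΦ using h
    have hL : MemLp (fun y : Fin n × ℝ => φ y.1 y.2) 2 (bdryMeasure P) :=
      memLp_two_fiberMeasure_iff.2 hφ
    refine ⟨hL.toLp, funext fun j => ?_⟩
    have hae : ∀ᵐ τ ∂volume.restrict (Icc (-halfLength P j) (halfLength P j)),
        hL.toLp _ (j, τ) = φ j τ := ae_fiberMeasure_iff.1 hL.coeFn_toLp j
    rw [hΦ j]
    ext z
    rw [bdryFourier, fourier_eq_setIntegral (halfLength_nonneg j),
      fourier_eq_setIntegral (halfLength_nonneg j)]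
    apply integral_congr_ae
    filter_upwards [hae] with τ hτ
    rw [hτ]
  · rintro ⟨φ, rfl⟩ j
    exact ⟨fun τ => φ (j, τ), memLp_two_fiberMeasure_iff.1 (Lp.memLp φ) j, rfl⟩

theorem integral_norm_le {Y : Type*} [MeasurableSpace Y] {μ : Measure Y} [IsFiniteMeasure μ]
    (φ : Lp ℝ 2 μ) : ∫ y, ‖φ y‖ ∂μ ≤ √(μ.real univ) * ‖φ‖ := by
  have h1 := integral_mul_sq_le (Lp.memLp φ) (memLp_const (1 : ℝ))
  simp only [abs_one, mul_one, one_pow, integral_const, smul_eq_mul] at h1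
  rw [← norm_sq_eq_integral] at h1
  refine abs_le_of_sq_le_sq' (h1.trans (le_of_eq ?_)) (by positivity) |>.2
  rw [mul_pow, Real.sq_sqrt measureReal_nonneg, mul_comm]

/-- A chord is no longer than the variation along it, so unit speed makes the curve 1-Lipschitz. -/
theorem IsContour.continuousOn {γ : ℝ → ℂ} (h : IsContour γ) : ContinuousOn γ (Ici 0) := by
  have hle : ∀ x ∈ Ici (0 : ℝ), ∀ y ∈ Ici (0 : ℝ), x ≤ y → dist (γ x) (γ y) ≤ dist x y := by
    intro x hx y hy hxy
    have h1 := h.1 hx hy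
    have h2 := eVariationOn.edist_le γ (s := Ici 0 ∩ Icc x y) (x := x) (y := y)
      ⟨hx, left_mem_Icc.2 hxy⟩ ⟨hy, right_mem_Icc.2 hxy⟩
    rw [h1, edist_dist, NNReal.coe_one, one_mul] at h2
    rw [dist_comm x y, Real.dist_eq, abs_of_nonneg (by linarith)]
    exact (ENNReal.ofReal_le_ofReal_iff (by linarith)).1 h2
  refine (LipschitzOnWith.of_dist_le_mul (K := 1) fun x hx y hy => ?_).continuousOn
  rw [NNReal.coe_one, one_mul]
  rcases le_total x y with hxy | hxy
  · exact hle x hx y hy hxy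
  · rw [dist_comm, dist_comm x]; exact hle y hy x hx hxy

theorem IsContour.exists_tail {γ : ℝ → ℂ} (h : IsContour γ) :
    ∃ c S : ℝ, 0 ≤ S ∧ c ≤ S ∧ ∀ s > S, γ s = -((s - c : ℝ) : ℂ) := by
  obtain ⟨c, S, hS⟩ := h.2
  -- Enlarging the threshold to be at least `0` and `c` makes `s - c` positive beyond it, so the
  -- tail lies on the negative axis itself.
  refine ⟨c, max (max S 0) c, le_max_of_le_left (le_max_right _ _), le_max_right _ _,
    fun s hs => ?_⟩
  rw [hS s ((le_max_left S 0).trans ((le_max_left _ _).trans hs.le))]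
  push_cast; ring

theorem lintegral_Ioi_sub (G : ℝ → ℝ≥0∞) (c S : ℝ) :
    ∫⁻ s in Ioi S, G (s - c) = ∫⁻ r in Ioi (S - c), G r := by
  have h := (measurePreserving_sub_right volume c).setLIntegral_comp_preimage_emb
    (MeasurableEquiv.subRight c).measurableEmbedding G (Ioi (S - c))
  rw [← h]
  congr 2
  ext s
  simp

/-- On the compact part the curve stays in a disc, where the transform is bounded by a multiple of
`‖φ‖`. On the tail it is a translate of the boundary transform. -/
theorem exists_lintegral_bdryLaplace_comp_le (hP : IsConvexPolygon P) {γ : ℝ → ℂ}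
    (hγ : IsContour γ) (i : Fin n) : ∃ C : ℝ, 0 ≤ C ∧ ∀ φ : Lp ℝ 2 (bdryMeasure P),
      ∫⁻ s in Ici (0 : ℝ), ‖bdryLaplace P i φ (γ s)‖ₑ ^ 2 ≤ ENNReal.ofReal (C * ‖φ‖ ^ 2) := by
  obtain ⟨c, S, hS0, hcS, hγS⟩ := hγ.exists_tail
  obtain ⟨R, hR⟩ := isCompact_Icc.exists_bound_of_continuousOn
    (hγ.continuousOn.mono (Icc_subset_Ici_self : Icc 0 S ⊆ Ici 0))
  obtain ⟨B, hB⟩ := exists_norm_bdryLaplace_le P i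
  set K := Real.exp (R * B) * √((bdryMeasure P).real univ) with hK
  refine ⟨K ^ 2 * S + ‖bdryOp hP i‖ ^ 2, by positivity, fun φ => ?_⟩
  have hφ1 : Integrable φ (bdryMeasure P) := (Lp.memLp φ).integrable (by norm_num)
  have h1 : ∫⁻ s in Icc 0 S, ‖bdryLaplace P i φ (γ s)‖ₑ ^ 2
      ≤ ENNReal.ofReal (K ^ 2 * S * ‖φ‖ ^ 2) := by
    calc _ ≤ ∫⁻ _ in Icc 0 S, ENNReal.ofReal ((K * ‖φ‖) ^ 2) := by
          refine setLIntegral_mono measurable_const fun s hs => ?_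
          rw [← ofReal_norm, ← ENNReal.ofReal_pow (norm_nonneg _)]
          refine ENNReal.ofReal_le_ofReal (pow_le_pow_left₀ (norm_nonneg _) ?_ 2)
          refine (hB φ hφ1 _ R (hR s hs)).trans ?_
          rw [hK, mul_assoc]
          exact mul_le_mul_of_nonneg_left (integral_norm_le φ) (Real.exp_pos _).le
      _ = ENNReal.ofReal (K ^ 2 * S * ‖φ‖ ^ 2) := by
          rw [setLIntegral_const, Real.volume_Icc, ← ENNReal.ofReal_mul (sq_nonneg _)]
          congr 1; ring
  have h2 : ∫⁻ s in Ioi S, ‖bdryLaplace P i φ (γ s)‖ₑ ^ 2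
      ≤ ENNReal.ofReal (‖bdryOp hP i‖ ^ 2 * ‖φ‖ ^ 2) := by
    calc _ = ∫⁻ s in Ioi S, ‖bdryTransform P i φ (s - c)‖ₑ ^ 2 := by
          refine setLIntegral_congr_fun measurableSet_Ioi fun s hs => ?_
          rw [hγS s hs, bdryLaplace_neg]
      _ = ∫⁻ r in Ioi (S - c), ‖bdryTransform P i φ r‖ₑ ^ 2 :=
          lintegral_Ioi_sub (fun r => ‖bdryTransform P i φ r‖ₑ ^ 2) c S
      _ ≤ ∫⁻ r in Ioi 0, ‖bdryTransform P i φ r‖ₑ ^ 2 :=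
          lintegral_mono_set (Ioi_subset_Ioi (by linarith))
      _ = ENNReal.ofReal (‖bdryOp hP i φ‖ ^ 2) := by
          rw [lintegral_enorm_sq_eq (memLp_two_bdryTransform hP i (Lp.memLp φ)), norm_sq_bdryOp]
      _ ≤ _ := by
          rw [← mul_pow]
          exact ENNReal.ofReal_le_ofReal
            (pow_le_pow_left₀ (norm_nonneg _) ((bdryOp hP i).le_opNorm φ) 2)
  rw [← Icc_union_Ioi_eq_Ici hS0, add_mul, ENNReal.ofReal_add (by positivity) (by positivity)]
  exact (lintegral_union_le _ _ _).trans (add_le_add h1 h2)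

/-- The arc length measure on the disjoint union of the contours. -/
noncomputable def contourMeasure (n : ℕ) : Measure (Fin n × ℝ) :=
  fiberMeasure fun _ => volume.restrict (Ici 0)

/-- The values on the contours of the operator `T`. -/
noncomputable def contourTrace (P : Polygon ℂ n) (γ : Fin n → ℝ → ℂ) (f : Fin n × ℝ → ℝ)
    (x : Fin n × ℝ) : ℂ :=
  bdryLaplace P x.1 f (γ x.1 x.2)

theorem aestronglyMeasurable_contourTrace {γ : Fin n → ℝ → ℂ} (hγ : ∀ i, IsContour (γ i))
    (φ : Lp ℝ 2 (bdryMeasure P)) :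
    AEStronglyMeasurable (contourTrace P γ φ) (contourMeasure n) :=
  aestronglyMeasurable_fiberMeasure_iff.2 fun i =>
    ((continuous_bdryLaplace i ((Lp.memLp φ).integrable (by norm_num))).comp_continuousOn
      (hγ i).continuousOn).aestronglyMeasurable measurableSet_Ici

theorem exists_lintegral_contourTrace_le (hP : IsConvexPolygon P) {γ : Fin n → ℝ → ℂ}
    (hγ : ∀ i, IsContour (γ i)) : ∃ C : ℝ, 0 ≤ C ∧ ∀ φ : Lp ℝ 2 (bdryMeasure P),
      ∫⁻ x, ‖contourTrace P γ φ x‖ₑ ^ 2 ∂contourMeasure n ≤ ENNReal.ofReal (C * ‖φ‖ ^ 2) := by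
  choose C hC0 hC using fun i => exists_lintegral_bdryLaplace_comp_le hP (hγ i) i
  refine ⟨∑ i, C i, Finset.sum_nonneg fun i _ => hC0 i, fun φ => ?_⟩
  rw [contourMeasure, lintegral_fiberMeasure, Finset.sum_mul,
    ENNReal.ofReal_sum_of_nonneg fun i _ => mul_nonneg (hC0 i) (sq_nonneg _)]
  exact Finset.sum_le_sum fun i _ => hC i φ

theorem memLp_two_contourTrace (hP : IsConvexPolygon P) {γ : Fin n → ℝ → ℂ}
    (hγ : ∀ i, IsContour (γ i)) (φ : Lp ℝ 2 (bdryMeasure P)) :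
    MemLp (contourTrace P γ φ) 2 (contourMeasure n) := by
  obtain ⟨C, _, hC⟩ := exists_lintegral_contourTrace_le hP hγ
  exact memLp_two_of_lintegral (aestronglyMeasurable_contourTrace hγ φ)
    ((hC φ).trans_lt ENNReal.ofReal_lt_top)

theorem bdryLaplace_congr (i : Fin n) {f g : Fin n × ℝ → ℝ} (h : f =ᵐ[bdryMeasure P] g) :
    bdryLaplace P i f = bdryLaplace P i g := by
  ext z
  apply integral_congr_ae
  filter_upwards [h] with y hy
  rw [hy]

theorem bdryLaplace_add (i : Fin n) {f g : Fin n × ℝ → ℝ} (hf : Integrable f (bdryMeasure P))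
    (hg : Integrable g (bdryMeasure P)) (z : ℂ) :
    bdryLaplace P i (f + g) z = bdryLaplace P i f z + bdryLaplace P i g z := by
  unfold bdryLaplace
  rw [← integral_add (integrable_bdryLaplace i hf z) (integrable_bdryLaplace i hg z)]
  congr 1; ext y
  simp [mul_add]

theorem bdryLaplace_const_smul (i : Fin n) (c : ℝ) (f : Fin n × ℝ → ℝ) (z : ℂ) :
    bdryLaplace P i (c • f) z = c • bdryLaplace P i f z := by
  unfold bdryLaplace
  rw [← integral_smul]
  congr 1; ext y
  simp
  ring

/-- The operator `T`, from densities on the boundary to functions on the contours. -/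
noncomputable def contourOp (hP : IsConvexPolygon P) {γ : Fin n → ℝ → ℂ}
    (hγ : ∀ i, IsContour (γ i)) : Lp ℝ 2 (bdryMeasure P) →L[ℝ] Lp ℂ 2 (contourMeasure n) :=
  LinearMap.mkContinuousOfExistsBound
    { toFun := fun φ => (memLp_two_contourTrace hP hγ φ).toLp
      map_add' := fun φ ψ => by
        rw [← MemLp.toLp_add]
        apply MemLp.toLp_congr
        refine .of_forall fun x => ?_
        rw [contourTrace, bdryLaplace_congr x.1 (Lp.coeFn_add φ ψ)]
        exact bdryLaplace_add x.1 ((Lp.memLp φ).integrable (by norm_num))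
          ((Lp.memLp ψ).integrable (by norm_num)) _
      map_smul' := fun c φ => by
        rw [RingHom.id_apply, ← MemLp.toLp_const_smul]
        apply MemLp.toLp_congr
        refine .of_forall fun x => ?_
        rw [contourTrace, bdryLaplace_congr x.1 (Lp.coeFn_smul c φ)]
        exact bdryLaplace_const_smul x.1 c φ _ } (by
    obtain ⟨C, hC0, hC⟩ := exists_lintegral_contourTrace_le hP hγ
    refine ⟨√C, fun φ => ?_⟩
    rw [LinearMap.coe_mk, AddHom.coe_mk, Lp.norm_toLp]
    refine ENNReal.toReal_le_of_le_ofReal (by positivity) ?_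
    rw [← ENNReal.pow_le_pow_left_iff two_ne_zero, eLpNorm_two_sq,
      ← ENNReal.ofReal_pow (by positivity), mul_pow, Real.sq_sqrt hC0]
    exact hC φ)

theorem contourOp_apply (hP : IsConvexPolygon P) {γ : Fin n → ℝ → ℂ}
    (hγ : ∀ i, IsContour (γ i)) (φ : Lp ℝ 2 (bdryMeasure P)) :
    contourOp hP hγ φ = (memLp_two_contourTrace hP hγ φ).toLp := rfl

theorem norm_sq_contourOp (hP : IsConvexPolygon P) {γ : Fin n → ℝ → ℂ}
    (hγ : ∀ i, IsContour (γ i)) (φ : Lp ℝ 2 (bdryMeasure P)) :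
    ENNReal.ofReal (‖contourOp hP hγ φ‖ ^ 2)
      = ∑ i, ∫⁻ s in Ici (0 : ℝ), ‖bdryLaplace P i φ (γ i s)‖ₑ ^ 2 := by
  have h := lintegral_fiberMeasure (ν := fun _ : Fin n => volume.restrict (Ici (0 : ℝ)))
    (fun x => ‖contourTrace P γ φ x‖ₑ ^ 2)
  refine Eq.trans ?_ h
  rw [contourOp_apply, Lp.norm_toLp, ← ENNReal.toReal_pow, ENNReal.ofReal_toReal
    (ENNReal.pow_ne_top (memLp_two_contourTrace hP hγ φ).2.ne), eLpNorm_two_sq]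
  rfl

end SpectralDN

/-! ### Coercivity and conclusion. -/

namespace SpectralDN
open Filter Topology
open scoped ENNReal ComplexConjugate

variable {n : ℕ} {P : Polygon ℂ n}

theorem lintegral_bdryTransform_tail_le (hP : IsConvexPolygon P) {γ : Fin n → ℝ → ℂ}
    (hγ : ∀ i, IsContour (γ i)) (i : Fin n) : ∃ R : ℝ, 0 ≤ R ∧ ∀ φ : Lp ℝ 2 (bdryMeasure P),
      ∫⁻ r in Ioi R, ‖bdryTransform P i φ r‖ₑ ^ 2
        ≤ ENNReal.ofReal (‖contourOp hP hγ φ‖ ^ 2) := by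
  obtain ⟨c, S, hS0, hcS, hγS⟩ := (hγ i).exists_tail
  refine ⟨S - c, by linarith, fun φ => ?_⟩
  calc _ = ∫⁻ s in Ioi S, ‖bdryTransform P i φ (s - c)‖ₑ ^ 2 :=
        (lintegral_Ioi_sub (fun r => ‖bdryTransform P i φ r‖ₑ ^ 2) c S).symm
    _ = ∫⁻ s in Ioi S, ‖bdryLaplace P i φ (γ i s)‖ₑ ^ 2 := by
        refine setLIntegral_congr_fun measurableSet_Ioi fun s hs => ?_
        rw [hγS s hs, bdryLaplace_neg]
    _ ≤ ∫⁻ s in Ici (0 : ℝ), ‖bdryLaplace P i φ (γ i s)‖ₑ ^ 2 :=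
        lintegral_mono_set fun s hs => hS0.trans (le_of_lt hs)
    _ ≤ _ := by
        rw [norm_sq_contourOp]
        exact Finset.single_le_sum (f := fun i => ∫⁻ s in Ici (0 : ℝ),
          ‖bdryLaplace P i φ (γ i s)‖ₑ ^ 2) (fun _ _ => zero_le) (Finset.mem_univ i)

/-- One component suffices: it vanishes almost everywhere on the tail of its contour, hence
everywhere there by continuity, and injectivity of the transform applies. -/
theorem eq_zero_of_contourOp_eq_zero (hP : IsConvexPolygon P) {γ : Fin n → ℝ → ℂ}
    (hγ : ∀ i, IsContour (γ i)) {φ : Lp ℝ 2 (bdryMeasure P)} (h : contourOp hP hγ φ = 0) :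
    φ = 0 := by
  have hn := hP.1
  let i : Fin n := ⟨0, by omega⟩
  obtain ⟨R, hR, hle⟩ := lintegral_bdryTransform_tail_le hP hγ i
  have hφ1 : Integrable φ (bdryMeasure P) := (Lp.memLp φ).integrable (by norm_num)
  have hcont : ContinuousOn (bdryTransform P i φ) (Ioi R) :=
    (continuousOn_expTransform (measurable_exponent i) (ae_exponent_re_nonneg hP i) hφ1).mono
      fun r hr => hR.trans (le_of_lt hr)
  have h0 : ∫⁻ r in Ioi R, ‖bdryTransform P i φ r‖ₑ ^ 2 = 0 := by
    have := hle φ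
    rw [h, norm_zero] at this
    simpa using this
  have hm : AEStronglyMeasurable (bdryTransform P i φ) (volume.restrict (Ioi R)) :=
    hcont.aestronglyMeasurable measurableSet_Ioi
  rw [lintegral_eq_zero_iff' (hm.enorm.pow_const 2)] at h0
  have hae : bdryTransform P i φ =ᵐ[volume.restrict (Ioi R)] fun _ => 0 := by
    filter_upwards [h0] with r hr
    simpa using hr
  have heq := Measure.eqOn_open_of_ae_eq hae isOpen_Ioi hcont continuousOn_const
  rw [Lp.eq_zero_iff_ae_eq_zero]
  exact ae_eq_zero_of_expTransform_eq_zero hP (Lp.memLp φ) i (R := R) fun r hr => heq hr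

/-- The contours control the transform only beyond some `R`. On `(0, R]` weak convergence gives
pointwise convergence with a uniform bound, so dominated convergence covers the missing part. -/
theorem WeaklyNull.tendsto_bdryOp (hP : IsConvexPolygon P) {γ : Fin n → ℝ → ℂ}
    (hγ : ∀ i, IsContour (γ i)) {φ : ℕ → Lp ℝ 2 (bdryMeasure P)} (hφ : WeaklyNull φ)
    (h : Tendsto (fun k => contourOp hP hγ (φ k)) atTop (𝓝 0)) (i : Fin n) :
    Tendsto (fun k => bdryOp hP i (φ k)) atTop (𝓝 0) := by
  obtain ⟨R, hR, hle⟩ := lintegral_bdryTransform_tail_le hP hγ i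
  obtain ⟨M, hM⟩ := hφ.bounded
  have hφ1 : ∀ k, Integrable (φ k) (bdryMeasure P) := fun k =>
    (Lp.memLp (φ k)).integrable (by norm_num)
  have hre := ae_exponent_re_nonneg hP i
  have hm := measurable_exponent (P := P) i
  set B := √((bdryMeasure P).real univ) * M with hB
  have hbound : ∀ k, ∀ r, 0 ≤ r → ‖bdryTransform P i (φ k) r‖ ≤ B := fun k r hr =>
    (norm_expTransform_le hre (hφ1 k) hr).trans ((integral_norm_le (φ k)).trans
      (mul_le_mul_of_nonneg_left (hM k) (Real.sqrt_nonneg _)))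
  have hpt : ∀ r, 0 ≤ r → Tendsto (fun k => bdryTransform P i (φ k) r) atTop (𝓝 0) := fun r hr =>
    hφ.tendsto_integral (MemLp.of_bound (C := 1) (Measurable.aestronglyMeasurable (by fun_prop))
      (hre.mono fun y hy => norm_exp_neg_mul_le_one hr hy))
  have h1 : Tendsto (fun k => ∫⁻ r in Ioc 0 R, ‖bdryTransform P i (φ k) r‖ₑ ^ 2) atTop (𝓝 0) := by
    have := tendsto_lintegral_of_dominated_convergence' (μ := volume.restrict (Ioc 0 R))
      (F := fun k r => ‖bdryTransform P i (φ k) r‖ₑ ^ 2) (f := fun _ => 0)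
      (fun _ => ENNReal.ofReal B ^ 2)
      (fun k => ((aestronglyMeasurable_bdryTransform hP i (hφ1 k)).mono_measure
        (Measure.restrict_mono_set _ Ioc_subset_Ioi_self)).enorm.pow_const 2)
      (fun k => by
        filter_upwards [ae_restrict_mem measurableSet_Ioc] with r hr
        gcongr
        rw [← ofReal_norm]
        exact ENNReal.ofReal_le_ofReal (hbound k r hr.1.le))
      (by
        rw [setLIntegral_const, Real.volume_Ioc]
        exact ENNReal.mul_ne_top (ENNReal.pow_ne_top ENNReal.ofReal_ne_top) ENNReal.ofReal_ne_top)
      (by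
        filter_upwards [ae_restrict_mem measurableSet_Ioc] with r hr
        have := ((ENNReal.continuous_pow 2).tendsto _).comp (hpt r hr.1.le).enorm
        simpa [Function.comp_def] using this)
    simpa using this
  have h2 : Tendsto (fun k => ENNReal.ofReal (‖contourOp hP hγ (φ k)‖ ^ 2)) atTop (𝓝 0) := by
    have := ENNReal.tendsto_ofReal ((h.norm).pow 2)
    simpa using this
  have h3 := h1.add h2
  rw [add_zero] at h3
  have h4 : Tendsto (fun k => ENNReal.ofReal (‖bdryOp hP i (φ k)‖ ^ 2)) atTop (𝓝 0) := by
    refine tendsto_of_tendsto_of_tendsto_of_le_of_le tendsto_const_nhds h3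
      (fun _ => zero_le) fun k => ?_
    rw [norm_sq_bdryOp, ← lintegral_enorm_sq_eq (memLp_two_bdryTransform hP i (Lp.memLp (φ k))),
      ← Ioc_union_Ioi_eq_Ioi hR]
    exact (lintegral_union_le _ _ _).trans (add_le_add le_rfl (hle (φ k)))
  have h5 := ((ENNReal.tendsto_toReal ENNReal.zero_ne_top).comp h4).sqrt
  simp only [Function.comp_def, ENNReal.toReal_ofReal (sq_nonneg _), ENNReal.toReal_zero,
    Real.sqrt_zero, Real.sqrt_sq (norm_nonneg _)] at h5
  exact tendsto_zero_iff_norm_tendsto_zero.2 h5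

theorem exists_mul_norm_le_contourOp (hP : IsConvexPolygon P) {γ : Fin n → ℝ → ℂ}
    (hγ : ∀ i, IsContour (γ i)) : ∃ c > 0, ∀ φ, c * ‖φ‖ ≤ ‖contourOp hP hγ φ‖ := by
  -- The finite exponent gives separability of `L²`, needed for weak sequential compactness.
  have : Fact ((2 : ℝ≥0∞) ≠ ∞) := ⟨by norm_num⟩
  exact exists_mul_norm_le_of_weakly_null _ (fun φ => eq_zero_of_contourOp_eq_zero hP hγ)
    fun φ hb hw hA =>
      have hφ : WeaklyNull φ := ⟨hb, hw⟩
      tendsto_zero_of_tendsto_bdryOp hP hφ (hφ.tendsto_bdryOp hP hγ hA)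

theorem integrableOn_mul_conj {F G : Fin n × ℝ → ℂ} (hF : MemLp F 2 (contourMeasure n))
    (hG : MemLp G 2 (contourMeasure n)) (i : Fin n) :
    IntegrableOn (fun s => F (i, s) * conj (G (i, s))) (Ici (0 : ℝ)) :=
  MemLp.integrable_mul (memLp_two_fiberMeasure_iff.1 hF i) (memLp_two_fiberMeasure_iff.1 hG i).star

theorem inner_toLp {F G : Fin n × ℝ → ℂ} (hF : MemLp F 2 (contourMeasure n))
    (hG : MemLp G 2 (contourMeasure n)) : inner ℝ hF.toLp hG.toLp
      = (∑ i, ∫ s in Ici (0 : ℝ), F (i, s) * conj (G (i, s))).re := by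
  have hint : Integrable (fun x => F x * conj (G x)) (contourMeasure n) :=
    MemLp.integrable_mul hF hG.star
  rw [← integral_fiberMeasure (f := fun x => F x * conj (G x)) hint, L2.inner_def]
  have h := integral_re hint
  simp only [RCLike.re_to_complex] at h
  refine Eq.trans ?_ h
  apply integral_congr_ae
  filter_upwards [hF.coeFn_toLp, hG.coeFn_toLp] with x h1 h2
  rw [h1, h2, Complex.inner]
  simp only [Complex.mul_re, Complex.conj_re, Complex.conj_im]
  ring

theorem norm_toLp_sq {F : Fin n × ℝ → ℂ} (hF : MemLp F 2 (contourMeasure n)) :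
    ‖hF.toLp‖ ^ 2 = ∑ i, ∫ s in Ici (0 : ℝ), ‖F (i, s)‖ ^ 2 := by
  rw [← integral_norm_sq_toLp, ← integral_fiberMeasure (f := fun x => ‖F x‖ ^ 2)
    hF.norm.integrable_sq]
  apply integral_congr_ae
  filter_upwards [hF.coeFn_toLp] with x hx
  rw [hx]

theorem T_sub_I_smul (Φ Ψ : Fin n → ℂ → ℂ) (i : Fin n) (z : ℂ) :
    T P (Φ - Complex.I • Ψ) i z = T P Φ i z - Complex.I * T P Ψ i z := by
  simp only [T, Pi.sub_apply, Pi.smul_apply, smul_eq_mul, mul_add, mul_sub, Finset.mul_sum,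
    Finset.sum_sub_distrib]
  rw [add_sub_add_comm]
  congr 2
  exact Finset.sum_congr rfl fun j _ => by ring

theorem T_bdryFourier_eq_contourTrace (γ : Fin n → ℝ → ℂ) (φ : Lp ℝ 2 (bdryMeasure P))
    (i : Fin n) (s : ℝ) :
    T P (bdryFourier P φ) i (γ i s) = contourTrace P γ φ (i, s) :=
  T_bdryFourier ((Lp.memLp φ).integrable (by norm_num)) i _

end SpectralDN

theorem theorem3 {n : ℕ} (P : Polygon ℂ n) (hP : SpectralDN.IsConvexPolygon P)
    (γ : Fin n → ℝ → ℂ) (hγ : ∀ i, SpectralDN.IsContour (γ i))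
    (Φt : Fin n → ℂ → ℂ) (hΦt : Φt ∈ SpectralDN.Xsym P) :
    -- all integrals in the two forms and in the functional converge absolutely
    (∀ Φ ∈ SpectralDN.Xsym P, ∀ Ψ ∈ SpectralDN.Xsym P, ∀ i, IntegrableOn
      (fun s => SpectralDN.T P Φ i (γ i s) * starRingEnd ℂ (SpectralDN.T P Ψ i (γ i s)))
      (Ici (0 : ℝ))) ∧
    (∀ Φ ∈ SpectralDN.Xsym P, ∀ i, IntegrableOn
      (fun s => ‖SpectralDN.T P (Φ - Complex.I • Φt) i (γ i s)‖ ^ 2) (Ici (0 : ℝ))) ∧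
    -- the weak problem has a unique solution
    (∃! Φ, SpectralDN.IsWeakSolution P γ Φt Φ) ∧
    -- equivalently, the functional has a unique minimizer
    (∀ Φ, SpectralDN.IsWeakSolution P γ Φt Φ ↔ SpectralDN.IsMinimizer P γ Φt Φ) ∧
    (∃! Φ, SpectralDN.IsMinimizer P γ Φt Φ) := by
  open SpectralDN in
  obtain ⟨φt, rfl⟩ := mem_Xsym_iff.1 hΦt
  have hM := memLp_two_contourTrace hP hγ
  -- The data vector is `b = i TΦᵗ`. Then `Re(i w) = -Im w` accounts for the sign and the imaginary
  -- part in `ℓ`.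
  have hMt : MemLp (fun x => Complex.I * contourTrace P γ φt x) 2 (contourMeasure n) :=
    (hM φt).const_mul _
  set A := contourOp hP hγ with hA
  set b : Lp ℂ 2 (contourMeasure n) := hMt.toLp with hb
  have ha : ∀ φ ψ : Lp ℝ 2 (bdryMeasure P),
      a P γ (bdryFourier P φ) (bdryFourier P ψ) = inner ℝ (A φ) (A ψ) := fun φ ψ => by
    rw [hA, contourOp_apply, contourOp_apply, inner_toLp]
    simp only [a, T_bdryFourier_eq_contourTrace]
  have hell : ∀ ψ : Lp ℝ 2 (bdryMeasure P),
      ell P γ (bdryFourier P φt) (bdryFourier P ψ) = inner ℝ b (A ψ) := fun ψ => by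
    rw [hb, hA, contourOp_apply, inner_toLp]
    simp only [ell, T_bdryFourier_eq_contourTrace, mul_assoc, integral_const_mul]
    rw [← Finset.mul_sum, Complex.I_mul_re]
  have hfun : ∀ φ : Lp ℝ 2 (bdryMeasure P),
      functional P γ (bdryFourier P φt) (bdryFourier P φ) = ‖A φ - b‖ ^ 2 := fun φ => by
    rw [hA, hb, contourOp_apply, ← MemLp.toLp_sub, norm_toLp_sq]
    simp only [functional, T_sub_I_smul, T_bdryFourier_eq_contourTrace, Pi.sub_apply]
  obtain ⟨c, hc, hcoer⟩ := exists_mul_norm_le_contourOp hP hγ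
  have hweak : ∀ φ : Lp ℝ 2 (bdryMeasure P),
      IsWeakSolution P γ (bdryFourier P φt) (bdryFourier P φ) ↔
        ∀ ψ, inner ℝ (A φ) (A ψ) = inner ℝ b (A ψ) := fun φ => by
    constructor
    · intro h ψ
      rw [← ha, ← hell]
      exact h.2 _ (mem_Xsym_iff.2 ⟨ψ, rfl⟩)
    · intro h
      refine ⟨mem_Xsym_iff.2 ⟨φ, rfl⟩, fun Ψ hΨ => ?_⟩
      obtain ⟨ψ, rfl⟩ := mem_Xsym_iff.1 hΨ
      rw [ha, hell]
      exact h ψ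
  have hmin : ∀ φ : Lp ℝ 2 (bdryMeasure P),
      IsMinimizer P γ (bdryFourier P φt) (bdryFourier P φ) ↔
        ∀ ψ, ‖A φ - b‖ ^ 2 ≤ ‖A ψ - b‖ ^ 2 := fun φ => by
    constructor
    · intro h ψ
      rw [← hfun, ← hfun]
      exact h.2 (mem_Xsym_iff.2 ⟨ψ, rfl⟩)
    · intro h
      refine ⟨mem_Xsym_iff.2 ⟨φ, rfl⟩, fun Ψ hΨ => ?_⟩
      obtain ⟨ψ, rfl⟩ := mem_Xsym_iff.1 hΨ
      simp only [Set.mem_ofPred_eq, hfun]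
      exact h ψ
  have hequiv : ∀ Φ, IsWeakSolution P γ (bdryFourier P φt) Φ ↔
      IsMinimizer P γ (bdryFourier P φt) Φ := fun Φ => by
    constructor <;> intro h <;> obtain ⟨φ, rfl⟩ := mem_Xsym_iff.1 h.1
    · exact (hmin φ).2 ((inner_eq_iff_forall_norm_sub_le A b φ).1 ((hweak φ).1 h))
    · exact (hweak φ).2 ((inner_eq_iff_forall_norm_sub_le A b φ).2 ((hmin φ).1 h))
  have hunique : ∃! Φ, IsWeakSolution P γ (bdryFourier P φt) Φ := by
    -- Uniqueness passes from densities to transforms because every element of `X_sym` comes from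
    -- some density. Injectivity of the Fourier transform plays no role.
    obtain ⟨φ, hφ, huniq⟩ := existsUnique_inner_eq A hc hcoer b
    refine ⟨bdryFourier P φ, (hweak φ).2 hφ, fun Φ hΦ => ?_⟩
    obtain ⟨φ', rfl⟩ := mem_Xsym_iff.1 hΦ.1
    rw [huniq φ' ((hweak φ').1 hΦ)]
  refine ⟨fun Φ hΦ Ψ hΨ i => ?_, fun Φ hΦ i => ?_, hunique, hequiv, ?_⟩
  · obtain ⟨φ, rfl⟩ := mem_Xsym_iff.1 hΦ
    obtain ⟨ψ, rfl⟩ := mem_Xsym_iff.1 hΨ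
    simp only [T_bdryFourier_eq_contourTrace]
    exact integrableOn_mul_conj (hM φ) (hM ψ) i
  · obtain ⟨φ, rfl⟩ := mem_Xsym_iff.1 hΦ
    simp only [T_sub_I_smul, T_bdryFourier_eq_contourTrace]
    exact (memLp_two_fiberMeasure_iff.1 ((hM φ).sub hMt) i).norm.integrable_sq
  · simpa only [hequiv] using hunique
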